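/- **Setting.** Let $N,m\ge 0$, $\eta\in\mathbb C\setminus\{0\}$, and let $\xi_1,\dots,\xi_N\in\mathbb C$ satisfy $\xi_a\ne\xi_b$ and $\xi_a\neq\xi_b\pm\eta$ for all $a\ne b$. On $(\mathbb C^2)^{\otimes N}$ consider the monodromy matrix $T_0(\lambda)=R_{0N}(\lambda-\xi_N)\cdots R_{01}(\lambda-\xi_1)$, where $R(u)=u\,\mathrm{Id}+\eta\,P$ on $\mathbb C^2\otimes\mathbb C^2$ ($P$ the permutation operator). Let $K=\begin{pmatrix}\mathsf a&\mathsf b\\ \mathsf c&\mathsf d\end{pmatrix}$ be an invertible complex matrix with $\mathsf b\ne0$, let $\mathsf k_1$ be an eigenvalue of $K$ (a root of its characteristic polynomial) and $\mathsf k_2=\det K/\mathsf k_1$, and write $$T^{(K)}_0(\lambda)=K_0T_0(\lambda)=\begin{pmatrix}A^{(K)}(\lambda)&B^{(K)}(\lambda)\\ C^{(K)}(\lambda)&D^{(K)}(\lambda)\end{pmatrix}.$$ Put $\bar T^{(K)}_{2,1}(\lambda)=[B^{(K)}(\lambda+\eta)]^{-1}A^{(K)}(\lambda+\eta)D^{(K)}(\lambda)$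 and $\bar T^{(K)}_{\epsilon,\epsilon'}(\lambda)=T^{(K)}_{\epsilon,\epsilon'}(\lambda)$ for the other $(\epsilon,\epsilon')\in\{1,2\}^2$. Let $a(\lambda)=\prod_n(\lambda-\xi_n+\eta)$, $d(\lambda)=\prod_n(\lambda-\xi_n)$ and, for $\mathbf h\in\{0,1\}^N$, $\xi_n^{(h_n)}=\xi_n-h_n\eta$, $d_{\mathbf h}(\lambda)=\prod_n(\lambda-\xi_n^{(h_n)})$. Let $V(x_1,\dots,x_N)=\prod_{i<j}(x_j-x_i)$, and $${}_K\langle\mathbf h|=\langle 0|\prod_{n=1}^N\Big(\frac{A^{(K)}(\xi_n)}{\mathsf k_1\,d(\xi_n-\eta)}\Big)^{h_n},\qquad \langle0|=\bigotimes_{n=1}^N(1,0)_n .$$ For $Q(\lambda)=\prod_{k=1}^R(\lambda-q_k)$ with $R\le N$ and $q_k\notin\{\xi_n,\xi_n-\eta\}$ for all $k,n$, let $${}_K\langle Q|=\sum_{\mathbf h}\prod_nQ(\xi_n^{(h_n)})\,V(\xi_1^{(h_1)},\dots,\xi_N^{(h_N)})\;{}_K\langle\mathbf h|$$ be the associated separate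 state. **Statement.** Let $\epsilon_1,\dots,\epsilon_{2m}\in\{1,2\}$, $\bar\epsilon_{2j}=\epsilon_{2j}-1$, $\bar\epsilon_{2j-1}=2-\epsilon_{2j-1}$, and let $\lambda_1,\dots,\lambda_m$ be complex numbers with $\lambda_j\notin\{\xi_n,\xi_n-\eta,\xi_n-2\eta\}$ for all $j,n$. Then $$\begin{aligned} &{}_K\langle Q|\,\bar T^{(K)}_{\epsilon_2,\epsilon_1}(\lambda_1)\cdots\bar T^{(K)}_{\epsilon_{2m},\epsilon_{2m-1}}(\lambda_m)=\sum_{\mathbf h}\prod_{j=1}^m[\mathsf b\,d_{\mathbf h}(\lambda_j)]\prod_{n=1}^NQ(\xi_n^{(h_n)})\\ &\times\prod_{j=m}^1\Bigg\{\Bigg[\Big(\frac{\mathsf d}{\mathsf b}\oint_{\mathcal C_\infty}+\frac{\mathsf k_2}{\mathsf b}\oint_{\Gamma_{2j}}\Big)\frac{dz_{2j}}{2\pi i(\lambda_j-z_{2j})}\frac{a(z_{2j})}{d_{\mathbf h}(z_{2j})}\frac{Q(z_{2j}-\eta)}{Q(z_{2j})}\prod_{k=1}^{j-1}\frac{z_{2j}-\lambda_k-\eta}{z_{2j}-\lambda_k}\Bigg]^{\bar\epsilon_{2j}}\\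 &\qquad\times\Bigg[\Big(\frac{\mathsf a}{\mathsf b}\oint_{\mathcal C_\infty}+\frac{\mathsf k_1}{\mathsf b}\oint_{\Gamma_{2j-1}}\Big)\frac{dz_{2j-1}}{2\pi i(\lambda_j-z_{2j-1})}\frac{d(z_{2j-1})}{d_{\mathbf h}(z_{2j-1})}\frac{Q(z_{2j-1}+\eta)}{Q(z_{2j-1})}\prod_{k=1}^{j-1}\frac{z_{2j-1}-\lambda_k+\eta}{z_{2j-1}-\lambda_k}\Bigg]^{\bar\epsilon_{2j-1}}\Bigg\}\\ &\times\prod_{1\le j<k\le2m}\Big(\frac{z_j-z_k}{z_j-z_k+(-1)^k\eta}\Big)^{\bar\epsilon_j\bar\epsilon_k}\;V(\xi_1^{(h_1)},\dots,\xi_N^{(h_N)})\;{}_K\langle\mathbf h| . \end{aligned}$$ Only the variables $z_i$ with $\bar\epsilon_i=1$ are present. The integrals are nested, $z_{2m}$ being the outermost variable and $z_1$ the innermost one, and the contours of $z_i$ may depend on the present $z_k$ with $k>i$. The formula holds for every choice of contours (finite unions of closed $C^1$ curves) with the following properties. * Let $\mathcal S_i$ be the finite set of the points $x+M\eta$, $M\in\mathbb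 Z$, $|M|\le 2m+1$, where $x$ is one of the $\xi_n$, $q_n$, $\lambda_1,\dots,\lambda_m$ or the present $z_k$ with $k>i$; it contains all finite poles in $z_i$ of the integrand, including those produced by the integrations over $z_1,\dots,z_{i-1}$. No contour of $z_i$ meets $\mathcal S_i$. * $\mathcal C_\infty$ surrounds counterclockwise the point at infinity and no finite pole: its winding number is $-1$ around each point of $\mathcal S_i$. * $\Gamma_{2j}$ has winding number $1$ around the points $\xi_n$, $1\le n\le N$, and the present $z_{2k-1}+\eta$, $k>j$, and winding number $0$ around the other points of $\mathcal S_{2j}$. * $\Gamma_{2j-1}$ has winding number $1$ around the points $\xi_n-\eta$, $1\le n\le N$, and the present $z_{2k}-\eta$, $k\ge j$, and winding number $0$ around the other points of $\mathcal S_{2j-1}$. For $m=1$ this is the action of a single operator, $$\begin{aligned} &{}_K\langle Q|\,\bar T^{(K)}_{\epsilon_2,\epsilon_1}(\lambda)=\sum_{\mathbf h}\mathsf b\,d_{\mathbf h}(\lambda)\prod_nQ(\xi_n^{(h_n)})\Bigg[\Big(\frac{\mathsf d}{\mathsf b}\oint_{\mathcal C_\infty}+\frac{\mathsf k_2}{\mathsf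 b}\oint_{\Gamma_2}\Big)\frac{dz_2}{2\pi i(\lambda-z_2)}\frac{a(z_2)}{d_{\mathbf h}(z_2)}\frac{Q(z_2-\eta)}{Q(z_2)}\Bigg]^{\epsilon_2-1}\\ &\times\Bigg[\Big(\frac{\mathsf a}{\mathsf b}\oint_{\mathcal C_\infty}+\frac{\mathsf k_1}{\mathsf b}\oint_{\Gamma_1}\Big)\frac{dz_1}{2\pi i(\lambda-z_1)}\frac{d(z_1)}{d_{\mathbf h}(z_1)}\frac{Q(z_1+\eta)}{Q(z_1)}\Bigg]^{2-\epsilon_1}\Big(\frac{z_1-z_2}{z_1-z_2+\eta}\Big)^{(2-\epsilon_1)(\epsilon_2-1)}V(\xi_1^{(h_1)},\dots,\xi_N^{(h_N)})\;{}_K\langle\mathbf h| , \end{aligned}$$ where $\Gamma_2$ surrounds the points $\xi_n$, and $\Gamma_1$ the points $\xi_n-\eta$ and, if $\epsilon_2=2$, the point $z_2-\eta$. -/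

import Mathlib

open scoped Matrix

namespace TwistedXXX

noncomputable section

/-! ### The monodromy matrix -/

/-- Configurations of the chain; the value `0` at a site is the vector `(1, 0)`, the value `1` is
`(0, 1)`. The quantum space is `Config N → ℂ`, with bras written as row vectors. -/
abbrev Config (N : ℕ) := Fin N → Fin 2

/-- Operators on the quantum space. -/
abbrev Op (N : ℕ) := Matrix (Config N) (Config N) ℂ

/-- The `R`-matrix on `ℂ² ⊗ ℂ²`, in the ordered basis `00, 01, 10, 11`. -/
def RMatrix (η u : ℂ) : Matrix (Fin 2 × Fin 2) (Fin 2 × Fin 2) ℂ := fun p r =>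
  if p = r then (if p.1 = p.2 then u + η else u)
  else if p.1 = r.2 ∧ p.2 = r.1 then η else 0

/-- The `2 × 2` matrix `X` acting on the site `n` of the chain. -/
def siteOp {N : ℕ} (n : Fin N) (X : Matrix (Fin 2) (Fin 2) ℂ) : Op N := fun s t =>
  if ∀ k, k ≠ n → s k = t k then X (s n) (t n) else 0

/-- `R_{0n}(u)`, as a `2 × 2` matrix in the auxiliary space `0` with entries acting on site `n`. -/
def lax {N : ℕ} (η u : ℂ) (n : Fin N) : Matrix (Fin 2) (Fin 2) (Op N) := fun i j =>
  siteOp n (fun k l => RMatrix η u (i, k) (j, l))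

/-- The monodromy matrix `T₀(u) = R_{0N}(u - ξ_N) ⋯ R_{01}(u - ξ_1)`. -/
def monodromy {N : ℕ} (η : ℂ) (ξ : Fin N → ℂ) (u : ℂ) : Matrix (Fin 2) (Fin 2) (Op N) :=
  (List.ofFn (fun n : Fin N => lax η (u - ξ n) n)).reverse.prod

/-- The twisted monodromy matrix `K₀ T₀(u)`. -/
def twistedMonodromy {N : ℕ} (η : ℂ) (ξ : Fin N → ℂ) (K : Matrix (Fin 2) (Fin 2) ℂ) (u : ℂ) :
    Matrix (Fin 2) (Fin 2) (Op N) := fun i j => ∑ l, K i l • monodromy η ξ u l j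

/-- The operators `T̄^{(K)}_{ε,ε'}(u)`. The index values `1`, `2` are coded by `0`, `1`, so that the
exceptional entry `(2, 1)` is coded by `(1, 0)`: it is
`[B^{(K)}(u + η)]⁻¹ A^{(K)}(u + η) D^{(K)}(u)`. -/
def Tbar {N : ℕ} (η : ℂ) (ξ : Fin N → ℂ) (K : Matrix (Fin 2) (Fin 2) ℂ) (e e' : Fin 2) (u : ℂ) :
    Op N :=
  if e = 1 ∧ e' = 0 then
    (twistedMonodromy η ξ K (u + η) 0 1)⁻¹ * twistedMonodromy η ξ K (u + η) 0 0
      * twistedMonodromy η ξ K u 1 1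
  else twistedMonodromy η ξ K u e e'

/-- `T̄^{(K)}_{ε₂,ε₁}(λ₁) T̄^{(K)}_{ε₄,ε₃}(λ₂) ⋯ T̄^{(K)}_{ε_{2m},ε_{2m-1}}(λ_m)`. -/
def TbarProd {N : ℕ} (η : ℂ) (ξ : Fin N → ℂ) (K : Matrix (Fin 2) (Fin 2) ℂ) (m : ℕ)
    (ε : ℕ → Fin 2) (lam : ℕ → ℂ) : Op N :=
  ((List.range m).map (fun j =>
    Tbar η ξ K (ε (2 * (j + 1))) (ε (2 * (j + 1) - 1)) (lam (j + 1)))).prod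

/-! ### The separated basis and separate states -/

/-- `a(u) = ∏ (u - ξ_n + η)`. -/
def aFun {N : ℕ} (η : ℂ) (ξ : Fin N → ℂ) (u : ℂ) : ℂ := ∏ n, (u - ξ n + η)

/-- `d(u) = ∏ (u - ξ_n)`. -/
def dFun {N : ℕ} (ξ : Fin N → ℂ) (u : ℂ) : ℂ := ∏ n, (u - ξ n)

/-- `ξ_n^{(h_n)} = ξ_n - h_n η`. -/
def shifted {N : ℕ} (η : ℂ) (ξ : Fin N → ℂ) (h : Config N) (n : Fin N) : ℂ :=
  ξ n - ((h n : ℕ) : ℂ) * η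

/-- `d_h(u) = ∏ (u - ξ_n^{(h_n)})`. -/
def dh {N : ℕ} (η : ℂ) (ξ : Fin N → ℂ) (h : Config N) (u : ℂ) : ℂ := ∏ n, (u - shifted η ξ h n)

/-- `V(x_1, …, x_N) = ∏_{i < j} (x_j - x_i)`. -/
def vandermondeProd {N : ℕ} (x : Fin N → ℂ) : ℂ := ∏ i, ∏ j ∈ Finset.Ioi i, (x j - x i)

/-- The bra `⟨0| = ⊗ (1, 0)`. -/
def braZero (N : ℕ) : Config N → ℂ := Pi.single 0 1

/-- The bra `_K⟨h| = ⟨0| ∏ₙ (A^{(K)}(ξ_n) / (k₁ d(ξ_n - η)))^{h_n}`. -/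
def bra {N : ℕ} (η : ℂ) (ξ : Fin N → ℂ) (K : Matrix (Fin 2) (Fin 2) ℂ) (k₁ : ℂ) (h : Config N) :
    Config N → ℂ :=
  braZero N ᵥ* (List.ofFn (fun n : Fin N =>
    ((k₁ * dFun ξ (ξ n - η))⁻¹ • twistedMonodromy η ξ K (ξ n) 0 0) ^ (h n : ℕ))).prod

/-- `Q(u) = ∏ (u - q_k)`. -/
def QFun {R : ℕ} (q : Fin R → ℂ) (u : ℂ) : ℂ := ∏ k, (u - q k)

/-- The separate state `_K⟨Q| = ∑_h ∏ₙ Q(ξ_n^{(h_n)}) V(ξ_1^{(h_1)}, …, ξ_N^{(h_N)}) _K⟨h|`. -/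
def separateState {N R : ℕ} (η : ℂ) (ξ : Fin N → ℂ) (K : Matrix (Fin 2) (Fin 2) ℂ) (k₁ : ℂ)
    (q : Fin R → ℂ) : Config N → ℂ :=
  ∑ h : Config N, ((∏ n, QFun q (shifted η ξ h n)) * vandermondeProd (shifted η ξ h)) •
    bra η ξ K k₁ h

/-! ### Contours -/

/-- A closed `C¹` curve, parametrized by `[0, 1]`. It may stop, so that curves with corners are
covered. -/
structure ClosedCurve where
  toFun : ℝ → ℂ
  contDiff : ContDiff ℝ 1 toFun
  closed : toFun 0 = toFun 1

/-- A contour: finitely many closed curves. -/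
abbrev Contour := List ClosedCurve

/-- The set of points on the contour. -/
def Contour.support (Γ : Contour) : Set ℂ :=
  {w | ∃ γ ∈ Γ, ∃ t ∈ Set.Icc (0 : ℝ) 1, γ.toFun t = w}

/-- The normalized contour integral `∮_Γ f(z) dz / (2πi)`. -/
def Contour.integral (Γ : Contour) (f : ℂ → ℂ) : ℂ :=
  (2 * (Real.pi : ℂ) * Complex.I)⁻¹ *
    (Γ.map (fun γ => ∫ t in (0 : ℝ)..1, f (γ.toFun t) * deriv γ.toFun t)).sum

/-- The winding number of the contour around a point off the contour. -/
def Contour.winding (Γ : Contour) (p : ℂ) : ℂ := Γ.integral (fun z => (z - p)⁻¹)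

/-- `Γ` surrounds once counterclockwise the points of `P`, and no other point of `S`. -/
def Contour.Surrounds (Γ : Contour) (P S : Set ℂ) : Prop :=
  (∀ p ∈ P ∪ S, p ∉ Γ.support) ∧ (∀ p ∈ P, Γ.winding p = 1) ∧ ∀ p ∈ S \ P, Γ.winding p = 0

/-- `Γ` surrounds once counterclockwise the point at infinity, and no point of `S`: seen from the
finite plane it winds once clockwise around all of `S`. -/
def Contour.SurroundsInfinity (Γ : Contour) (S : Set ℂ) : Prop :=
  ∀ p ∈ S, p ∉ Γ.support ∧ Γ.winding p = -1

/-! ### The multiple contour integral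

The variables are `z 1, …, z (2 * m)`; only those with `ebar ε i = 1` are present. The variable
`z (2 * m)` is the outermost one, and the contours for `z i` depend on the present `z k`, `k > i`. -/

/-- `ε̄_{2j} = ε_{2j} - 1` and `ε̄_{2j-1} = 2 - ε_{2j-1}`, where the values `1`, `2` of `ε` are coded
by `0`, `1`. -/
def ebar (ε : ℕ → Fin 2) (i : ℕ) : ℕ := if Even i then (ε i : ℕ) else 1 - (ε i : ℕ)

/-- The factor of the integrand attached to the variable `z (2 * j)`. -/
def evenFactor {N R : ℕ} (η : ℂ) (ξ : Fin N → ℂ) (q : Fin R → ℂ) (lam : ℕ → ℂ) (h : Config N)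
    (j : ℕ) (w : ℂ) : ℂ :=
  1 / (lam j - w) * (aFun η ξ w / dh η ξ h w) * (QFun q (w - η) / QFun q w) *
    ∏ k ∈ Finset.Ico 1 j, (w - lam k - η) / (w - lam k)

/-- The factor of the integrand attached to the variable `z (2 * j - 1)`. -/
def oddFactor {N R : ℕ} (η : ℂ) (ξ : Fin N → ℂ) (q : Fin R → ℂ) (lam : ℕ → ℂ) (h : Config N)
    (j : ℕ) (w : ℂ) : ℂ :=
  1 / (lam j - w) * (dFun ξ w / dh η ξ h w) * (QFun q (w + η) / QFun q w) *
    ∏ k ∈ Finset.Ico 1 j, (w - lam k + η) / (w - lam k)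

/-- The full integrand, without the weights. -/
def integrand {N R : ℕ} (η : ℂ) (ξ : Fin N → ℂ) (q : Fin R → ℂ) (m : ℕ) (ε : ℕ → Fin 2)
    (lam : ℕ → ℂ) (h : Config N) (z : ℕ → ℂ) : ℂ :=
  (∏ j ∈ Finset.Icc 1 m,
    evenFactor η ξ q lam h j (z (2 * j)) ^ ebar ε (2 * j) *
      oddFactor η ξ q lam h j (z (2 * j - 1)) ^ ebar ε (2 * j - 1)) *
  ∏ k ∈ Finset.Icc 1 (2 * m), ∏ j ∈ Finset.Ico 1 k,
    ((z j - z k) / (z j - z k + (-1) ^ k * η)) ^ (ebar ε j * ebar ε k)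

/-- The weight of the contour at infinity: `d/b` for even variables, `a/b` for odd ones. -/
def weightInf (K : Matrix (Fin 2) (Fin 2) ℂ) (i : ℕ) : ℂ :=
  if Even i then K 1 1 / K 0 1 else K 0 0 / K 0 1

/-- The weight of the contour `Γ_i`: `k₂/b` for even variables, `k₁/b` for odd ones. -/
def weightFin (K : Matrix (Fin 2) (Fin 2) ℂ) (k₁ k₂ : ℂ) (i : ℕ) : ℂ :=
  if Even i then k₂ / K 0 1 else k₁ / K 0 1

/-- Integration of `F` over the present variables among `z 1, …, z i`, where `z (i + 1), …` already
have their values: the variable `z i` is integrated with `wInf i ∮_{C i z} + wFin i ∮_{Γ i z}`. -/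
def nestedIntegral (ε : ℕ → Fin 2) (wInf wFin : ℕ → ℂ) (C Γ : ℕ → (ℕ → ℂ) → Contour)
    (F : (ℕ → ℂ) → ℂ) : ℕ → (ℕ → ℂ) → ℂ
  | 0, z => F z
  | i + 1, z =>
    if ebar ε (i + 1) = 0 then nestedIntegral ε wInf wFin C Γ F i z
    else
      wInf (i + 1) * (C (i + 1) z).integral
          (fun w => nestedIntegral ε wInf wFin C Γ F i (Function.update z (i + 1) w)) +
        wFin (i + 1) * (Γ (i + 1) z).integral
          (fun w => nestedIntegral ε wInf wFin C Γ F i (Function.update z (i + 1) w))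

/-- The points that `Γ_i` has to surround: the `ξ_n` and the present `z_k + η` with `k > i` odd if
`i` is even; the `ξ_n - η` and the present `z_k - η` with `k > i` even if `i` is odd. -/
def insidePoints {N : ℕ} (η : ℂ) (ξ : Fin N → ℂ) (m : ℕ) (ε : ℕ → Fin 2) (i : ℕ) (z : ℕ → ℂ) :
    Set ℂ :=
  if Even i then
    Set.range ξ ∪ {w | ∃ k, i < k ∧ k ≤ 2 * m ∧ Odd k ∧ ebar ε k = 1 ∧ w = z k + η}
  else
    Set.range (fun n => ξ n - η) ∪
      {w | ∃ k, i < k ∧ k ≤ 2 * m ∧ Even k ∧ ebar ε k = 1 ∧ w = z k - η}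

/-- A finite set that contains every pole, in the variable `z i`, of the integrand and of what it
becomes after integration over `z 1, …, z (i - 1)`: the points `x + M η` with `|M| ≤ 2 m + 1`, where
`x` is a `ξ_n`, a `q_n`, a `λ_l` or a present `z k` with `k > i`. (An inner contour around
`z i ± η` moves the poles in `z i` by `∓ η`, at most once for each inner variable.) -/
def polePoints {N R : ℕ} (η : ℂ) (ξ : Fin N → ℂ) (q : Fin R → ℂ) (m : ℕ) (ε : ℕ → Fin 2)
    (lam : ℕ → ℂ) (i : ℕ) (z : ℕ → ℂ) : Set ℂ :=
  {w | ∃ M : ℤ, |M| ≤ 2 * (m : ℤ) + 1 ∧ ∃ x : ℂ, w = x + (M : ℂ) * η ∧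
    ((∃ n, x = ξ n) ∨ (∃ n, x = q n) ∨ (∃ l, 1 ≤ l ∧ l ≤ m ∧ x = lam l) ∨
      ∃ k, i < k ∧ k ≤ 2 * m ∧ ebar ε k = 1 ∧ x = z k)}

end

end TwistedXXX

namespace TwistedXXX

open Filter Topology

noncomputable section

/-! ### Contour integrals of products of simple fractions -/

namespace Contour

/-! The bras ⟨h| diagonalise B: the eigenvalue of B(u) is b d_h(u), and at its zeros ξ_n^{(h_n)} the
operators A and D act as ladder operators. A raises h_n = 0 to 1 and annihilates the bra if h_n = 1;
D lowers h_n = 1 to 0 and annihilates it if h_n = 0. This follows from the RTT relation, the quantum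
determinant, the identity A(ξ_n) A(ξ_n - η) = 0 and the reference state. Since A and D are
polynomials of degree at most N whose coefficients of u^N are the scalars a and d, interpolation at
the N points ξ_n^{(h_n)} gives their action at every λ. On a state with coefficients f(h)
V(ξ^{(h)}), D(λ) replaces f(h) by d_h(λ) (d f(h) + k₂ ∑_n w_n f(h with h_n := 1)), the Vandermonde
factor absorbing the interpolation denominators; A(λ) acts in the same way with a, k₁ and h_n := 0
(`Regular.stateOf_vecMul`). The combination B(λ + η)⁻¹ A(λ + η) acts as A(λ) divided by b d_h(λ), so
that each of the four operators contributes the factor b d_h(λ) exactly once.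

The nested integral obeys the same recursion in its outermost variable (`Params.inner_top`). The
contour at infinity produces the limit z_i → ∞, where all pair factors tend to 1 and z_i disappears.
The finite contour produces the residues of a/d_h or d/d_h at the sites of the chain. At such a
point the pair factors with the inner variables turn d_h into d_{h'}, where h' is h with the site n
flipped, so that the remaining integral is the one for h'. The Q-ratio and the λ_k-ratios become the
quotient of the explicit prefactors at h' and at h (`Params.Generic.prefactor_flip`). Each further
operator on the right thus amounts to new outermost variables, and induction on the number of
operators gives the formula.

The care goes into the integrations, because the contours are arbitrary and move with the outer
variables. All integrands are rational, so by partial fractions the integrals depend only on winding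
numbers. In the coordinates x_k = z_k + sh_k, with sh_k = 0 for even k and η for odd k, the points
to be surrounded are the ξ_n and the outer x_k of opposite parity, whereas all other poles are
constants of `outConsts` or points x_k ± η. Inverse differences of an inside and an outside point
are constants or have, up to sign, the form 1/(x_k - o) or 1/(x_k - x_l ± η). Hence an inner
integral is a rational function of the outer variables with outside poles only
(`Params.exists_inner_eq`), it commutes with the limit of an outer variable to infinity
(`Params.tendsto_inner`), and an outer coordinate may be set equal to ξ_n in it
(`Params.inner_eq_inner_flip`). -/

theorem toFun_mem_support {Γ : Contour} {γ : ClosedCurve} (hγ : γ ∈ Γ) {t : ℝ}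
    (ht : t ∈ Set.Icc (0 : ℝ) 1) : γ.toFun t ∈ Γ.support := ⟨γ, hγ, t, ht, rfl⟩

theorem integral_congr {Γ : Contour} {f g : ℂ → ℂ} (h : ∀ w ∈ Γ.support, f w = g w) :
    Γ.integral f = Γ.integral g := by
  unfold integral
  congr 2
  refine List.map_congr_left fun γ hγ => ?_
  refine intervalIntegral.integral_congr fun t ht => ?_
  rw [Set.uIcc_of_le zero_le_one] at ht
  simp only [h _ (toFun_mem_support hγ ht)]

theorem integral_const_mul (Γ : Contour) (c : ℂ) (f : ℂ → ℂ) :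
    Γ.integral (fun w => c * f w) = c * Γ.integral f := by
  unfold integral
  simp only [mul_assoc, intervalIntegral.integral_const_mul, List.sum_map_mul_left]
  ring

theorem integral_zero (Γ : Contour) : Γ.integral (fun _ => 0) = 0 := by
  simpa using integral_const_mul Γ 0 (fun _ => 0)

theorem intervalIntegrable_curve {Γ : Contour} {f : ℂ → ℂ} (hf : ContinuousOn f Γ.support)
    {γ : ClosedCurve} (hγ : γ ∈ Γ) :
    IntervalIntegrable (fun t => f (γ.toFun t) * deriv γ.toFun t) MeasureTheory.volume 0 1 := by
  refine ContinuousOn.intervalIntegrable ?_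
  rw [Set.uIcc_of_le zero_le_one]
  refine ContinuousOn.mul ?_ (γ.contDiff.continuous_deriv le_rfl).continuousOn
  exact hf.comp γ.contDiff.continuous.continuousOn fun t ht => toFun_mem_support hγ ht

theorem integral_add {Γ : Contour} {f g : ℂ → ℂ} (hf : ContinuousOn f Γ.support)
    (hg : ContinuousOn g Γ.support) :
    Γ.integral (fun w => f w + g w) = Γ.integral f + Γ.integral g := by
  unfold integral
  rw [← mul_add, ← List.sum_map_add]
  congr 2
  refine List.map_congr_left fun γ hγ => ?_
  simp only [add_mul]
  exact intervalIntegral.integral_add (intervalIntegrable_curve hf hγ)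
    (intervalIntegrable_curve hg hγ)

theorem integral_mul_add {Γ : Contour} {u f g : ℂ → ℂ} (hu : ContinuousOn u Γ.support)
    (hf : ContinuousOn f Γ.support) (hg : ContinuousOn g Γ.support) :
    Γ.integral (fun w => u w * (f w + g w)) =
      Γ.integral (fun w => u w * f w) + Γ.integral (fun w => u w * g w) := by
  simp only [mul_add]
  exact integral_add (hu.mul hf) (hu.mul hg)

theorem integral_sub {Γ : Contour} {f g : ℂ → ℂ} (hf : ContinuousOn f Γ.support)
    (hg : ContinuousOn g Γ.support) :
    Γ.integral (fun w => f w - g w) = Γ.integral f - Γ.integral g := by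
  have h := integral_add hf (g := fun w => -1 * g w) (continuousOn_const.mul hg)
  rw [integral_const_mul] at h
  simpa [sub_eq_add_neg] using h

theorem integral_sum {ι : Type*} {Γ : Contour} (s : Finset ι) {f : ι → ℂ → ℂ}
    (hf : ∀ i ∈ s, ContinuousOn (f i) Γ.support) :
    Γ.integral (fun w => ∑ i ∈ s, f i w) = ∑ i ∈ s, Γ.integral (f i) := by
  classical
  induction s using Finset.induction_on with
  | empty => simpa using integral_zero Γ
  | insert i s his ih =>
    simp only [Finset.sum_insert his]
    rw [integral_add (hf i (by simp))
      (continuousOn_finsetSum _ fun j hj => hf j (Finset.mem_insert_of_mem hj)),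
      ih fun j hj => hf j (Finset.mem_insert_of_mem hj)]

/-- The fundamental theorem of calculus on each closed curve. No form of Cauchy's theorem is needed
beyond this: partial fractions reduce rational integrands to functions with a primitive and to 1 /
(w - p), whose integral is the winding number. -/
theorem integral_eq_zero_of_hasDerivAt {Γ : Contour} {F f : ℂ → ℂ}
    (hf : ContinuousOn f Γ.support) (h : ∀ w ∈ Γ.support, HasDerivAt F (f w) w) :
    Γ.integral f = 0 := by
  unfold integral
  rw [mul_eq_zero]
  right
  refine List.sum_eq_zero fun x hx => ?_
  obtain ⟨γ, hγ, rfl⟩ := List.mem_map.1 hx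
  have hd : ∀ t ∈ Set.uIcc (0 : ℝ) 1,
      HasDerivAt (F ∘ γ.toFun) (f (γ.toFun t) * deriv γ.toFun t) t := by
    intro t ht
    rw [Set.uIcc_of_le zero_le_one] at ht
    have h1 := (γ.contDiff.differentiable one_ne_zero t).hasDerivAt
    have h2 := (h _ (toFun_mem_support hγ ht)).scomp t h1
    simpa [mul_comm] using h2
  rw [intervalIntegral.integral_eq_sub_of_hasDerivAt hd (intervalIntegrable_curve hf hγ)]
  simp [γ.closed]

end Contour

/-- `∏ 1 / (w - p)` over the list `L`. -/
def invProd (L : List ℂ) (w : ℂ) : ℂ := (L.map fun p => (w - p)⁻¹).prod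

@[simp] theorem invProd_nil (w : ℂ) : invProd [] w = 1 := rfl

@[simp] theorem invProd_cons (p : ℂ) (L : List ℂ) (w : ℂ) :
    invProd (p :: L) w = (w - p)⁻¹ * invProd L w := by simp [invProd]

theorem invProd_append (L M : List ℂ) (w : ℂ) :
    invProd (L ++ M) w = invProd L w * invProd M w := by simp [invProd]

theorem invProd_perm {L M : List ℂ} (h : L.Perm M) : invProd L = invProd M := by
  funext w
  exact (h.map _).prod_eq

theorem continuousOn_invProd {s : Set ℂ} {L : List ℂ} (h : ∀ p ∈ L, p ∉ s) :
    ContinuousOn (invProd L) s := by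
  induction L with
  | nil => exact continuousOn_const
  | cons p L ih =>
    have : invProd (p :: L) = fun w => (w - p)⁻¹ * invProd L w := by funext w; simp
    rw [this]
    refine ContinuousOn.mul (ContinuousOn.inv₀ (by fun_prop) fun w hw => ?_)
      (ih fun q hq => h q (by simp [hq]))
    exact sub_ne_zero.2 fun e => h p (by simp) (e ▸ hw)

theorem invProd_cons_cons {a b : ℂ} (hab : a ≠ b) (L : List ℂ) {w : ℂ} (ha : w ≠ a)
    (hb : w ≠ b) :
    invProd (a :: b :: L) w = (a - b)⁻¹ * (invProd (a :: L) w - invProd (b :: L) w) := by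
  have h1 := sub_ne_zero.2 hab
  have h2 := sub_ne_zero.2 ha
  have h3 := sub_ne_zero.2 hb
  simp only [invProd_cons]
  field_simp
  ring

namespace Contour

theorem integral_invProd_cons_cons {Γ : Contour} {a b : ℂ} (hab : a ≠ b) {L : List ℂ}
    (h : ∀ p ∈ a :: b :: L, p ∉ Γ.support) :
    Γ.integral (invProd (a :: b :: L)) =
      (a - b)⁻¹ * (Γ.integral (invProd (a :: L)) - Γ.integral (invProd (b :: L))) := by
  rw [← integral_sub, ← integral_const_mul]
  · refine integral_congr fun w hw => invProd_cons_cons hab L ?_ ?_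
    · exact fun e => h a (by simp) (e ▸ hw)
    · exact fun e => h b (by simp) (e ▸ hw)
  · exact continuousOn_invProd fun p hp => h p (by simp at hp ⊢; tauto)
  · exact continuousOn_invProd fun p hp => h p (by simp at hp ⊢; tauto)

theorem integral_one (Γ : Contour) : Γ.integral (invProd []) = 0 :=
  integral_eq_zero_of_hasDerivAt (F := id) continuousOn_const fun w _ => hasDerivAt_id w

theorem integral_invProd_replicate {Γ : Contour} {a : ℂ} (ha : a ∉ Γ.support) (n : ℕ) :
    Γ.integral (invProd (List.replicate (n + 2) a)) = 0 := by
  refine integral_eq_zero_of_hasDerivAt (F := fun w => -((n : ℂ) + 1)⁻¹ * ((w - a) ^ (n + 1))⁻¹)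
    (continuousOn_invProd fun p hp => (List.eq_of_mem_replicate hp) ▸ ha) fun w hw => ?_
  have hwa : w - a ≠ 0 := sub_ne_zero.2 fun e => ha (e ▸ hw)
  have h1 : HasDerivAt (fun w : ℂ => (w - a) ^ (n + 1)) (((n : ℂ) + 1) * (w - a) ^ n) w := by
    simpa using ((hasDerivAt_id' w).sub_const a).fun_pow (n + 1)
  have h2 := (h1.fun_inv (pow_ne_zero _ hwa)).const_mul (-((n : ℂ) + 1)⁻¹)
  have h3 : (n : ℂ) + 1 ≠ 0 := by exact_mod_cast n.succ_ne_zero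
  refine h2.congr_deriv ?_
  rw [invProd, List.map_replicate, List.prod_replicate, inv_pow]
  field_simp
  ring

/-- If all the poles have the same winding number, then only a single simple pole contributes. -/
theorem integral_invProd_of_winding_eq {Γ : Contour} {c : ℂ} (L : List ℂ)
    (h : ∀ p ∈ L, p ∉ Γ.support ∧ Γ.winding p = c) :
    Γ.integral (invProd L) = if L.length = 1 then c else 0 := by
  induction hn : L.length using Nat.strong_induction_on generalizing L with
  | _ n ih =>
  match L, hn with
  | [], hn => subst hn; simpa using integral_one Γ
  | [a], hn =>
    subst hn
    have := (h a (by simp)).2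
    have he : invProd [a] = fun w => (w - a)⁻¹ := by funext w; simp
    simpa [winding, he] using this
  | a :: a' :: M, hn =>
    subst hn
    simp only [List.length_cons]
    rw [if_neg (by omega)]
    -- If all poles coincide, the integrand is a power of order at least 2 and has a primitive.
    -- Otherwise two distinct poles are separated by partial fractions; the two shorter integrals
    -- have equal values by induction, so their difference vanishes.
    by_cases hall : ∀ b ∈ a' :: M, b = a
    · have : a :: a' :: M = List.replicate (M.length + 2) a := by
        rw [List.eq_replicate_iff]
        refine ⟨rfl, ?_⟩
        intro b hb
        rcases List.mem_cons.1 hb with rfl | hb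
        · rfl
        · exact hall b hb
      rw [this]
      exact integral_invProd_replicate (h a (by simp)).1 _
    · push Not at hall
      obtain ⟨b, hb, hba⟩ := hall
      have hp : (a :: a' :: M).Perm (a :: b :: (a' :: M).erase b) :=
        (List.perm_cons_erase hb).cons a
      have hlen : ((a' :: M).erase b).length = M.length := by
        rw [List.length_erase_of_mem hb]; simp
      have h' : ∀ p ∈ a :: b :: (a' :: M).erase b, p ∉ Γ.support ∧ Γ.winding p = c :=
        fun p hp' => h p (hp.mem_iff.2 hp')
      rw [invProd_perm hp, integral_invProd_cons_cons (Ne.symm hba) fun p hp' => (h' p hp').1,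
        ih (M.length + 1) (by simp) (a :: (a' :: M).erase b)
          (fun p hp' => h' p (by simp at hp' ⊢; tauto)) (by simp [hlen]),
        ih (M.length + 1) (by simp) (b :: (a' :: M).erase b)
          (fun p hp' => h' p (by simp at hp' ⊢; tauto)) (by simp [hlen])]
      simp

end Contour

/-- The sum of the residues at the points of `A` of `∏_{A} 1 / (w - a) ∏_{B} 1 / (w - b)`. -/
def residueSum : List ℂ → List ℂ → ℂ
  | [], _ => 0
  | [_], [] => 1
  | _ :: _ :: _, [] => 0
  | a :: A, b :: B => (a - b)⁻¹ * (residueSum (a :: A) B - residueSum A (b :: B))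
termination_by A B => A.length + B.length

theorem residueSum_nil (B : List ℂ) : residueSum [] B = 0 := by rw [residueSum]

theorem residueSum_cons_cons (a b : ℂ) (A B : List ℂ) :
    residueSum (a :: A) (b :: B) =
      (a - b)⁻¹ * (residueSum (a :: A) B - residueSum A (b :: B)) := by rw [residueSum]

theorem residueSum_right_nil (A : List ℂ) :
    residueSum A [] = if A.length = 1 then 1 else 0 := by
  match A with
  | [] => simp [residueSum]
  | [_] => simp [residueSum]
  | _ :: _ :: _ => simp [residueSum]

/-- Partial fractions are only taken for a pair with one pole from each list. Such poles differ
because their winding numbers do, whatever coincidences occur inside `A` or inside `B`. The value is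
therefore an expression in the differences a - b alone, and collisions within one list cause no
singularity. -/
theorem Contour.integral_invProd_append {Γ : Contour} (A B : List ℂ)
    (hA : ∀ p ∈ A, p ∉ Γ.support ∧ Γ.winding p = 1)
    (hB : ∀ p ∈ B, p ∉ Γ.support ∧ Γ.winding p = 0) :
    Γ.integral (invProd (A ++ B)) = residueSum A B := by
  match A, B with
  | [], B =>
    rw [residueSum_nil, List.nil_append, Contour.integral_invProd_of_winding_eq B hB]
    simp
  | a :: A, [] =>
    rw [List.append_nil, Contour.integral_invProd_of_winding_eq _ hA, residueSum_right_nil]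
  | a :: A, b :: B =>
    have hab : a ≠ b := by
      rintro rfl
      have h1 := (hA a (by simp)).2
      rw [(hB a (by simp)).2] at h1
      exact zero_ne_one h1
    have hp : (a :: A ++ b :: B).Perm (a :: b :: (A ++ B)) := by
      simp [(List.perm_middle (a := b) (l₁ := A) (l₂ := B))]
    have hp' : (A ++ b :: B).Perm (b :: (A ++ B)) := List.perm_middle
    rw [invProd_perm hp, Contour.integral_invProd_cons_cons hab, residueSum_cons_cons,
      ← List.cons_append, Contour.integral_invProd_append (a :: A) B hA
        fun p hp => hB p (by simp [hp]), ← invProd_perm hp',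
      Contour.integral_invProd_append A (b :: B) (fun p hp => hA p (by simp [hp])) hB]
    intro p hp
    simp only [List.mem_cons, List.mem_append] at hp
    rcases hp with rfl | rfl | hp | hp
    · exact (hA _ (by simp)).1
    · exact (hB _ (by simp)).1
    · exact (hA _ (by simp [hp])).1
    · exact (hB _ (by simp [hp])).1
termination_by A.length + B.length

/-! ### Existence of contours -/

/-- The circle around `c` of radius `r`, run through once in the direction given by `σ = ± 1`. -/
def circleCurve (c : ℂ) (r : ℝ) (σ : ℤ) : ClosedCurve where
  toFun t := c + r * Complex.exp (2 * Real.pi * Complex.I * σ * t)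
  contDiff := by
    refine contDiff_const.add (contDiff_const.mul (ContDiff.cexp ?_))
    exact contDiff_const.mul Complex.ofRealCLM.contDiff
  closed := by
    have h : Complex.exp (2 * Real.pi * Complex.I * σ) = 1 := by
      rw [Complex.exp_eq_one_iff]
      exact ⟨σ, by ring⟩
    simp [h]

theorem hasDerivAt_circleCurve (c : ℂ) (r : ℝ) (σ : ℤ) (t : ℝ) :
    HasDerivAt (circleCurve c r σ).toFun
      (2 * Real.pi * Complex.I * σ * ((circleCurve c r σ).toFun t - c)) t := by
  have h1 : HasDerivAt (fun t : ℝ => 2 * Real.pi * Complex.I * σ * (t : ℂ))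
      (2 * Real.pi * Complex.I * σ) t := by
    simpa using (Complex.ofRealCLM.hasDerivAt (x := t)).const_mul (2 * Real.pi * Complex.I * σ)
  have h2 := (h1.cexp.const_mul (r : ℂ)).const_add c
  refine h2.congr_deriv ?_
  simp only [circleCurve]
  ring

theorem norm_circleCurve_sub (c : ℂ) {r : ℝ} (hr : 0 < r) (σ : ℤ) (t : ℝ) :
    ‖(circleCurve c r σ).toFun t - c‖ = r := by
  have : (2 * Real.pi * Complex.I * σ * t : ℂ) = ((2 * Real.pi * σ * t : ℝ) : ℂ) * Complex.I := by
    push_cast; ring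
  simp only [circleCurve, add_sub_cancel_left, norm_mul, this, Complex.norm_exp_ofReal_mul_I]
  simp [abs_of_pos hr]

theorem integral_circleCurve_center (c : ℂ) {r : ℝ} (hr : 0 < r) (σ : ℤ) :
    ∫ t in (0 : ℝ)..1, ((circleCurve c r σ).toFun t - c)⁻¹ * deriv (circleCurve c r σ).toFun t =
      2 * Real.pi * Complex.I * σ := by
  have : ∀ t : ℝ, ((circleCurve c r σ).toFun t - c)⁻¹ * deriv (circleCurve c r σ).toFun t =
      2 * Real.pi * Complex.I * σ := by
    intro t
    have h : (circleCurve c r σ).toFun t - c ≠ 0 := by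
      rw [← norm_pos_iff, norm_circleCurve_sub c hr]; exact hr
    rw [(hasDerivAt_circleCurve c r σ t).deriv]
    field_simp
  simp [this]

/-- The quotient (γ - p) / (c - p) stays in the open unit disc around 1, hence in the slit plane, so
its logarithm is a primitive along the curve. -/
theorem integral_circleCurve_outside (c : ℂ) {r : ℝ} (hr : 0 < r) (σ : ℤ) {p : ℂ}
    (hp : r < ‖c - p‖) :
    ∫ t in (0 : ℝ)..1, ((circleCurve c r σ).toFun t - p)⁻¹ * deriv (circleCurve c r σ).toFun t =
      0 := by
  set γ := circleCurve c r σ with hγ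
  have hcp : c - p ≠ 0 := norm_pos_iff.1 (hr.trans hp)
  have hslit : ∀ t, (γ.toFun t - p) / (c - p) ∈ Complex.slitPlane := by
    intro t
    have h := Complex.mem_slitPlane_of_norm_lt_one (z := (γ.toFun t - c) / (c - p)) (by
      rw [norm_div, norm_circleCurve_sub c hr, div_lt_one (norm_pos_iff.2 hcp)]; exact hp)
    convert h using 1
    field_simp
    ring
  have hne : ∀ t, γ.toFun t - p ≠ 0 := fun t h0 => by
    have := hslit t
    rw [h0, zero_div] at this
    exact Complex.slitPlane_ne_zero this rfl
  have hd : ∀ t ∈ Set.uIcc (0 : ℝ) 1, HasDerivAt (fun t => Complex.log ((γ.toFun t - p) / (c - p)))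
      ((γ.toFun t - p)⁻¹ * deriv γ.toFun t) t := by
    intro t _
    have h1 := (((γ.contDiff.differentiable one_ne_zero t).hasDerivAt).sub_const p).div_const
      (c - p)
    have h2 := h1.clog_real (hslit t)
    convert h2 using 1
    have := hne t
    field_simp
  rw [intervalIntegral.integral_eq_sub_of_hasDerivAt hd, γ.closed, sub_self]
  refine Continuous.intervalIntegrable ?_ _ _
  refine Continuous.mul (Continuous.inv₀ ?_ hne) (γ.contDiff.continuous_deriv le_rfl)
  exact γ.contDiff.continuous.sub continuous_const

/-- Circles around the points of `P`, with a common radius smaller than all distances between points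
of `S`. Clockwise circles around all of `S` serve as a contour around infinity, since only winding
numbers matter. -/
theorem exists_contour {S : Set ℂ} (hS : S.Finite) {P : Set ℂ} (hP : P ⊆ S) (σ : ℤ) :
    ∃ Γ : Contour, (∀ p ∈ P, p ∉ Γ.support ∧ Γ.winding p = σ) ∧
      ∀ p ∈ S \ P, p ∉ Γ.support ∧ Γ.winding p = 0 := by
  classical
  have hev : ∀ᶠ r : ℝ in 𝓝[>] 0, ∀ p ∈ S, ∀ p' ∈ S, p ≠ p' → r < ‖p - p'‖ := by
    rw [Filter.eventually_all_finite hS]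
    intro p _
    rw [Filter.eventually_all_finite hS]
    intro p' _
    by_cases h : p = p'
    · simp [h]
    · have : 0 < ‖p - p'‖ := norm_pos_iff.2 (sub_ne_zero.2 h)
      filter_upwards [Ioo_mem_nhdsGT this] with r hr _ using hr.2
  obtain ⟨r, hr, hr0⟩ := (hev.and self_mem_nhdsWithin).exists
  replace hr0 : 0 < r := hr0
  have hPf := hS.subset hP
  set Γ : Contour := hPf.toFinset.toList.map fun c => circleCurve c r σ with hΓ
  have hsupp : ∀ p ∈ S, p ∉ Γ.support := by
    rintro p hp ⟨γ, hγ, t, _, h⟩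
    simp only [hΓ, List.mem_map, Finset.mem_toList, Set.Finite.mem_toFinset] at hγ
    obtain ⟨c, hc, rfl⟩ := hγ
    have h2 := norm_circleCurve_sub c hr0 σ t
    rw [h] at h2
    by_cases hpc : p = c
    · simp [hpc] at h2; linarith
    · have := hr p hp c (hP hc) hpc; linarith
  have hw : ∀ p ∈ S, Γ.winding p = if p ∈ P then (σ : ℂ) else 0 := by
    intro p hp
    have h1 : ∀ c ∈ hPf.toFinset, (∫ t in (0 : ℝ)..1,
        ((circleCurve c r σ).toFun t - p)⁻¹ * deriv (circleCurve c r σ).toFun t) =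
          if p = c then 2 * Real.pi * Complex.I * σ else 0 := by
      intro c hc
      split_ifs with hpc
      · rw [hpc, integral_circleCurve_center c hr0]
      · refine integral_circleCurve_outside c hr0 σ (hr c ?_ p hp (Ne.symm hpc))
        exact hP (by simpa using hc)
    unfold Contour.winding Contour.integral
    rw [hΓ, List.map_map, Finset.sum_map_toList]
    simp only [Function.comp_def]
    rw [Finset.sum_congr rfl h1, Finset.sum_ite_eq]
    simp only [Set.Finite.mem_toFinset]
    split_ifs
    · have := Complex.two_pi_I_ne_zero
      field_simp
    · simp
  refine ⟨Γ, fun p hp => ⟨hsupp p (hP hp), ?_⟩, fun p hp => ⟨hsupp p hp.1, ?_⟩⟩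
  · rw [hw p (hP hp), if_pos hp]
  · rw [hw p hp.1, if_neg hp.2]

end

end TwistedXXX

namespace TwistedXXX

open Filter Topology Bornology

noncomputable section

/-! ### Rational functions of the outer variables -/

/-- An affine form: a constant, or a shifted coordinate plus a constant. -/
abbrev Form := Option ℕ × ℂ

/-- The value of an affine form; the coordinates are shifted by `sh`. -/
def Form.eval (sh : ℕ → ℂ) (z : ℕ → ℂ) : Form → ℂ
  | (none, c) => c
  | (some k, c) => z k + sh k + c

/-- The forms for the points that a contour has to surround. -/
def InForm (I : Set ℂ) (Y : Finset ℕ) : Form → Prop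
  | (none, c) => c ∈ I
  | (some k, c) => k ∈ Y ∧ c = 0

/-- The forms for the points that a contour must not surround. -/
def OutForm (η : ℂ) (O : Set ℂ) (Z : Finset ℕ) : Form → Prop
  | (none, c) => c ∈ O
  | (some k, c) => k ∈ Z ∧ (c = η ∨ c = -η)

/-- The algebra of functions generated by `1 / (x_k - o)` and `1 / (x_k - x_l ± η)`, where
`x_k = z_k + sh_k`. -/
inductive RatCls (η : ℂ) (sh : ℕ → ℂ) (O : Set ℂ) (Z : Finset ℕ) : ((ℕ → ℂ) → ℂ) → Prop
  | const (c : ℂ) : RatCls η sh O Z fun _ => c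
  | simple (k : ℕ) (hk : k ∈ Z) (o : ℂ) (ho : o ∈ O) : RatCls η sh O Z fun z => (z k + sh k - o)⁻¹
  | pair (k l : ℕ) (hk : k ∈ Z) (hl : l ∈ Z) (hkl : k ≠ l) (c : ℂ) (hc : c = η ∨ c = -η) :
      RatCls η sh O Z fun z => (z k + sh k - (z l + sh l + c))⁻¹
  | add {F G : (ℕ → ℂ) → ℂ} (hF : RatCls η sh O Z F) (hG : RatCls η sh O Z G) :
      RatCls η sh O Z fun z => F z + G z
  | mul {F G : (ℕ → ℂ) → ℂ} (hF : RatCls η sh O Z F) (hG : RatCls η sh O Z G) :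
      RatCls η sh O Z fun z => F z * G z

/-- The functions which, in the coordinate `i`, are sums of products of simple fractions with poles
given by `InForm` and `OutForm`. -/
inductive FracCls (η : ℂ) (sh : ℕ → ℂ) (O I : Set ℂ) (i : ℕ) (Y Z : Finset ℕ) :
    ((ℕ → ℂ) → ℂ) → Prop
  | term (c : (ℕ → ℂ) → ℂ) (A B : List Form) (hc : RatCls η sh O Z c)
      (hA : ∀ a ∈ A, InForm I Y a) (hB : ∀ b ∈ B, OutForm η O Z b) :
      FracCls η sh O I i Y Z fun z => c z *
        (invProd (A.map (Form.eval sh z)) (z i + sh i) *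
          invProd (B.map (Form.eval sh z)) (z i + sh i))
  | add {F G : (ℕ → ℂ) → ℂ} (hF : FracCls η sh O I i Y Z F) (hG : FracCls η sh O I i Y Z G) :
      FracCls η sh O I i Y Z fun z => F z + G z

section

variable {η : ℂ} {sh : ℕ → ℂ} {O I : Set ℂ} {i k : ℕ} {Y Z : Finset ℕ} {F G : (ℕ → ℂ) → ℂ}

theorem InForm.eval_update {a : Form} (ha : InForm I Y a) (hi : i ∉ Y) (z : ℕ → ℂ) (w : ℂ) :
    a.eval sh (Function.update z i w) = a.eval sh z := by
  match a, ha with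
  | (none, c), _ => rfl
  | (some k, c), ha =>
    have : k ≠ i := by rintro rfl; exact hi ha.1
    simp [Form.eval, Function.update_of_ne this]

theorem OutForm.eval_update {a : Form} (ha : OutForm η O Z a) (hi : i ∉ Z) (z : ℕ → ℂ) (w : ℂ) :
    a.eval sh (Function.update z i w) = a.eval sh z := by
  match a, ha with
  | (none, c), _ => rfl
  | (some k, c), ha =>
    have : k ≠ i := by rintro rfl; exact hi ha.1
    simp [Form.eval, Function.update_of_ne this]

theorem RatCls.update (hF : RatCls η sh O Z F) (hi : i ∉ Z) (z : ℕ → ℂ) (w : ℂ) :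
    F (Function.update z i w) = F z := by
  have hne : ∀ k ∈ Z, k ≠ i := fun k hk e => hi (e ▸ hk)
  induction hF with
  | const c => rfl
  | simple k hk o ho => simp [Function.update_of_ne (hne k hk)]
  | pair k l hk hl hkl c hc =>
    simp [Function.update_of_ne (hne k hk), Function.update_of_ne (hne l hl)]
  | add _ _ h1 h2 => simp only [h1, h2]
  | mul _ _ h1 h2 => simp only [h1, h2]

/-- The reason for the choice of the two kinds of forms: a difference of an inside and an outside
point is constant or, up to sign, the inverse of a generator of `RatCls`. For a constant inside
point this uses that `I` shifted by ± η lies in `O`. -/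
theorem InForm.inv_sub (hI : ∀ x ∈ I, x + η ∈ O ∧ x - η ∈ O) (hYZ : Y ⊆ Z) {a b : Form}
    (ha : InForm I Y a) (hb : OutForm η O Z b) :
    RatCls η sh O Z fun z => (a.eval sh z - b.eval sh z)⁻¹ := by
  match a, b, ha, hb with
  | (none, c), (none, c'), _, _ => exact RatCls.const (c - c')⁻¹
  | (none, c), (some k, c'), ha, hb =>
    have ho : c - c' ∈ O := by
      rcases hb.2 with rfl | rfl
      · exact (hI c ha).2
      · simpa using (hI c ha).1
    have := (RatCls.const (η := η) (sh := sh) (O := O) (Z := Z) (-1)).mul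
      (RatCls.simple k hb.1 _ ho)
    convert this using 2 with z
    simp only [Form.eval]
    rw [neg_one_mul, ← inv_neg]
    congr 1
    ring
  | (some k, c), (none, c'), ha, hb =>
    obtain ⟨hk, rfl⟩ := ha
    convert RatCls.simple (η := η) (sh := sh) k (hYZ hk) c' hb using 2 with z
    simp [Form.eval]
  | (some k, c), (some l, c'), ha, hb =>
    obtain ⟨hk, rfl⟩ := ha
    by_cases hkl : k = l
    · subst hkl
      convert RatCls.const (η := η) (sh := sh) (O := O) (Z := Z) ((-c')⁻¹) using 2 with z
      simp [Form.eval]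
    · convert RatCls.pair (η := η) (sh := sh) (O := O) k l (hYZ hk) hb.1 hkl c' hb.2 using 2 with z
      simp [Form.eval]

theorem RatCls.neg (hF : RatCls η sh O Z F) : RatCls η sh O Z fun z => -F z := by
  simpa using (RatCls.const (-1)).mul hF

theorem RatCls.sub (hF : RatCls η sh O Z F) (hG : RatCls η sh O Z G) :
    RatCls η sh O Z fun z => F z - G z := by
  simpa [sub_eq_add_neg] using hF.add hG.neg

theorem ratCls_residueSum (hI : ∀ x ∈ I, x + η ∈ O ∧ x - η ∈ O) (hYZ : Y ⊆ Z) (A B : List Form)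
    (hA : ∀ a ∈ A, InForm I Y a) (hB : ∀ b ∈ B, OutForm η O Z b) :
    RatCls η sh O Z fun z =>
      residueSum (A.map (Form.eval sh z)) (B.map (Form.eval sh z)) := by
  match A, B with
  | [], B => simpa [residueSum_nil] using RatCls.const 0
  | a :: A, [] => simpa [residueSum_right_nil] using RatCls.const _
  | a :: A, b :: B =>
    simp only [List.map_cons, residueSum_cons_cons]
    refine RatCls.mul (InForm.inv_sub hI hYZ (hA a (by simp)) (hB b (by simp))) (RatCls.sub ?_ ?_)
    · exact ratCls_residueSum hI hYZ (a :: A) B hA fun p hp => hB p (by simp [hp])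
    · exact ratCls_residueSum hI hYZ A (b :: B) (fun p hp => hA p (by simp [hp])) hB
termination_by A.length + B.length

/-! #### Behaviour at infinity -/

theorem tendsto_inv_add_cobounded (c : ℂ) :
    Tendsto (fun x : ℂ => (x + c)⁻¹) (cobounded ℂ) (𝓝 0) :=
  tendsto_inv₀_cobounded.comp (tendsto_add_const_cobounded c)

theorem tendsto_inv_sub_cobounded (c : ℂ) :
    Tendsto (fun x : ℂ => (c - x)⁻¹) (cobounded ℂ) (𝓝 0) := by
  have h := (tendsto_inv_add_cobounded (-c)).neg
  rw [neg_zero] at h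
  refine h.congr fun x => ?_
  rw [← inv_neg]
  congr 1
  ring

theorem Form.eval_update_self {a : Form} (ha : a.1 = some k) (z : ℕ → ℂ) (x : ℂ) :
    a.eval sh (Function.update z k x) = x + (sh k + a.2) := by
  obtain ⟨a1, a2⟩ := a
  obtain rfl : a1 = some k := ha
  simp [Form.eval, add_assoc]

theorem Form.eval_update_of_ne {a : Form} (ha : a.1 ≠ some k) (z : ℕ → ℂ) (x : ℂ) :
    a.eval sh (Function.update z k x) = a.eval sh z := by
  match a, ha with
  | (none, c), _ => rfl
  | (some l, c), ha =>
    have : l ≠ k := fun e => ha (by rw [e])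
    simp [Form.eval, Function.update_of_ne this]

theorem Form.tendsto_inv_sub (k : ℕ) (z : ℕ → ℂ) (a b : Form) :
    ∃ l, Tendsto (fun x => (a.eval sh (Function.update z k x) -
      b.eval sh (Function.update z k x))⁻¹) (cobounded ℂ) (𝓝 l) ∧
      (¬ (a.1 = some k ↔ b.1 = some k) → l = 0) := by
  by_cases ha : a.1 = some k <;> by_cases hb : b.1 = some k
  · simp only [Form.eval_update_self ha, Form.eval_update_self hb, add_sub_add_left_eq_sub]
    exact ⟨_, tendsto_const_nhds, fun h => absurd (iff_of_true ha hb) h⟩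
  · refine ⟨0, ?_, fun _ => rfl⟩
    simp only [Form.eval_update_self ha, Form.eval_update_of_ne hb]
    simpa [add_sub_assoc] using tendsto_inv_add_cobounded (sh k + a.2 - b.eval sh z)
  · refine ⟨0, ?_, fun _ => rfl⟩
    simp only [Form.eval_update_self hb, Form.eval_update_of_ne ha]
    refine (tendsto_inv_sub_cobounded (a.eval sh z - (sh k + b.2))).congr fun x => ?_
    congr 1
    ring
  · simp only [Form.eval_update_of_ne ha, Form.eval_update_of_ne hb]
    exact ⟨_, tendsto_const_nhds, fun h => absurd (iff_of_false ha hb) h⟩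

theorem RatCls.tendsto (hF : RatCls η sh O Z F) (k : ℕ) (z : ℕ → ℂ) :
    ∃ l, Tendsto (fun x => F (Function.update z k x)) (cobounded ℂ) (𝓝 l) := by
  induction hF with
  | const c => exact ⟨c, tendsto_const_nhds⟩
  | simple j hj o ho =>
    obtain ⟨l, hl, _⟩ := Form.tendsto_inv_sub (sh := sh) k z (some j, 0) (none, o)
    exact ⟨l, by simpa [Form.eval] using hl⟩
  | pair j j' hj hj' hjj c hc =>
    obtain ⟨l, hl, _⟩ := Form.tendsto_inv_sub (sh := sh) k z (some j, 0) (some j', c)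
    exact ⟨l, by simpa [Form.eval] using hl⟩
  | add _ _ h1 h2 =>
    obtain ⟨l1, h1⟩ := h1
    obtain ⟨l2, h2⟩ := h2
    exact ⟨_, h1.add h2⟩
  | mul _ _ h1 h2 =>
    obtain ⟨l1, h1⟩ := h1
    obtain ⟨l2, h2⟩ := h2
    exact ⟨_, h1.mul h2⟩

/-- The additional pole `lam` is essential: without it a single pole of `A` has residue 1, which
does not decay when that pole moves to infinity. -/
theorem residueSum_tendsto (k : ℕ) (z : ℕ → ℂ) (lam : ℂ) (A B : List Form) :
    ∃ l, Tendsto (fun x => residueSum (A.map (Form.eval sh (Function.update z k x)))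
      ((B ++ [(none, lam)]).map (Form.eval sh (Function.update z k x)))) (cobounded ℂ) (𝓝 l) ∧
      ((∃ a ∈ A ++ B, a.1 = some k) → l = 0) := by
  match A, B with
  | [], B => exact ⟨0, by simp [residueSum_nil], fun _ => rfl⟩
  | a :: A, [] =>
    obtain ⟨l1, h1, h1'⟩ := Form.tendsto_inv_sub (sh := sh) k z a (none, lam)
    obtain ⟨l2, h2, h2'⟩ := residueSum_tendsto k z lam A []
    refine ⟨l1 * ((if (a :: A).length = 1 then 1 else 0) - l2), ?_, ?_⟩
    · simp only [List.nil_append, List.map_cons, List.map_nil, residueSum_cons_cons,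
        residueSum_right_nil, List.length_cons, List.length_map] at h2 ⊢
      exact h1.mul (tendsto_const_nhds.sub h2)
    · rintro ⟨b, hb, hbk⟩
      by_cases hak : a.1 = some k
      · rw [h1' (by simp [hak]), zero_mul]
      · have hbA : b ∈ A := by
          simp only [List.append_nil, List.mem_cons] at hb
          rcases hb with rfl | hb
          · exact absurd hbk hak
          · exact hb
        rw [h2' ⟨b, by simpa using hbA, hbk⟩, if_neg]
        · simp
        · simp only [List.length_cons]
          have := List.length_pos_of_mem hbA
          omega
  | a :: A, b :: B =>
    obtain ⟨l1, h1, h1'⟩ := Form.tendsto_inv_sub (sh := sh) k z a b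
    obtain ⟨l2, h2, h2'⟩ := residueSum_tendsto k z lam (a :: A) B
    obtain ⟨l3, h3, h3'⟩ := residueSum_tendsto k z lam A (b :: B)
    refine ⟨l1 * (l2 - l3), ?_, ?_⟩
    · simp only [List.map_cons, List.cons_append, residueSum_cons_cons] at h2 h3 ⊢
      exact h1.mul (h2.sub h3)
    · rintro ⟨c, hc, hck⟩
      by_cases hab : a.1 = some k ↔ b.1 = some k
      · by_cases hak : a.1 = some k
        · rw [h2' ⟨a, by simp, hak⟩, h3' ⟨b, by simp, hab.1 hak⟩]; simp
        · have hbk : b.1 ≠ some k := fun h => hak (hab.2 h)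
          have hc' : c ∈ A ∨ c ∈ B := by
            simp only [List.cons_append, List.mem_cons, List.mem_append] at hc
            rcases hc with rfl | hc | rfl | hc
            · exact absurd hck hak
            · exact Or.inl hc
            · exact absurd hck hbk
            · exact Or.inr hc
          rw [h2' ⟨c, by simp; tauto, hck⟩, h3' ⟨c, by simp; tauto, hck⟩]; simp
      · rw [h1' hab, zero_mul]
termination_by A.length + B.length

theorem invProd_tendsto (k : ℕ) (z : ℕ → ℂ) (w : ℂ) (A : List Form) :
    Tendsto (fun x => invProd (A.map (Form.eval sh (Function.update z k x))) w) (cobounded ℂ)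
      (𝓝 (if ∃ a ∈ A, a.1 = some k then 0 else invProd (A.map (Form.eval sh z)) w)) := by
  induction A with
  | nil => simp
  | cons a A ih =>
    simp only [List.map_cons, invProd_cons]
    by_cases hak : a.1 = some k
    · rw [if_pos ⟨a, by simp, hak⟩]
      simp only [Form.eval_update_self hak]
      have h0 : Tendsto (fun x : ℂ => (w - (x + (sh k + a.2)))⁻¹) (cobounded ℂ) (𝓝 0) :=
        (tendsto_inv_sub_cobounded (w - (sh k + a.2))).congr fun x => by congr 1; ring
      simpa using h0.mul ih
    · simp only [Form.eval_update_of_ne hak]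
      convert ih.const_mul ((w - a.eval sh z)⁻¹) using 2
      simp only [List.mem_cons, exists_eq_or_imp, hak, false_or]
      split_ifs <;> simp

/-! #### Closure properties of `FracCls` -/

theorem FracCls.congr (hF : FracCls η sh O I i Y Z F) (h : ∀ z, F z = G z) :
    FracCls η sh O I i Y Z G := by
  obtain rfl : F = G := funext h
  exact hF

theorem FracCls.of_ratCls (hF : RatCls η sh O Z F) : FracCls η sh O I i Y Z F :=
  (FracCls.term F [] [] hF (by simp) (by simp)).congr fun z => by simp

theorem FracCls.const (c : ℂ) : FracCls η sh O I i Y Z fun _ => c := .of_ratCls (.const c)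

theorem FracCls.mul (hF : FracCls η sh O I i Y Z F) (hG : FracCls η sh O I i Y Z G) :
    FracCls η sh O I i Y Z fun z => F z * G z := by
  induction hF with
  | term c A B hc hA hB =>
    induction hG with
    | term c' A' B' hc' hA' hB' =>
      refine (FracCls.term _ (A ++ A') (B ++ B') (hc.mul hc') (fun a ha => ?_)
        fun b hb => ?_).congr fun z => ?_
      · exact (List.mem_append.1 ha).elim (hA a) (hA' a)
      · exact (List.mem_append.1 hb).elim (hB b) (hB' b)
      · simp only [List.map_append, invProd_append]; ring
    | add _ _ h1 h2 => exact (h1.add h2).congr fun z => by ring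
  | add _ _ h1 h2 => exact (h1.add h2).congr fun z => by ring

theorem FracCls.inv_in {a : Form} (ha : InForm I Y a) :
    FracCls η sh O I i Y Z fun z => (z i + sh i - a.eval sh z)⁻¹ :=
  (FracCls.term _ [a] [] (.const 1) (by simpa using ha) (by simp)).congr fun z => by simp

theorem FracCls.inv_out {b : Form} (hb : OutForm η O Z b) :
    FracCls η sh O I i Y Z fun z => (z i + sh i - b.eval sh z)⁻¹ :=
  (FracCls.term _ [] [b] (.const 1) (by simp) (by simpa using hb)).congr fun z => by simp

/-- Makes an outer variable the next integration variable. What the inner integrations leave behind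
has only outside poles in this variable; all its inside poles come from its own explicit factor. -/
theorem RatCls.fracCls (hF : RatCls η sh O (insert i Z) F) :
    FracCls η sh O I i Y Z F := by
  induction hF with
  | const c => exact .const c
  | simple k hk o ho =>
    rcases Finset.mem_insert.1 hk with rfl | hk
    · exact FracCls.inv_out (b := (none, o)) ho
    · exact .of_ratCls (.simple k hk o ho)
  | pair k l hk hl hkl c hc =>
    rcases Finset.mem_insert.1 hk with rfl | hk'
    · rcases Finset.mem_insert.1 hl with rfl | hl
      · exact absurd rfl hkl
      · exact FracCls.inv_out (b := (some l, c)) ⟨hl, hc⟩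
    · rcases Finset.mem_insert.1 hl with hl' | hl
      · subst hl'
        have hb : OutForm η O Z (some k, -c) := ⟨hk', by rcases hc with rfl | rfl <;> simp⟩
        refine ((FracCls.const (-1)).mul (FracCls.inv_out hb)).congr fun z => ?_
        rw [neg_one_mul, ← inv_neg]
        congr 1
        simp only [Form.eval]
        ring
      · exact .of_ratCls (.pair k l hk' hl hkl c hc)
  | add _ _ h1 h2 => exact h1.add h2
  | mul _ _ h1 h2 => exact h1.mul h2

/-! #### Contour integrals of functions in `FracCls` -/

/-- The contour has winding number `wI` around the points given by `InForm` and `wO` around those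
given by `OutForm`, and does not meet them. -/
def Contour.Winds (Γ : Contour) (wI wO : ℂ) (η : ℂ) (sh : ℕ → ℂ) (O I : Set ℂ) (i : ℕ)
    (Y Z : Finset ℕ) (z : ℕ → ℂ) : Prop :=
  (∀ a, InForm I Y a → a.eval sh z - sh i ∉ Γ.support ∧ Γ.winding (a.eval sh z - sh i) = wI) ∧
    ∀ b, OutForm η O Z b → b.eval sh z - sh i ∉ Γ.support ∧ Γ.winding (b.eval sh z - sh i) = wO

/-- A rule `v` for the contour integral of `∏_{A} 1 / (w - a) ∏_{B} 1 / (w - b)`, for contours with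
winding numbers `wI` around the points of `A` and `wO` around those of `B`. -/
structure IntegralRule (wI wO : ℂ) (v : List ℂ → List ℂ → ℂ) : Prop where
  translate : ∀ (s : ℂ) (A B : List ℂ), v (A.map (· - s)) (B.map (· - s)) = v A B
  integral : ∀ (Γ : Contour) (A B : List ℂ), (∀ p ∈ A, p ∉ Γ.support ∧ Γ.winding p = wI) →
    (∀ p ∈ B, p ∉ Γ.support ∧ Γ.winding p = wO) → Γ.integral (invProd (A ++ B)) = v A B
  ratCls : ∀ (η : ℂ) (sh : ℕ → ℂ) (O I : Set ℂ) (Y Z : Finset ℕ)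
    (_ : ∀ x ∈ I, x + η ∈ O ∧ x - η ∈ O) (_ : Y ⊆ Z) (A B : List Form)
    (_ : ∀ a ∈ A, InForm I Y a) (_ : ∀ b ∈ B, OutForm η O Z b),
    RatCls η sh O Z fun z => v (A.map (Form.eval sh z)) (B.map (Form.eval sh z))
  tendsto_zero : ∀ (sh : ℕ → ℂ) (k : ℕ) (z : ℕ → ℂ) (lam : ℂ) (A B : List Form),
    (∃ a ∈ A ++ B, a.1 = some k) →
    Tendsto (fun x => v (A.map (Form.eval sh (Function.update z k x)))
      ((B ++ [(none, lam)]).map (Form.eval sh (Function.update z k x)))) (cobounded ℂ) (𝓝 0)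

theorem residueSum_translate (s : ℂ) (A B : List ℂ) :
    residueSum (A.map (· - s)) (B.map (· - s)) = residueSum A B := by
  match A, B with
  | [], B => simp [residueSum_nil]
  | a :: A, [] => simp [residueSum_right_nil]
  | a :: A, b :: B =>
    have h1 := residueSum_translate s (a :: A) B
    have h2 := residueSum_translate s A (b :: B)
    simp only [List.map_cons] at h1 h2 ⊢
    rw [residueSum_cons_cons, residueSum_cons_cons, h1, h2, sub_sub_sub_cancel_right]
termination_by A.length + B.length

theorem integralRule_residueSum : IntegralRule 1 0 residueSum where
  translate := residueSum_translate
  integral _ A B hA hB := Contour.integral_invProd_append A B hA hB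
  ratCls _ _ _ _ _ _ hI hYZ A B hA hB := ratCls_residueSum hI hYZ A B hA hB
  tendsto_zero sh k z lam A B h := by
    obtain ⟨l, hl, hl0⟩ := residueSum_tendsto (sh := sh) k z lam A B
    rwa [hl0 h] at hl

/-- A contour around infinity does not distinguish the two kinds of poles; with at least two poles
the integrand decays like 1 / w² and the integral vanishes. -/
theorem integralRule_infinity :
    IntegralRule (-1) (-1) fun A B => if A.length + B.length = 1 then -1 else 0 where
  translate s A B := by simp
  integral Γ A B hA hB := by
    rw [Contour.integral_invProd_of_winding_eq (A ++ B) fun p hp =>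
      (List.mem_append.1 hp).elim (hA p) (hB p)]
    simp
  ratCls _ _ _ _ _ _ _ _ A B _ _ := by simpa using RatCls.const _
  tendsto_zero sh k z lam A B h := by
    obtain ⟨a, ha, _⟩ := h
    have := List.length_pos_of_mem ha
    simp only [List.length_append] at this
    have h1 : ¬ (A.length + (B.length + 1) = 1) := by omega
    simp only [List.length_map, List.length_append, List.length_singleton, if_neg h1]
    exact tendsto_const_nhds

theorem invProd_map_sub (s : ℂ) (L : List ℂ) (w : ℂ) :
    invProd (L.map (· - s)) w = invProd L (w + s) := by
  simp only [invProd, List.map_map, Function.comp_def]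
  congr 2
  funext p
  congr 1
  ring

theorem IntegralRule.integral_translate {wI wO : ℂ} {v : List ℂ → List ℂ → ℂ}
    (hv : IntegralRule wI wO v) {Γ : Contour} (s : ℂ) (A B : List ℂ)
    (hA : ∀ p ∈ A, p - s ∉ Γ.support ∧ Γ.winding (p - s) = wI)
    (hB : ∀ p ∈ B, p - s ∉ Γ.support ∧ Γ.winding (p - s) = wO) :
    Γ.integral (fun w => invProd A (w + s) * invProd B (w + s)) = v A B := by
  rw [← hv.translate s, ← hv.integral Γ]
  · refine Contour.integral_congr fun w _ => ?_
    rw [invProd_append, invProd_map_sub, invProd_map_sub]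
  · simpa using hA
  · simpa using hB

theorem continuousOn_invProd_translate {Γ : Contour} {s : ℂ} {L : List ℂ}
    (h : ∀ p ∈ L, p - s ∉ Γ.support) : ContinuousOn (fun w => invProd L (w + s)) Γ.support := by
  have : (fun w => invProd L (w + s)) = invProd (L.map (· - s)) := by
    funext w; rw [invProd_map_sub]
  rw [this]
  exact continuousOn_invProd (by simpa using h)

theorem map_eval_update_in {A : List Form} (hA : ∀ a ∈ A, InForm I Y a) (hi : i ∉ Y) (z : ℕ → ℂ)
    (w : ℂ) : A.map (Form.eval sh (Function.update z i w)) = A.map (Form.eval sh z) :=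
  List.map_congr_left fun a ha => (hA a ha).eval_update hi z w

theorem map_eval_update_out {A : List Form} (hA : ∀ a ∈ A, OutForm η O Z a) (hi : i ∉ Z)
    (z : ℕ → ℂ) (w : ℂ) :
    A.map (Form.eval sh (Function.update z i w)) = A.map (Form.eval sh z) :=
  List.map_congr_left fun a ha => (hA a ha).eval_update hi z w

theorem FracCls.continuousOn (hF : FracCls η sh O I i Y Z F) (hi : i ∉ Z) (hYZ : Y ⊆ Z)
    {Γ : Contour} {wI wO : ℂ} {z : ℕ → ℂ} (hΓ : Γ.Winds wI wO η sh O I i Y Z z) :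
    ContinuousOn (fun w => F (Function.update z i w)) Γ.support := by
  induction hF with
  | term c A B hc hA hB =>
    simp only [hc.update hi, map_eval_update_in hA (fun h => hi (hYZ h)),
      map_eval_update_out hB hi, Function.update_self]
    refine continuousOn_const.mul (ContinuousOn.mul ?_ ?_)
    · refine continuousOn_invProd_translate fun p hp => ?_
      obtain ⟨a, ha, rfl⟩ := List.mem_map.1 hp
      exact (hΓ.1 a (hA a ha)).1
    · refine continuousOn_invProd_translate fun p hp => ?_
      obtain ⟨a, ha, rfl⟩ := List.mem_map.1 hp
      exact (hΓ.2 a (hB a ha)).1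
  | add _ _ h1 h2 => exact h1.add h2

theorem continuousOn_inv_out {lam : ℂ} (hlam : lam ∈ O) {Γ : Contour} {wI wO : ℂ} {z : ℕ → ℂ}
    (hΓ : Γ.Winds wI wO η sh O I i Y Z z) :
    ContinuousOn (fun w => (w + sh i - lam)⁻¹) Γ.support := by
  refine ContinuousOn.inv₀ (by fun_prop) fun w hw h => ?_
  refine (hΓ.2 (none, lam) hlam).1 ?_
  have : w = lam - sh i := by linear_combination h
  simpa [Form.eval, ← this] using hw

/-- The contour integral of a function in `FracCls` with an additional factor `1 / (x_i - lam)` is a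
rational function of the outer variables, and commutes with the limit to infinity in an outer
variable. -/
theorem FracCls.exists_integral {wI wO : ℂ} {v : List ℂ → List ℂ → ℂ} (hv : IntegralRule wI wO v)
    (hF : FracCls η sh O I i Y Z F) (hi : i ∉ Z) (hYZ : Y ⊆ Z)
    (hI : ∀ x ∈ I, x + η ∈ O ∧ x - η ∈ O) {lam : ℂ} (hlam : lam ∈ O) :
    ∃ R, RatCls η sh O Z R ∧
      (∀ (Γ : Contour) (z : ℕ → ℂ), Γ.Winds wI wO η sh O I i Y Z z →
        Γ.integral (fun w => (w + sh i - lam)⁻¹ * F (Function.update z i w)) = R z) ∧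
      ∀ k ∈ Z, ∀ z, ∃ H : ℂ → ℂ,
        (∀ w, Tendsto (fun x => F (Function.update (Function.update z k x) i w)) (cobounded ℂ)
          (𝓝 (H w))) ∧
        ∀ Γ : Contour, Γ.Winds wI wO η sh O I i (Y.erase k) (Z.erase k) z →
          ContinuousOn H Γ.support ∧ Tendsto (fun x => R (Function.update z k x)) (cobounded ℂ)
            (𝓝 (Γ.integral fun w => (w + sh i - lam)⁻¹ * H w)) := by
  induction hF with
  | term c A B hc hA hB =>
    have hiY : i ∉ Y := fun h => hi (hYZ h)
    have hB' : ∀ b ∈ B ++ [(none, lam)], OutForm η O Z b := by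
      intro b hb
      rcases List.mem_append.1 hb with hb | hb
      · exact hB b hb
      · rw [List.mem_singleton.1 hb]; exact hlam
    have key : ∀ (Γ : Contour) (z : ℕ → ℂ) (C : ℂ),
        (∀ a ∈ A, a.eval sh z - sh i ∉ Γ.support ∧ Γ.winding (a.eval sh z - sh i) = wI) →
        (∀ b ∈ B ++ [(none, lam)],
          b.eval sh z - sh i ∉ Γ.support ∧ Γ.winding (b.eval sh z - sh i) = wO) →
        Γ.integral (fun w => (w + sh i - lam)⁻¹ * (C *
          (invProd (A.map (Form.eval sh z)) (w + sh i) *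
            invProd (B.map (Form.eval sh z)) (w + sh i)))) =
          C * v (A.map (Form.eval sh z)) ((B ++ [(none, lam)]).map (Form.eval sh z)) := by
      intro Γ z C h1 h2
      have h := hv.integral_translate (Γ := Γ) (sh i) (A.map (Form.eval sh z))
        ((B ++ [(none, lam)]).map (Form.eval sh z)) (List.forall_mem_map.2 h1)
        (List.forall_mem_map.2 h2)
      rw [← h, ← Contour.integral_const_mul]
      refine Contour.integral_congr fun w _ => ?_
      simp only [List.map_append, invProd_append, List.map_cons, List.map_nil, invProd_cons,
        invProd_nil, Form.eval]
      ring
    refine ⟨_, hc.mul (hv.ratCls η sh O I Y Z hI hYZ A _ hA hB'), fun Γ z hΓ => ?_,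
      fun k hk z => ?_⟩
    · rw [← key Γ z (c z) (fun a ha => hΓ.1 a (hA a ha)) fun b hb => hΓ.2 b (hB' b hb)]
      refine Contour.integral_congr fun w _ => ?_
      simp only [hc.update hi, map_eval_update_in hA hiY, map_eval_update_out hB hi,
        Function.update_self]
    · obtain ⟨l, hl⟩ := hc.tendsto k z
      have hki : i ≠ k := by rintro rfl; exact hi hk
      have hlim : ∀ w, Tendsto (fun x => c (Function.update z k x) *
          (invProd (A.map (Form.eval sh (Function.update z k x))) (w + sh i) *
            invProd (B.map (Form.eval sh (Function.update z k x))) (w + sh i))) (cobounded ℂ)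
          (𝓝 (l * ((if ∃ a ∈ A, a.1 = some k then 0 else
            invProd (A.map (Form.eval sh z)) (w + sh i)) *
            (if ∃ a ∈ B, a.1 = some k then 0 else
              invProd (B.map (Form.eval sh z)) (w + sh i))))) := fun w =>
        hl.mul ((invProd_tendsto k z (w + sh i) A).mul (invProd_tendsto k z (w + sh i) B))
      refine ⟨fun w => l * ((if ∃ a ∈ A, a.1 = some k then 0 else
            invProd (A.map (Form.eval sh z)) (w + sh i)) *
            (if ∃ a ∈ B, a.1 = some k then 0 else
              invProd (B.map (Form.eval sh z)) (w + sh i))), fun w => ?_, fun Γ hΓ => ?_⟩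
      · simp only [hc.update hi, map_eval_update_in hA hiY, map_eval_update_out hB hi,
          Function.update_self]
        exact hlim w
      -- If some pole moves with `z k`, the limit integrand is zero, and the integral tends to zero
      -- because of the further pole `lam`. Otherwise only the coefficient `c` depends on `z k`, and
      -- the limit comes out of the integral.
      · by_cases hdep : ∃ a ∈ A ++ B, a.1 = some k
        · have h0 : ∀ w, l * ((if ∃ a ∈ A, a.1 = some k then 0 else
              invProd (A.map (Form.eval sh z)) (w + sh i)) *
              (if ∃ a ∈ B, a.1 = some k then 0 else
                invProd (B.map (Form.eval sh z)) (w + sh i))) = 0 := by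
            intro w
            obtain ⟨a, ha, hak⟩ := hdep
            rcases List.mem_append.1 ha with ha | ha
            · rw [if_pos ⟨a, ha, hak⟩]; simp
            · rw [if_pos (c := ∃ a ∈ B, a.1 = some k) ⟨a, ha, hak⟩]; simp
          simp only [h0, mul_zero, Contour.integral_zero]
          refine ⟨continuousOn_const, ?_⟩
          simpa using hl.mul (hv.tendsto_zero sh k z lam A B hdep)
        · have hdA : ¬ ∃ a ∈ A, a.1 = some k := fun ⟨a, ha, h⟩ => hdep ⟨a, by simp [ha], h⟩
          have hdB : ¬ ∃ a ∈ B, a.1 = some k := fun ⟨a, ha, h⟩ => hdep ⟨a, by simp [ha], h⟩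
          simp only [if_neg hdA, if_neg hdB]
          have hA2 : ∀ a ∈ A, InForm I (Y.erase k) a := by
            intro a ha
            match a, hA a ha, ha with
            | (none, _), h, _ => exact h
            | (some j, _), h, ha =>
              exact ⟨Finset.mem_erase.2 ⟨fun e => hdA ⟨_, ha, by rw [e]⟩, h.1⟩, h.2⟩
          have hB2 : ∀ a ∈ B, OutForm η O (Z.erase k) a := by
            intro a ha
            match a, hB a ha, ha with
            | (none, _), h, _ => exact h
            | (some j, _), h, ha =>
              exact ⟨Finset.mem_erase.2 ⟨fun e => hdB ⟨_, ha, by rw [e]⟩, h.1⟩, h.2⟩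
          have hB3 : ∀ b ∈ B ++ [(none, lam)], OutForm η O (Z.erase k) b := by
            intro b hb
            rcases List.mem_append.1 hb with hb | hb
            · exact hB2 b hb
            · rw [List.mem_singleton.1 hb]; exact hlam
          constructor
          · refine continuousOn_const.mul (ContinuousOn.mul ?_ ?_)
            · refine continuousOn_invProd_translate fun p hp => ?_
              obtain ⟨a, ha, rfl⟩ := List.mem_map.1 hp
              exact (hΓ.1 a (hA2 a ha)).1
            · refine continuousOn_invProd_translate fun p hp => ?_
              obtain ⟨a, ha, rfl⟩ := List.mem_map.1 hp
              exact (hΓ.2 a (hB2 a ha)).1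
          · rw [key Γ z l (fun a ha => hΓ.1 a (hA2 a ha)) fun b hb => hΓ.2 b (hB3 b hb)]
            have e1 : ∀ x, A.map (Form.eval sh (Function.update z k x)) =
                A.map (Form.eval sh z) := fun x => List.map_congr_left fun a ha =>
              Form.eval_update_of_ne (fun h => hdA ⟨a, ha, h⟩) z x
            have e2 : ∀ x, (B ++ [(none, lam)]).map (Form.eval sh (Function.update z k x)) =
                (B ++ [(none, lam)]).map (Form.eval sh z) := fun x =>
              map_eval_update_out hB3 (by simp) z x
            simp only [e1, e2]
            exact hl.mul_const _
  | add hF hG h1 h2 =>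
    obtain ⟨R1, hR1, hi1, hl1⟩ := h1
    obtain ⟨R2, hR2, hi2, hl2⟩ := h2
    refine ⟨_, hR1.add hR2, fun Γ z hΓ => ?_, fun k hk z => ?_⟩
    · have hc := continuousOn_inv_out hlam hΓ
      rw [← hi1 Γ z hΓ, ← hi2 Γ z hΓ, ← Contour.integral_mul_add hc
        (hF.continuousOn hi hYZ hΓ) (hG.continuousOn hi hYZ hΓ)]
    · obtain ⟨H1, ht1, hΓ1⟩ := hl1 k hk z
      obtain ⟨H2, ht2, hΓ2⟩ := hl2 k hk z
      refine ⟨fun w => H1 w + H2 w, fun w => (ht1 w).add (ht2 w), fun Γ hΓ => ?_⟩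
      obtain ⟨c1, t1⟩ := hΓ1 Γ hΓ
      obtain ⟨c2, t2⟩ := hΓ2 Γ hΓ
      have hc := continuousOn_inv_out hlam hΓ
      refine ⟨c1.add c2, ?_⟩
      rw [Contour.integral_mul_add hc c1 c2]
      exact t1.add t2

/-- The integral over a contour around infinity is given by the limit at infinity. -/
theorem FracCls.integral_infinity (hF : FracCls η sh O I i Y Z F) (hi : i ∉ Z) (hYZ : Y ⊆ Z)
    {lam : ℂ} (hlam : lam ∈ O) {Γ : Contour} {z : ℕ → ℂ}
    (hΓ : Γ.Winds (-1) (-1) η sh O I i Y Z z) :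
    ∃ l, Tendsto (fun w => F (Function.update z i w)) (cobounded ℂ) (𝓝 l) ∧
      Γ.integral (fun w => (w + sh i - lam)⁻¹ * F (Function.update z i w)) = -l := by
  induction hF with
  | term c A B hc hA hB =>
    have hiY : i ∉ Y := fun h => hi (hYZ h)
    simp only [hc.update hi, map_eval_update_in hA hiY, map_eval_update_out hB hi,
      Function.update_self]
    have hinv : ∀ L : List ℂ, Tendsto (fun w => invProd L (w + sh i)) (cobounded ℂ)
        (𝓝 (if L.length = 0 then 1 else 0)) := by
      intro L
      induction L with
      | nil => simp
      | cons p L ih =>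
        simp only [invProd_cons]
        have h0 := (tendsto_inv_add_cobounded (sh i - p)).mul ih
        simpa [add_sub_assoc] using h0
    refine ⟨_, tendsto_const_nhds.mul ((hinv _).mul (hinv _)), ?_⟩
    have h := integralRule_infinity.integral_translate (Γ := Γ) (sh i) (A.map (Form.eval sh z))
      ((B ++ [(none, lam)]).map (Form.eval sh z))
      (List.forall_mem_map.2 fun a ha => hΓ.1 a (hA a ha))
      (by
        rw [List.forall_mem_map]
        intro b hb
        rcases List.mem_append.1 hb with hb | hb
        · exact hΓ.2 b (hB b hb)
        · rw [List.mem_singleton.1 hb]; exact hΓ.2 (none, lam) hlam)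
    have e : Γ.integral (fun w => (w + sh i - lam)⁻¹ * (c z *
        (invProd (A.map (Form.eval sh z)) (w + sh i) *
          invProd (B.map (Form.eval sh z)) (w + sh i)))) = c z * Γ.integral (fun w =>
          invProd (A.map (Form.eval sh z)) (w + sh i) *
            invProd ((B ++ [(none, lam)]).map (Form.eval sh z)) (w + sh i)) := by
      rw [← Contour.integral_const_mul]
      refine Contour.integral_congr fun w _ => ?_
      simp only [List.map_append, invProd_append, List.map_cons, List.map_nil, invProd_cons,
        invProd_nil, Form.eval]
      ring
    rw [e, h]
    -- Both sides are nonzero at most for empty `A` and `B`: then `lam` is the only pole on the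
    -- left, and the term does not decay on the right.
    rcases A with _ | ⟨a, A⟩ <;> rcases B with _ | ⟨b, B⟩ <;> simp
    omega
  | add hF hG h1 h2 =>
    obtain ⟨l1, t1, e1⟩ := h1
    obtain ⟨l2, t2, e2⟩ := h2
    refine ⟨l1 + l2, t1.add t2, ?_⟩
    have hc := continuousOn_inv_out hlam hΓ
    rw [Contour.integral_mul_add hc (hF.continuousOn hi hYZ hΓ) (hG.continuousOn hi hYZ hΓ), e1,
      e2]
    ring

theorem residueSum_singleton (x : ℂ) (B : List ℂ) : residueSum [x] B = invProd B x := by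
  induction B with
  | nil => simp [residueSum]
  | cons b B ih => rw [residueSum_cons_cons, residueSum_nil, ih, invProd_cons, sub_zero]

theorem FracCls.integral_eq_zero (hF : FracCls η sh O ∅ i ∅ Z F) (hi : i ∉ Z)
    {Γ : Contour} {z : ℕ → ℂ} (hΓ : Γ.Winds 1 0 η sh O ∅ i ∅ Z z) :
    Γ.integral (fun w => F (Function.update z i w)) = 0 := by
  induction hF with
  | term c A B hc hA hB =>
    simp only [hc.update hi, map_eval_update_in hA (Finset.notMem_empty _),
      map_eval_update_out hB hi, Function.update_self]
    obtain rfl : A = [] := by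
      refine List.eq_nil_iff_forall_not_mem.2 fun a ha => ?_
      match a, hA a ha with
      | (none, _), h => exact h
      | (some _, _), h => exact Finset.notMem_empty _ h.1
    rw [Contour.integral_const_mul, integralRule_residueSum.integral_translate (sh i)]
    · simp [residueSum_nil]
    · simp
    · exact List.forall_mem_map.2 fun a ha => hΓ.2 a (hB a ha)
  | add hF hG h1 h2 =>
    rw [Contour.integral_add (hF.continuousOn hi (by simp) hΓ)
      (hG.continuousOn hi (by simp) hΓ), h1, h2, add_zero]

/-- Cauchy's integral formula: with no inside forms available, `F` has no pole within the contour.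
-/
theorem FracCls.integral_simple_pole (hF : FracCls η sh O ∅ i ∅ Z F) (hi : i ∉ Z)
    {Γ : Contour} {z : ℕ → ℂ} (hΓ : Γ.Winds 1 0 η sh O ∅ i ∅ Z z) {x : ℂ}
    (hx : x ∉ Γ.support ∧ Γ.winding x = 1) :
    Γ.integral (fun w => (w - x)⁻¹ * F (Function.update z i w)) =
      F (Function.update z i x) := by
  have hcx : ContinuousOn (fun w => (w - x)⁻¹) Γ.support :=
    ContinuousOn.inv₀ (by fun_prop) fun w hw => sub_ne_zero.2 fun e => hx.1 (e ▸ hw)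
  induction hF with
  | term c A B hc hA hB =>
    simp only [hc.update hi, map_eval_update_in hA (Finset.notMem_empty _),
      map_eval_update_out hB hi, Function.update_self]
    obtain rfl : A = [] := by
      refine List.eq_nil_iff_forall_not_mem.2 fun a ha => ?_
      match a, hA a ha with
      | (none, _), h => exact h
      | (some _, _), h => exact Finset.notMem_empty _ h.1
    have h := integralRule_residueSum.integral_translate (Γ := Γ) (sh i) [x + sh i]
      (B.map (Form.eval sh z)) (by simpa using hx) (List.forall_mem_map.2 fun a ha => hΓ.2 a (hB a ha))
    rw [residueSum_singleton] at h
    simp only [List.map_nil, invProd_nil, one_mul]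
    rw [← h, ← Contour.integral_const_mul]
    refine Contour.integral_congr fun w _ => ?_
    simp only [invProd_cons, invProd_nil, add_sub_add_right_eq_sub]
    ring
  | add hF hG h1 h2 =>
    rw [Contour.integral_mul_add hcx (hF.continuousOn hi (by simp) hΓ)
      (hG.continuousOn hi (by simp) hΓ), h1, h2]

end

end

end TwistedXXX

namespace TwistedXXX

open Filter Topology Bornology

noncomputable section

/-! ### Interpolation -/

/-- Subtracting the multiple of the nodal polynomial with the same coefficient of X^N leaves a
polynomial of degree less than N with the same values at the nodes, to which Lagrange interpolation
applies. -/
theorem eval_eq_interpolation {N : ℕ} (p : Polynomial ℂ) (hp : p.natDegree ≤ N) {x : Fin N → ℂ}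
    (hx : Function.Injective x) (u : ℂ) :
    p.eval u = p.coeff N * ∏ n, (u - x n) +
      ∑ n, p.eval (x n) * ∏ k ∈ Finset.univ.erase n, ((u - x k) / (x n - x k)) := by
  set r := p - Polynomial.C (p.coeff N) * Lagrange.nodal Finset.univ x with hr
  have hdeg : r.degree < (Finset.univ : Finset (Fin N)).card := by
    have hnat : (Lagrange.nodal Finset.univ x).natDegree = N := by
      rw [Lagrange.natDegree_nodal]; simp
    have hmonic : (Lagrange.nodal Finset.univ x).coeff N = 1 := by
      have := (Lagrange.nodal_monic (s := Finset.univ) (v := x)).coeff_natDegree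
      rwa [hnat] at this
    rw [Finset.card_univ, Fintype.card_fin, Polynomial.degree_lt_iff_coeff_zero]
    intro k hk
    rcases hk.eq_or_lt with rfl | hk
    · simp [hr, hmonic]
    · rw [hr, Polynomial.coeff_sub, Polynomial.coeff_C_mul,
        Polynomial.coeff_eq_zero_of_natDegree_lt (lt_of_le_of_lt hp hk),
        Polynomial.coeff_eq_zero_of_natDegree_lt (hnat.trans_lt hk)]
      simp
  have h1 := Lagrange.eq_interpolate (s := Finset.univ) (v := x) hx.injOn hdeg
  have h2 : ∀ v, r.eval v = p.eval v - p.coeff N * ∏ n, (v - x n) := by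
    intro v
    simp [hr, Lagrange.eval_nodal]
  have h3 : ∀ n, r.eval (x n) = p.eval (x n) := by
    intro n
    rw [h2, Finset.prod_eq_zero (Finset.mem_univ n) (sub_self _)]
    simp
  have h4 := congrArg (Polynomial.eval u) h1
  rw [h2, Lagrange.interpolate_apply, Polynomial.eval_finsetSum] at h4
  rw [← sub_eq_iff_eq_add', h4]
  refine Finset.sum_congr rfl fun n _ => ?_
  rw [Polynomial.eval_mul, Polynomial.eval_C, h3, Lagrange.basis, Polynomial.eval_prod]
  congr 1
  refine Finset.prod_congr rfl fun k _ => ?_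
  simp [Lagrange.basisDivisor, div_eq_inv_mul]

theorem prod_div_prod_eq {N : ℕ} (y : Fin N → ℂ) {x : Fin N → ℂ} (hx : Function.Injective x)
    {u : ℂ} (hu : ∀ n, u ≠ x n) :
    (∏ n, (u - y n)) / ∏ n, (u - x n) =
      1 + ∑ n, (∏ k, (x n - y k)) / (∏ k ∈ Finset.univ.erase n, (x n - x k)) * (u - x n)⁻¹ := by
  have hm : (∏ n, (Polynomial.X - Polynomial.C (y n))).Monic :=
    Polynomial.monic_prod_of_monic _ _ fun n _ => Polynomial.monic_X_sub_C _
  have hd : (∏ n, (Polynomial.X - Polynomial.C (y n))).natDegree = N := by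
    simp [Polynomial.natDegree_prod_of_monic _ _ fun n _ => Polynomial.monic_X_sub_C (y n)]
  have h := eval_eq_interpolation _ hd.le hx u
  have hc : (∏ n, (Polynomial.X - Polynomial.C (y n))).coeff N = 1 := by
    have := hm.coeff_natDegree
    rwa [hd] at this
  rw [hc] at h
  simp only [Polynomial.eval_prod, Polynomial.eval_sub, Polynomial.eval_X, Polynomial.eval_C] at h
  have h0 : ∏ n, (u - x n) ≠ 0 := Finset.prod_ne_zero_iff.2 fun n _ => sub_ne_zero.2 (hu n)
  rw [h, add_div, one_mul, div_self h0, Finset.sum_div]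
  congr 1
  refine Finset.sum_congr rfl fun n _ => ?_
  rw [← Finset.mul_prod_erase Finset.univ (fun k => u - x k) (Finset.mem_univ n),
    Finset.prod_div_distrib]
  have h1 : u - x n ≠ 0 := sub_ne_zero.2 (hu n)
  have h2 : ∏ k ∈ Finset.univ.erase n, (u - x k) ≠ 0 :=
    Finset.prod_ne_zero_iff.2 fun k _ => sub_ne_zero.2 (hu k)
  field_simp

/-! ### Factors of the integrand as ratios -/

/-- Functions in `FracCls` that tend to `1` as the `i`-th coordinate tends to infinity. -/
def RatioCls (η : ℂ) (sh : ℕ → ℂ) (O I : Set ℂ) (i : ℕ) (Y Z : Finset ℕ)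
    (F : (ℕ → ℂ) → ℂ) : Prop :=
  FracCls η sh O I i Y Z F ∧
    ∀ z, Tendsto (fun w => F (Function.update z i w)) (cobounded ℂ) (𝓝 1)

/-- The coordinate `i` of `z` is none of the special points. -/
def Avoids (η : ℂ) (sh : ℕ → ℂ) (O I : Set ℂ) (i : ℕ) (Y Z : Finset ℕ) (z : ℕ → ℂ) : Prop :=
  (∀ a, InForm I Y a → z i + sh i - a.eval sh z ≠ 0) ∧
    ∀ b, OutForm η O Z b → z i + sh i - b.eval sh z ≠ 0

/-- Functions that agree with a function in `RatioCls` off the special points. -/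
def HasRatio (η : ℂ) (sh : ℕ → ℂ) (O I : Set ℂ) (i : ℕ) (Y Z : Finset ℕ)
    (f : (ℕ → ℂ) → ℂ) : Prop :=
  ∃ F, RatioCls η sh O I i Y Z F ∧ ∀ z, Avoids η sh O I i Y Z z → f z = F z

section

variable {η : ℂ} {sh : ℕ → ℂ} {O I : Set ℂ} {i k : ℕ} {Y Z : Finset ℕ} {f g : (ℕ → ℂ) → ℂ}

theorem HasRatio.one : HasRatio η sh O I i Y Z fun _ => 1 :=
  ⟨_, ⟨.const 1, fun _ => tendsto_const_nhds⟩, fun _ _ => rfl⟩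

theorem HasRatio.mul (hf : HasRatio η sh O I i Y Z f) (hg : HasRatio η sh O I i Y Z g) :
    HasRatio η sh O I i Y Z fun z => f z * g z := by
  obtain ⟨F, hF, hfF⟩ := hf
  obtain ⟨G, hG, hgG⟩ := hg
  exact ⟨_, ⟨hF.1.mul hG.1, fun z => by simpa using (hF.2 z).mul (hG.2 z)⟩,
    fun z hz => by simp only [hfF z hz, hgG z hz]⟩

theorem HasRatio.prod {ι : Type*} (s : Finset ι) {f : ι → (ℕ → ℂ) → ℂ}
    (hf : ∀ j ∈ s, HasRatio η sh O I i Y Z (f j)) :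
    HasRatio η sh O I i Y Z fun z => ∏ j ∈ s, f j z := by
  classical
  induction s using Finset.induction_on with
  | empty => simpa using HasRatio.one
  | insert j s hj ih =>
    simp only [Finset.prod_insert hj]
    exact (hf j (by simp)).mul (ih fun l hl => hf l (Finset.mem_insert_of_mem hl))

theorem tendsto_ratio (z : ℕ → ℂ) {a : Form}
    (h : ∀ w, a.eval sh (Function.update z i w) = a.eval sh z) (c : ℂ) :
    Tendsto (fun w => 1 + c * (Function.update z i w i + sh i -
      a.eval sh (Function.update z i w))⁻¹) (cobounded ℂ) (𝓝 1) := by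
  simp only [h, Function.update_self]
  simpa [add_sub_assoc] using
    ((tendsto_inv_add_cobounded (sh i - a.eval sh z)).const_mul c).const_add 1

theorem HasRatio.of_in (hi : i ∉ Y) {a : Form} (ha : InForm I Y a) (c : ℂ)
    (hf : ∀ z, f z = (z i + sh i - a.eval sh z + c) / (z i + sh i - a.eval sh z)) :
    HasRatio η sh O I i Y Z f := by
  refine ⟨_, ⟨(FracCls.const 1).add ((FracCls.const c).mul (.inv_in ha)), fun z => ?_⟩,
    fun z hz => ?_⟩
  · exact tendsto_ratio z (fun w => ha.eval_update hi z w) c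
  · rw [hf, add_div, div_self (hz.1 a ha), div_eq_mul_inv]

theorem HasRatio.of_out (hi : i ∉ Z) {a : Form} (ha : OutForm η O Z a) (c : ℂ)
    (hf : ∀ z, f z = (z i + sh i - a.eval sh z + c) / (z i + sh i - a.eval sh z)) :
    HasRatio η sh O I i Y Z f := by
  refine ⟨_, ⟨(FracCls.const 1).add ((FracCls.const c).mul (.inv_out ha)), fun z => ?_⟩,
    fun z hz => ?_⟩
  · exact tendsto_ratio z (fun w => ha.eval_update hi z w) c
  · rw [hf, add_div, div_self (hz.2 a ha), div_eq_mul_inv]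

theorem Contour.Winds.avoids {Γ : Contour} {wI wO : ℂ} {z : ℕ → ℂ}
    (hΓ : Γ.Winds wI wO η sh O I i Y Z z) (hiY : i ∉ Y) (hiZ : i ∉ Z) {w : ℂ}
    (hw : w ∈ Γ.support) : Avoids η sh O I i Y Z (Function.update z i w) := by
  constructor
  · intro a ha h
    rw [ha.eval_update hiY, Function.update_self] at h
    refine (hΓ.1 a ha).1 ?_
    rwa [show a.eval sh z - sh i = w by linear_combination -h]
  · intro a ha h
    rw [ha.eval_update hiZ, Function.update_self] at h
    refine (hΓ.2 a ha).1 ?_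
    rwa [show a.eval sh z - sh i = w by linear_combination -h]

end

/-! ### The data of the multiple integral -/

/-- The parameters of the multiple integral. -/
structure Params (N R : ℕ) where
  η : ℂ
  ξ : Fin N → ℂ
  q : Fin R → ℂ
  lam : ℕ → ℂ
  m : ℕ

namespace Params

variable {N R : ℕ} (P : Params N R)

/-- The genericity assumptions on the parameters. -/
structure Generic : Prop where
  eta_ne : P.η ≠ 0
  xi_ne : ∀ i j, i ≠ j → P.ξ i ≠ P.ξ j ∧ P.ξ i ≠ P.ξ j + P.η ∧ P.ξ i ≠ P.ξ j - P.η
  q_ne : ∀ k n, P.q k ≠ P.ξ n ∧ P.q k ≠ P.ξ n - P.η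
  lam_ne : ∀ j, 1 ≤ j → j ≤ P.m →
    ∀ n, P.lam j ≠ P.ξ n ∧ P.lam j ≠ P.ξ n - P.η ∧ P.lam j ≠ P.ξ n - 2 * P.η

/-- The shift that turns the variable `z k` into its normalized coordinate. -/
def sh (k : ℕ) : ℂ := if Even k then 0 else P.η

/-- The constant points to be surrounded, in normalized coordinates. -/
def inConsts : Set ℂ := Set.range P.ξ

/-- The constant points not to be surrounded, in normalized coordinates. -/
def outConsts : Set ℂ :=
  {o | (∃ n, o = P.ξ n + P.η ∨ o = P.ξ n - P.η) ∨ (∃ n, o = P.q n ∨ o = P.q n + P.η) ∨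
    ∃ l, 1 ≤ l ∧ l ≤ P.m ∧ (o = P.lam l ∨ o = P.lam l + P.η)}

/-- The part of the factor of the variable `z i` that depends on the `q k` and the previous
`lam k`. -/
def regRatio (i : ℕ) (w : ℂ) : ℂ :=
  if Even i then
    QFun P.q (w - P.η) / QFun P.q w *
      ∏ k ∈ Finset.Ico 1 ((i + 1) / 2), (w - P.lam k - P.η) / (w - P.lam k)
  else QFun P.q (w + P.η) / QFun P.q w *
      ∏ k ∈ Finset.Ico 1 ((i + 1) / 2), (w - P.lam k + P.η) / (w - P.lam k)

/-- The part of the factor of the variable `z i` that depends on `h`. -/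
def chainFactor (h : Config N) (i : ℕ) (w : ℂ) : ℂ :=
  (if Even i then aFun P.η P.ξ w else dFun P.ξ w) / dh P.η P.ξ h w

/-- The factor for a pair of variables, the outer one being `z k`. -/
def pairFactor (k : ℕ) (zk w : ℂ) : ℂ := (w - zk) / (w - zk + (-1) ^ k * P.η)

/-- The present variables outside `z i`. -/
def outer (i : ℕ) (Z : Finset ℕ) : Finset ℕ := Z.filter (i < ·)

/-- The present variables outside `z i` of the other parity. -/
def outerOdd (i : ℕ) (Z : Finset ℕ) : Finset ℕ := Z.filter fun k => i < k ∧ Odd (k + i)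

/-- The factor of the integrand attached to `z i`, including the pair factors with the outer
variables. -/
def fac (h : Config N) (Z : Finset ℕ) (i : ℕ) (z : ℕ → ℂ) : ℂ :=
  1 / (P.lam ((i + 1) / 2) - z i) * P.chainFactor h i (z i) * P.regRatio i (z i) *
    ∏ k ∈ outer i Z, P.pairFactor k (z k) (z i)

/-- The special points of `z i` that are to be surrounded. -/
def inPts (i : ℕ) (Z : Finset ℕ) (z : ℕ → ℂ) : Set ℂ :=
  {p | ∃ a, InForm P.inConsts (outerOdd i Z) a ∧ a.eval P.sh z - P.sh i = p}

/-- The other special points of `z i`. -/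
def outPts (i : ℕ) (Z : Finset ℕ) (z : ℕ → ℂ) : Set ℂ :=
  {p | ∃ b, OutForm P.η P.outConsts (outer i Z) b ∧ b.eval P.sh z - P.sh i = p}

/-- A contour with winding numbers `wI` around the points of `A` and `wO` around those of `B`. -/
def contourWith (wI wO : ℂ) (A B : Set ℂ) : Contour :=
  Classical.epsilon fun Γ : Contour => (∀ p ∈ A, p ∉ Γ.support ∧ Γ.winding p = wI) ∧
    ∀ p ∈ B, p ∉ Γ.support ∧ Γ.winding p = wO

/-- The contours have the required winding numbers. -/
abbrev GoodContour (Γ : Contour) (wI wO : ℂ) (i : ℕ) (Z : Finset ℕ) (z : ℕ → ℂ) : Prop :=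
  Γ.Winds wI wO P.η P.sh P.outConsts P.inConsts i (outerOdd i Z) (outer i Z) z

/-- The nested integral over the variables `z 1, …, z i`, with the factors of these variables only,
and with contours that depend only on the special points. -/
def inner (wInf wFin : ℕ → ℂ) (h : Config N) (Z : Finset ℕ) : ℕ → (ℕ → ℂ) → ℂ
  | 0, _ => 1
  | i + 1, z =>
    if i + 1 ∈ Z then
      wInf (i + 1) * (contourWith (-1) (-1) (P.inPts (i + 1) Z z) (P.outPts (i + 1) Z z)).integral
          (fun w => P.fac h Z (i + 1) (Function.update z (i + 1) w) *
            inner wInf wFin h Z i (Function.update z (i + 1) w)) +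
        wFin (i + 1) * (contourWith 1 0 (P.inPts (i + 1) Z z) (P.outPts (i + 1) Z z)).integral
          (fun w => P.fac h Z (i + 1) (Function.update z (i + 1) w) *
            inner wInf wFin h Z i (Function.update z (i + 1) w))
    else inner wInf wFin h Z i z

/-- The admissible values of the outer variables. -/
def Dom (Z : Finset ℕ) (z : ℕ → ℂ) : Prop :=
  (∀ k ∈ Z, z k + P.sh k ∉ P.outConsts) ∧ ∀ k ∈ Z, ∀ l ∈ Z, z k + P.sh k ≠ z l + P.sh l + P.η

variable {P}

/-! ### Special points, admissible outer variables and the choice of contours -/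

theorem outer_subset_of {i k : ℕ} {Z : Finset ℕ} (hk : k ∈ outer i Z) : i < k :=
  (Finset.mem_filter.1 hk).2

theorem notMem_outer (i : ℕ) (Z : Finset ℕ) : i ∉ outer i Z := fun h =>
  lt_irrefl i (outer_subset_of h)

theorem outerOdd_subset (i : ℕ) (Z : Finset ℕ) : outerOdd i Z ⊆ outer i Z := fun k hk => by
  simp only [outer, outerOdd, Finset.mem_filter] at hk ⊢
  exact ⟨hk.1, hk.2.1⟩

theorem notMem_outerOdd (i : ℕ) (Z : Finset ℕ) : i ∉ outerOdd i Z := fun h =>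
  notMem_outer i Z (outerOdd_subset i Z h)

theorem outer_of_mem {i : ℕ} {Z : Finset ℕ} (h : i + 1 ∈ Z) :
    outer i Z = insert (i + 1) (outer (i + 1) Z) := by
  ext k
  simp only [outer, Finset.mem_filter, Finset.mem_insert]
  constructor
  · rintro ⟨h1, h2⟩
    by_cases hk : k = i + 1
    · exact Or.inl hk
    · exact Or.inr ⟨h1, by omega⟩
  · rintro (rfl | ⟨h1, h2⟩)
    · exact ⟨h, by omega⟩
    · exact ⟨h1, by omega⟩

theorem outer_of_notMem {i : ℕ} {Z : Finset ℕ} (h : i + 1 ∉ Z) :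
    outer i Z = outer (i + 1) Z := by
  ext k
  simp only [outer, Finset.mem_filter]
  refine and_congr_right fun hk => ?_
  have : k ≠ i + 1 := fun e => h (e ▸ hk)
  omega

theorem outer_erase (i k : ℕ) (Z : Finset ℕ) : outer i (Z.erase k) = (outer i Z).erase k := by
  simp only [outer, Finset.filter_erase]

theorem outerOdd_erase (i k : ℕ) (Z : Finset ℕ) :
    outerOdd i (Z.erase k) = (outerOdd i Z).erase k := by
  simp only [outerOdd, Finset.filter_erase]

theorem inConsts_shift : ∀ x ∈ P.inConsts, x + P.η ∈ P.outConsts ∧ x - P.η ∈ P.outConsts := by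
  rintro _ ⟨n, rfl⟩
  exact ⟨Or.inl ⟨n, Or.inl rfl⟩, Or.inl ⟨n, Or.inr rfl⟩⟩

/-- This makes ξ_n an admissible value of an outer coordinate, so that residues at the sites of the
chain can be taken after the inner integrations. Each kind of element of `outConsts` is excluded by
one of the genericity assumptions. -/
theorem Generic.notMem_outConsts (hP : P.Generic) (n : Fin N) : P.ξ n ∉ P.outConsts := by
  rintro (⟨k, hk⟩ | ⟨k, hk⟩ | ⟨l, hl1, hl2, hl⟩)
  · by_cases hnk : n = k
    · subst hnk
      have := hP.eta_ne
      rcases hk with hk | hk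
      · exact this (by linear_combination -hk)
      · exact this (by linear_combination hk)
    · exact hk.elim (hP.xi_ne n k hnk).2.1 (hP.xi_ne n k hnk).2.2
  · rcases hk with hk | hk
    · exact (hP.q_ne k n).1 hk.symm
    · exact (hP.q_ne k n).2 (by linear_combination -hk)
  · rcases hl with hl | hl
    · exact (hP.lam_ne l hl1 hl2 n).1 hl.symm
    · exact (hP.lam_ne l hl1 hl2 n).2.1 (by linear_combination -hl)

theorem Generic.shifted_injective (hP : P.Generic) (h : Config N) :
    Function.Injective (shifted P.η P.ξ h) := by
  intro i j hij
  by_contra hne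
  have hx := hP.xi_ne i j hne
  unfold shifted at hij
  have h2 : ∀ a : Fin 2, a = 0 ∨ a = 1 := by decide
  rcases h2 (h i) with hi | hi <;> rcases h2 (h j) with hj | hj <;> rw [hi, hj] at hij <;>
    simp at hij
  · exact hx.1 hij
  · exact hx.2.2 hij
  · exact hx.2.1 (by linear_combination hij)
  · exact hx.1 hij

theorem finite_outConsts : P.outConsts.Finite := by
  have h1 : (⋃ n, ({P.ξ n + P.η, P.ξ n - P.η} : Set ℂ)).Finite :=
    Set.finite_iUnion fun n => by simp
  have h2 : (⋃ n, ({P.q n, P.q n + P.η} : Set ℂ)).Finite := Set.finite_iUnion fun n => by simp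
  have h3 : (⋃ l ∈ Set.Icc 1 P.m, ({P.lam l, P.lam l + P.η} : Set ℂ)).Finite :=
    (Set.finite_Icc 1 P.m).biUnion fun n _ => by simp
  refine (h1.union (h2.union h3)).subset ?_
  rintro o (⟨n, hn⟩ | ⟨n, hn⟩ | ⟨l, hl1, hl2, hl⟩)
  · exact Or.inl (Set.mem_iUnion.2 ⟨n, by simpa using hn⟩)
  · exact Or.inr (Or.inl (Set.mem_iUnion.2 ⟨n, by simpa using hn⟩))
  · exact Or.inr (Or.inr (Set.mem_biUnion (x := l) ⟨hl1, hl2⟩ (by simpa using hl)))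

theorem finite_inPts (i : ℕ) (Z : Finset ℕ) (z : ℕ → ℂ) : (P.inPts i Z z).Finite := by
  have h1 : (Set.range fun n => P.ξ n - P.sh i).Finite := Set.finite_range _
  have h2 : ((fun k => z k + P.sh k - P.sh i) '' (outerOdd i Z : Set ℕ)).Finite :=
    (Finset.finite_toSet _).image _
  refine (h1.union h2).subset ?_
  rintro p ⟨⟨a1, a2⟩, ha, rfl⟩
  match a1, ha with
  | none, ⟨n, hn⟩ => exact Or.inl ⟨n, by simp only [Form.eval]; rw [hn]⟩
  | some k, ha =>
    obtain ⟨hk, rfl⟩ := ha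
    exact Or.inr ⟨k, hk, by simp [Form.eval]⟩

theorem finite_outPts (i : ℕ) (Z : Finset ℕ) (z : ℕ → ℂ) : (P.outPts i Z z).Finite := by
  have h1 := (finite_outConsts (P := P)).image fun o => o - P.sh i
  have h2 : (⋃ k ∈ (outer i Z : Set ℕ),
      ({z k + P.sh k + P.η - P.sh i, z k + P.sh k + -P.η - P.sh i} : Set ℂ)).Finite :=
    (Finset.finite_toSet _).biUnion fun k _ => by simp
  refine (h1.union h2).subset ?_
  rintro p ⟨⟨a1, a2⟩, ha, rfl⟩
  match a1, ha with
  | none, ha => exact Or.inl ⟨a2, ha, rfl⟩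
  | some k, ⟨hk, ha⟩ =>
    refine Or.inr (Set.mem_biUnion (x := k) hk ?_)
    rcases ha with rfl | rfl <;> simp [Form.eval]

/-- A collision of an inside and an outside point would place ξ_n or an outer coordinate in
`outConsts`, or make two outer coordinates differ by η. Disjointness is what allows a contour with
the two prescribed winding numbers to exist. -/
theorem Dom.disjoint (hP : P.Generic) {i : ℕ} {Z : Finset ℕ} {z : ℕ → ℂ}
    (hz : P.Dom (outer i Z) z) : ∀ p ∈ P.inPts i Z z, p ∉ P.outPts i Z z := by
  rintro _ ⟨a, ha, rfl⟩ ⟨b, hb, hab⟩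
  replace hab : b.eval P.sh z = a.eval P.sh z := by linear_combination hab
  match a, b, ha, hb with
  | (none, c), (none, c'), ⟨n, hn⟩, hb =>
    simp only [Form.eval] at hab
    exact hP.notMem_outConsts n (by rw [hn, ← hab]; exact hb)
  | (none, c), (some l, c'), ⟨n, hn⟩, ⟨hl, hc⟩ =>
    simp only [Form.eval] at hab
    have h1 := hz.1 l hl
    have h2 := inConsts_shift (P := P) c ⟨n, hn⟩
    rcases hc with rfl | rfl
    · exact h1 (by rw [show z l + P.sh l = c - P.η by linear_combination hab]; exact h2.2)
    · exact h1 (by rw [show z l + P.sh l = c + P.η by linear_combination hab]; exact h2.1)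
  | (some k, c), (none, c'), ⟨hk, hc⟩, hb =>
    subst hc
    simp only [Form.eval, add_zero] at hab
    exact hz.1 k (outerOdd_subset _ _ hk) (by rw [← hab]; exact hb)
  | (some k, c), (some l, c'), ⟨hk, hc⟩, ⟨hl, hc'⟩ =>
    subst hc
    simp only [Form.eval, add_zero] at hab
    have hk' := outerOdd_subset _ _ hk
    rcases hc' with rfl | rfl
    · exact hz.2 k hk' l hl hab.symm
    · exact hz.2 l hl k hk' (by linear_combination hab)

theorem contourWith_spec {wI wO : ℂ} {A B : Set ℂ} (h : ∃ Γ : Contour,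
    (∀ p ∈ A, p ∉ Γ.support ∧ Γ.winding p = wI) ∧ ∀ p ∈ B, p ∉ Γ.support ∧ Γ.winding p = wO) :
    (∀ p ∈ A, p ∉ (contourWith wI wO A B).support ∧ (contourWith wI wO A B).winding p = wI) ∧
      ∀ p ∈ B, p ∉ (contourWith wI wO A B).support ∧ (contourWith wI wO A B).winding p = wO :=
  Classical.epsilon_spec h

theorem Dom.goodContour_fin (hP : P.Generic) {i : ℕ} {Z : Finset ℕ} {z : ℕ → ℂ}
    (hz : P.Dom (outer i Z) z) :
    P.GoodContour (contourWith 1 0 (P.inPts i Z z) (P.outPts i Z z)) 1 0 i Z z := by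
  have h := contourWith_spec (wI := 1) (wO := 0) (A := P.inPts i Z z) (B := P.outPts i Z z) (by
    obtain ⟨Γ, h1, h2⟩ := exists_contour ((finite_inPts i Z z).union (finite_outPts (P := P) i Z z))
      Set.subset_union_left 1
    refine ⟨Γ, by simpa using h1, fun p hp => h2 p ⟨Or.inr hp, fun hp' => ?_⟩⟩
    exact hz.disjoint hP p hp' hp)
  exact ⟨fun a ha => h.1 _ ⟨a, ha, rfl⟩, fun b hb => h.2 _ ⟨b, hb, rfl⟩⟩

theorem goodContour_inf (P : Params N R) (i : ℕ) (Z : Finset ℕ) (z : ℕ → ℂ) :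
    P.GoodContour (contourWith (-1) (-1) (P.inPts i Z z) (P.outPts i Z z)) (-1) (-1) i Z z := by
  have h := contourWith_spec (wI := -1) (wO := -1) (A := P.inPts i Z z) (B := P.outPts i Z z) (by
    obtain ⟨Γ, h1, h2⟩ := exists_contour ((finite_inPts i Z z).union (finite_outPts (P := P) i Z z))
      subset_rfl (-1)
    exact ⟨Γ, fun p hp => by simpa using h1 p (Or.inl hp),
      fun p hp => by simpa using h1 p (Or.inr hp)⟩)
  exact ⟨fun a ha => h.1 _ ⟨a, ha, rfl⟩, fun b hb => h.2 _ ⟨b, hb, rfl⟩⟩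

/-- A good contour avoids `outConsts` and the points x_k ± η, which are exactly the conditions that
the new coordinate has to fulfil. -/
theorem Dom.update (hP : P.Generic) {i : ℕ} {Z : Finset ℕ} {z : ℕ → ℂ}
    (hz : P.Dom (outer i Z) z) {Γ : Contour} {wI wO : ℂ} (hΓ : P.GoodContour Γ wI wO i Z z) {w : ℂ}
    (hw : w ∈ Γ.support) : P.Dom (insert i (outer i Z)) (Function.update z i w) := by
  have hne : ∀ k ∈ outer i Z, k ≠ i := fun k hk e => notMem_outer i Z (e ▸ hk)
  have hav := (hΓ.avoids (notMem_outerOdd i Z) (notMem_outer i Z) hw).2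
  have h1 : ∀ o ∈ P.outConsts, w + P.sh i ≠ o := fun o ho h => by
    have := hav (none, o) ho
    simp [Form.eval, h] at this
  have h2 : ∀ k ∈ outer i Z, ∀ c, (c = P.η ∨ c = -P.η) → w + P.sh i ≠ z k + P.sh k + c := by
    intro k hk c hc h
    have := hav (some k, c) ⟨hk, hc⟩
    simp [Form.eval, Function.update_of_ne (hne k hk), h] at this
  constructor
  · intro k hk
    rcases Finset.mem_insert.1 hk with rfl | hk
    · rw [Function.update_self]
      exact fun h => h1 _ h rfl
    · rw [Function.update_of_ne (hne k hk)]
      exact hz.1 k hk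
  · intro k hk l hl
    rcases Finset.mem_insert.1 hk with rfl | hk <;> rcases Finset.mem_insert.1 hl with hl' | hl
    · subst hl'
      have := hP.eta_ne
      simpa using this
    · rw [Function.update_self, Function.update_of_ne (hne l hl)]
      exact h2 l hl _ (Or.inl rfl)
    · subst hl'
      rw [Function.update_self, Function.update_of_ne (hne k hk)]
      intro h
      exact h2 k hk _ (Or.inr rfl) (by linear_combination -h)
    · rw [Function.update_of_ne (hne k hk), Function.update_of_ne (hne l hl)]
      exact hz.2 k hk l hl

end Params

end

end TwistedXXX

/-! ### The factors of the integrand, and the inner integrals as rational functions of the outer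
variables -/

namespace TwistedXXX

open Filter Topology Bornology

noncomputable section

namespace Params

variable {N R : ℕ} {P : Params N R}

/-- For even `i` the sites with h_n = 1 cancel between a and d_h, and those with h_n = 0 give the
inside pole ξ_n; for odd `i` the roles are exchanged. With division by zero having value zero, the
cancellation fails at the cancelled point itself; that point is a special point ξ_n ± η outside, so
the equality is only claimed off the special points. -/
theorem hasRatio_chainFactor (h : Config N) (i : ℕ) {Y Z : Finset ℕ} (hiY : i ∉ Y) (hiZ : i ∉ Z) :
    HasRatio P.η P.sh P.outConsts P.inConsts i Y Z fun z => P.chainFactor h i (z i) := by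
  have h2 : ∀ a : Fin 2, a = 0 ∨ a = 1 := by decide
  by_cases hi : Even i
  · simp only [chainFactor, if_pos hi, aFun, dh, ← Finset.prod_div_distrib]
    refine HasRatio.prod _ fun n _ => ?_
    rcases h2 (h n) with hn | hn
    · refine HasRatio.of_in hiY (a := (none, P.ξ n)) ⟨n, rfl⟩ P.η fun z => ?_
      simp [shifted, hn, Form.eval, sh, hi]
    · refine HasRatio.of_out hiZ (a := (none, P.ξ n - P.η)) (inConsts_shift _ ⟨n, rfl⟩).2 0
        fun z => ?_
      simp only [shifted, hn, Form.eval, sh, if_pos hi]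
      congr 1
      · ring
      · simp
  · simp only [chainFactor, if_neg hi, dFun, dh, ← Finset.prod_div_distrib]
    refine HasRatio.prod _ fun n _ => ?_
    rcases h2 (h n) with hn | hn
    · refine HasRatio.of_out hiZ (a := (none, P.ξ n + P.η)) (inConsts_shift _ ⟨n, rfl⟩).1 0
        fun z => ?_
      simp [shifted, hn, Form.eval, sh, hi]
    · refine HasRatio.of_in hiY (a := (none, P.ξ n)) ⟨n, rfl⟩ (-P.η) fun z => ?_
      simp only [shifted, hn, Form.eval, sh, if_neg hi]
      congr 1
      · ring
      · simp only [Fin.val_one, Nat.cast_one, one_mul]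
        ring

theorem hasRatio_regRatio {i : ℕ} (him : i ≤ 2 * P.m) (I : Set ℂ) {Y Z : Finset ℕ}
    (hiZ : i ∉ Z) :
    HasRatio P.η P.sh P.outConsts I i Y Z fun z => P.regRatio i (z i) := by
  have hq : ∀ n, P.q n + P.sh i ∈ P.outConsts := by
    intro n
    refine Or.inr (Or.inl ⟨n, ?_⟩)
    by_cases hi : Even i <;> simp [sh, hi]
  have hl : ∀ k ∈ Finset.Ico 1 ((i + 1) / 2), P.lam k + P.sh i ∈ P.outConsts := by
    intro k hk
    rw [Finset.mem_Ico] at hk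
    refine Or.inr (Or.inr ⟨k, hk.1, by omega, ?_⟩)
    by_cases hi : Even i <;> simp [sh, hi]
  by_cases hi : Even i
  · simp only [regRatio, if_pos hi, QFun, ← Finset.prod_div_distrib]
    refine HasRatio.mul (HasRatio.prod _ fun n _ => ?_) (HasRatio.prod _ fun k hk => ?_)
    · refine HasRatio.of_out hiZ (a := (none, _)) (hq n) (-P.η) fun z => ?_
      simp only [Form.eval]
      congr 1 <;> ring
    · refine HasRatio.of_out hiZ (a := (none, _)) (hl k hk) (-P.η) fun z => ?_
      simp only [Form.eval]
      congr 1 <;> ring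
  · simp only [regRatio, if_neg hi, QFun, ← Finset.prod_div_distrib]
    refine HasRatio.mul (HasRatio.prod _ fun n _ => ?_) (HasRatio.prod _ fun k hk => ?_)
    · refine HasRatio.of_out hiZ (a := (none, _)) (hq n) P.η fun z => ?_
      simp only [Form.eval]
      congr 1 <;> ring
    · refine HasRatio.of_out hiZ (a := (none, _)) (hl k hk) P.η fun z => ?_
      simp only [Form.eval]
      congr 1 <;> ring

/-- In normalized coordinates the pole in x_i is x_k if the parities of `i` and `k` differ, x_k - η
if both are even and x_k + η if both are odd. Hence opposite parity gives an inside pole, equal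
parity an outside one. -/
theorem hasRatio_pairFactor {i k : ℕ} {Z : Finset ℕ} (hk : k ∈ outer i Z) :
    HasRatio P.η P.sh P.outConsts P.inConsts i (outerOdd i Z) (outer i Z)
      fun z => P.pairFactor k (z k) (z i) := by
  have hiY := notMem_outerOdd i Z
  have hiZ := notMem_outer i Z
  have hin : Odd (k + i) → InForm P.inConsts (outerOdd i Z) (some k, 0) := fun ho => by
    refine ⟨?_, rfl⟩
    simp only [outer, outerOdd, Finset.mem_filter] at hk ⊢
    exact ⟨hk.1, hk.2, ho⟩
  by_cases hek : Even k <;> by_cases hei : Even i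
  · refine HasRatio.of_out hiZ (a := (some k, -P.η)) ⟨hk, Or.inr rfl⟩ (-P.η) fun z => ?_
    simp only [pairFactor, hek.neg_one_pow, Form.eval, sh, if_pos hek, if_pos hei]
    congr 1 <;> ring
  · refine HasRatio.of_in hiY (hin (hek.add_odd (Nat.not_even_iff_odd.1 hei))) (-P.η) fun z => ?_
    simp only [pairFactor, hek.neg_one_pow, Form.eval, sh, if_pos hek, if_neg hei]
    congr 1 <;> ring
  · refine HasRatio.of_in hiY (hin ((Nat.not_even_iff_odd.1 hek).add_even hei)) P.η fun z => ?_
    simp only [pairFactor, (Nat.not_even_iff_odd.1 hek).neg_one_pow, Form.eval, sh, if_neg hek,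
      if_pos hei]
    congr 1 <;> ring
  · refine HasRatio.of_out hiZ (a := (some k, P.η)) ⟨hk, Or.inl rfl⟩ P.η fun z => ?_
    simp only [pairFactor, (Nat.not_even_iff_odd.1 hek).neg_one_pow, Form.eval, sh, if_neg hek,
      if_neg hei]
    congr 1 <;> ring

theorem lam_mem_outConsts {i : ℕ} (hi1 : 1 ≤ i) (him : i ≤ 2 * P.m) :
    P.lam ((i + 1) / 2) + P.sh i ∈ P.outConsts := by
  refine Or.inr (Or.inr ⟨(i + 1) / 2, by omega, by omega, ?_⟩)
  by_cases hi : Even i <;> simp [sh, hi]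

theorem one_div_lam_sub (i : ℕ) (w : ℂ) :
    1 / (P.lam ((i + 1) / 2) - w) =
      (w + P.sh i - (P.lam ((i + 1) / 2) + P.sh i))⁻¹ * (-1) := by
  rw [add_sub_add_right_eq_sub, one_div, ← neg_sub, inv_neg]
  ring

theorem exists_fac_eq (h : Config N) {i : ℕ} (him : i ≤ 2 * P.m) (Z : Finset ℕ) :
    ∃ F, RatioCls P.η P.sh P.outConsts P.inConsts i (outerOdd i Z) (outer i Z) F ∧
      ∀ z, Avoids P.η P.sh P.outConsts P.inConsts i (outerOdd i Z) (outer i Z) z →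
        P.fac h Z i z = (z i + P.sh i - (P.lam ((i + 1) / 2) + P.sh i))⁻¹ * (-1 * F z) := by
  obtain ⟨F, hF, hfF⟩ := ((hasRatio_chainFactor (P := P) h i (notMem_outerOdd i Z)
    (notMem_outer i Z)).mul (hasRatio_regRatio him P.inConsts (notMem_outer i Z))).mul
    (HasRatio.prod (outer i Z) fun k hk => hasRatio_pairFactor (P := P) hk)
  refine ⟨F, hF, fun z hz => ?_⟩
  rw [← hfF z hz, fac, one_div_lam_sub]
  ring

theorem tendsto_pairFactor (k : ℕ) (w : ℂ) :
    Tendsto (fun x => P.pairFactor k x w) (cobounded ℂ) (𝓝 1) := by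
  have h0 := ((tendsto_inv_sub_cobounded (w + (-1) ^ k * P.η)).const_mul
    (-((-1) ^ k * P.η))).const_add 1
  rw [mul_zero, add_zero] at h0
  refine h0.congr' ?_
  filter_upwards [eventually_ne_cobounded (w + (-1) ^ k * P.η)] with x hx
  have : w - x + (-1) ^ k * P.η ≠ 0 := fun e => hx (by linear_combination -e)
  have h1 : w + (-1) ^ k * P.η - x ≠ 0 := fun e => hx (by linear_combination -e)
  rw [pairFactor]
  field_simp
  ring

theorem tendsto_fac (h : Config N) {i k : ℕ} {Z : Finset ℕ} (hk : k ∈ outer i Z) (z : ℕ → ℂ) :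
    Tendsto (fun x => P.fac h Z i (Function.update z k x)) (cobounded ℂ)
      (𝓝 (P.fac h (Z.erase k) i z)) := by
  have hki : i ≠ k := (outer_subset_of hk).ne
  simp only [fac, Function.update_of_ne hki, outer_erase]
  refine tendsto_const_nhds.mul ?_
  simp only [← Finset.mul_prod_erase (outer i Z) _ hk, Function.update_self]
  have h1 : ∀ x, ∏ j ∈ (outer i Z).erase k, P.pairFactor j (Function.update z k x j) (z i) =
      ∏ j ∈ (outer i Z).erase k, P.pairFactor j (z j) (z i) := fun x =>
    Finset.prod_congr rfl fun j hj => by rw [Function.update_of_ne (Finset.ne_of_mem_erase hj)]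
  simp only [h1]
  simpa using (tendsto_pairFactor (P := P) k (z i)).mul_const
    (∏ j ∈ (outer i Z).erase k, P.pairFactor j (z j) (z i))

theorem Dom.eventually {Z : Finset ℕ} {k : ℕ} {z : ℕ → ℂ} (hP : P.Generic)
    (hz : P.Dom (Z.erase k) z) :
    ∀ᶠ x in cobounded ℂ, P.Dom Z (Function.update z k x) := by
  have h1 : ∀ᶠ x in cobounded ℂ, ∀ o ∈ P.outConsts, x ≠ o - P.sh k :=
    (Filter.eventually_all_finite finite_outConsts).2 fun o _ => eventually_ne_cobounded _
  have h2 : ∀ᶠ x in cobounded ℂ, ∀ l ∈ Z, x ≠ z l + P.sh l + P.η - P.sh k ∧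
      x ≠ z l + P.sh l - P.η - P.sh k :=
    (Filter.eventually_all_finset Z).2 fun l _ =>
      (eventually_ne_cobounded _).and (eventually_ne_cobounded _)
  filter_upwards [h1, h2] with x hx1 hx2
  constructor
  · intro j hj
    by_cases hjk : j = k
    · subst hjk
      rw [Function.update_self]
      exact fun ho => hx1 _ ho (by ring)
    · rw [Function.update_of_ne hjk]
      exact hz.1 j (Finset.mem_erase.2 ⟨hjk, hj⟩)
  · intro j hj l hl
    by_cases hjk : j = k <;> by_cases hlk : l = k
    · subst hjk; subst hlk
      have := hP.eta_ne
      simpa using this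
    · subst hjk
      rw [Function.update_self, Function.update_of_ne hlk]
      exact fun e => (hx2 l hl).1 (by linear_combination e)
    · subst hlk
      rw [Function.update_self, Function.update_of_ne hjk]
      exact fun e => (hx2 j hj).2 (by linear_combination -e)
    · rw [Function.update_of_ne hjk, Function.update_of_ne hlk]
      exact hz.2 j (Finset.mem_erase.2 ⟨hjk, hj⟩) l (Finset.mem_erase.2 ⟨hlk, hl⟩)

/-- One integration: the result is rational in the outer variables, independent of the contour, and
compatible with the limit to infinity in an outer variable. -/
theorem exists_integral_fac_mul (hP : P.Generic) {wI wO : ℂ} {v : List ℂ → List ℂ → ℂ}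
    (hv : IntegralRule wI wO v) (h : Config N) {i : ℕ} {Z : Finset ℕ} (hi : i + 1 ∈ Z)
    (him : i + 1 ≤ 2 * P.m) {g : Finset ℕ → (ℕ → ℂ) → ℂ}
    (hg : ∃ F, RatCls P.η P.sh P.outConsts (outer i Z) F ∧
      ∀ z, P.Dom (outer i Z) z → g Z z = F z) :
    ∃ T, RatCls P.η P.sh P.outConsts (outer (i + 1) Z) T ∧
      (∀ Γ z, P.Dom (outer (i + 1) Z) z → P.GoodContour Γ wI wO (i + 1) Z z →
        Γ.integral (fun w => P.fac h Z (i + 1) (Function.update z (i + 1) w) *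
          g Z (Function.update z (i + 1) w)) = T z) ∧
      ∀ k ∈ outer (i + 1) Z,
        (∀ z, P.Dom (outer i (Z.erase k)) z → Tendsto (fun x => g Z (Function.update z k x))
          (cobounded ℂ) (𝓝 (g (Z.erase k) z))) →
        ∀ z, P.Dom (outer (i + 1) (Z.erase k)) z →
          ∀ Γ, P.GoodContour Γ wI wO (i + 1) (Z.erase k) z →
          Tendsto (fun x => T (Function.update z k x)) (cobounded ℂ) (𝓝 (Γ.integral fun w =>
            P.fac h (Z.erase k) (i + 1) (Function.update z (i + 1) w) *
              g (Z.erase k) (Function.update z (i + 1) w))) := by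
  obtain ⟨F, hF, hgF⟩ := hg
  obtain ⟨Φ, hΦ, hfac⟩ := exists_fac_eq h him Z
  rw [outer_of_mem hi] at hF hgF
  have hlam := lam_mem_outConsts (P := P) (Nat.succ_pos i) him
  have hiZ := notMem_outer (i + 1) Z
  have hiY := notMem_outerOdd (i + 1) Z
  obtain ⟨T, hT, hTi, hTl⟩ := (((FracCls.const (-1)).mul hΦ.1).mul
    (hF.fracCls (I := P.inConsts) (Y := outerOdd (i + 1) Z))).exists_integral hv hiZ
    (outerOdd_subset _ _) inConsts_shift hlam
  refine ⟨T, hT, fun Γ z hz hΓ => ?_, fun k hk hlim z hz Γ hΓ => ?_⟩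
  · rw [← hTi Γ z hΓ]
    refine Contour.integral_congr fun w hw => ?_
    rw [hfac _ (hΓ.avoids hiY hiZ hw), hgF _ (hz.update hP hΓ hw), Function.update_self]
    ring
  · obtain ⟨H, hH, hHΓ⟩ := hTl k hk z
    have hki : i + 1 ≠ k := (outer_subset_of hk).ne
    have hΓ' := hΓ
    rw [GoodContour, outerOdd_erase, outer_erase] at hΓ'
    obtain ⟨_, hHt⟩ := hHΓ Γ hΓ'
    convert hHt using 2
    refine Contour.integral_congr fun w hw => ?_
    have hDom : P.Dom (outer i (Z.erase k)) (Function.update z (i + 1) w) := by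
      rw [outer_of_mem (Finset.mem_erase.2 ⟨hki, hi⟩)]
      exact hz.update hP hΓ hw
    have t1 := (tendsto_fac (P := P) h hk (Function.update z (i + 1) w)).mul (hlim _ hDom)
    have t2 := (hH w).const_mul ((w + P.sh (i + 1) - (P.lam ((i + 1 + 1) / 2) + P.sh (i + 1)))⁻¹)
    -- At a fixed point `w` of the contour both integrands are limits of the same function of `x`:
    -- for large `x` the point is admissible and avoids the special points, so the rational
    -- representatives agree with the actual factors.
    refine tendsto_nhds_unique t1 (t2.congr' ?_)
    have hDom' := hDom
    rw [outer_erase, outer_of_mem hi] at hDom'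
    have hinv : ∀ᶠ x in cobounded ℂ, Avoids P.η P.sh P.outConsts P.inConsts (i + 1)
        (outerOdd (i + 1) Z) (outer (i + 1) Z)
        (Function.update (Function.update z (i + 1) w) k x) := by
      have hav := hΓ'.avoids (fun h => hiY (Finset.mem_of_mem_erase h))
        (fun h => hiZ (Finset.mem_of_mem_erase h)) hw
      have hb : ∀ᶠ x in cobounded ℂ, ∀ c ∈ ({0, P.η, -P.η} : Set ℂ),
          x ≠ w + P.sh (i + 1) - (P.sh k + c) :=
        (Filter.eventually_all_finite (by simp)).2 fun c _ => eventually_ne_cobounded _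
      filter_upwards [hb] with x hx
      rw [Avoids, Function.update_of_ne hki, Function.update_self]
      rw [Avoids, Function.update_self] at hav
      constructor
      · intro a ha
        by_cases hak : a.1 = some k
        · rw [Form.eval_update_self hak]
          obtain ⟨a1, a2⟩ := a
          obtain rfl : a1 = some k := hak
          have h2 : a2 = 0 := ha.2
          intro e
          exact hx a2 (by simp [h2]) (by linear_combination -e)
        · rw [Form.eval_update_of_ne hak]
          refine hav.1 a ?_
          match a, ha, hak with
          | (none, _), ha, _ => exact ha
          | (some j, _), ha, hak =>
            exact ⟨Finset.mem_erase.2 ⟨fun e => hak (by rw [e]), ha.1⟩, ha.2⟩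
      · intro a ha
        by_cases hak : a.1 = some k
        · rw [Form.eval_update_self hak]
          obtain ⟨a1, a2⟩ := a
          obtain rfl : a1 = some k := hak
          have h2 : a2 = P.η ∨ a2 = -P.η := ha.2
          intro e
          exact hx a2 (by simp [h2]) (by linear_combination -e)
        · rw [Form.eval_update_of_ne hak]
          refine hav.2 a ?_
          match a, ha, hak with
          | (none, _), ha, _ => exact ha
          | (some j, _), ha, hak =>
            exact ⟨Finset.mem_erase.2 ⟨fun e => hak (by rw [e]), ha.1⟩, ha.2⟩
    filter_upwards [hDom'.eventually hP, hinv] with x hx hx'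
    rw [hfac _ hx', hgF _ hx, Function.update_comm hki, Function.update_self]
    ring

variable (wInf wFin : ℕ → ℂ)

/-- Each integration removes one variable and keeps the class: the factor of the integrated variable
has simple-fraction form, the previous result has outside poles, and the residue sums involve only
differences of inside and outside points. -/
theorem exists_inner_eq (hP : P.Generic) (h : Config N) {Z : Finset ℕ}
    (hZ : ∀ k ∈ Z, k ≤ 2 * P.m) (i : ℕ) :
    ∃ F, RatCls P.η P.sh P.outConsts (outer i Z) F ∧
      ∀ z, P.Dom (outer i Z) z → P.inner wInf wFin h Z i z = F z := by
  induction i with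
  | zero => exact ⟨_, .const 1, fun _ _ => rfl⟩
  | succ i ih =>
    by_cases hi : i + 1 ∈ Z
    · obtain ⟨T1, hT1, h1, _⟩ := exists_integral_fac_mul hP integralRule_infinity h hi (hZ _ hi)
        (g := fun Z => P.inner wInf wFin h Z i) ih
      obtain ⟨T2, hT2, h2, _⟩ := exists_integral_fac_mul hP integralRule_residueSum h hi (hZ _ hi)
        (g := fun Z => P.inner wInf wFin h Z i) ih
      refine ⟨_, ((RatCls.const (wInf (i + 1))).mul hT1).add
        ((RatCls.const (wFin (i + 1))).mul hT2), fun z hz => ?_⟩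
      rw [inner, if_pos hi, h1 _ z hz (goodContour_inf P _ Z z),
        h2 _ z hz (hz.goodContour_fin hP)]
    · simp only [inner, if_neg hi]
      rw [← outer_of_notMem hi]
      exact ih

/-- The pair factors with `z k` tend to 1, which erases `z k` from the integrand. The poles that run
off to infinity with it contribute nothing to the limit of the integrals. -/
theorem tendsto_inner (hP : P.Generic) (h : Config N) {Z : Finset ℕ}
    (hZ : ∀ k ∈ Z, k ≤ 2 * P.m) (i : ℕ) {k : ℕ} (hk : k ∈ outer i Z) (z : ℕ → ℂ)
    (hz : P.Dom (outer i (Z.erase k)) z) :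
    Tendsto (fun x => P.inner wInf wFin h Z i (Function.update z k x)) (cobounded ℂ)
      (𝓝 (P.inner wInf wFin h (Z.erase k) i z)) := by
  induction i generalizing z with
  | zero => exact tendsto_const_nhds
  | succ i ih =>
    have hki : k ≠ i + 1 := (outer_subset_of hk).ne'
    have hk' : k ∈ outer i Z := by
      simp only [outer, Finset.mem_filter] at hk ⊢
      exact ⟨hk.1, by omega⟩
    by_cases hi : i + 1 ∈ Z
    · have hi' : i + 1 ∈ Z.erase k := Finset.mem_erase.2 ⟨hki.symm, hi⟩
      obtain ⟨T1, hT1, h1, l1⟩ := exists_integral_fac_mul hP integralRule_infinity h hi (hZ _ hi)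
        (g := fun Z => P.inner wInf wFin h Z i) (exists_inner_eq wInf wFin hP h hZ i)
      obtain ⟨T2, hT2, h2, l2⟩ := exists_integral_fac_mul hP integralRule_residueSum h hi (hZ _ hi)
        (g := fun Z => P.inner wInf wFin h Z i) (exists_inner_eq wInf wFin hP h hZ i)
      have t1 := l1 k hk (fun z hz => ih hk' z hz) z hz _ (goodContour_inf P _ _ z)
      have t2 := l2 k hk (fun z hz => ih hk' z hz) z hz _ (hz.goodContour_fin hP)
      simp only [inner, if_pos hi, if_pos hi']
      -- The contours in `inner` change with `x`; `T1` and `T2` give the integrals over all of them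
      -- at once, as soon as `x` is large enough for the outer variables to be admissible.
      refine ((t1.const_mul (wInf (i + 1))).add (t2.const_mul (wFin (i + 1)))).congr' ?_
      rw [outer_erase] at hz
      filter_upwards [hz.eventually hP] with x hx
      rw [h1 _ _ hx (goodContour_inf P _ Z _), h2 _ _ hx (hx.goodContour_fin hP)]
    · have hi' : i + 1 ∉ Z.erase k := fun h => hi (Finset.mem_of_mem_erase h)
      simp only [inner, if_neg hi, if_neg hi']
      rw [← outer_of_notMem hi'] at hz
      exact ih hk' z hz

end Params

end

end TwistedXXX

namespace TwistedXXX

open Filter Topology Bornology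

noncomputable section

namespace Params

variable {N R : ℕ} {P : Params N R}

/-! ### Evaluation of an outer variable at a point of the chain -/

/-- The numerator of the pair factor cancels the factor of d_h at the site `n`, and its denominator
supplies the factor of d_{h'} there. This is how a residue at the chain changes the configuration
seen by the inner variables. -/
theorem chainFactor_mul_pairFactor {h h' : Config N} {n : Fin N} (i k : ℕ) {x w : ℂ}
    (h1 : x = shifted P.η P.ξ h n) (h2 : x - (-1) ^ k * P.η = shifted P.η P.ξ h' n)
    (h3 : ∀ l, l ≠ n → h' l = h l) (hw : w ≠ x) :
    P.chainFactor h i w * P.pairFactor k x w = P.chainFactor h' i w := by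
  have hr : ∏ l ∈ Finset.univ.erase n, (w - shifted P.η P.ξ h' l) =
      ∏ l ∈ Finset.univ.erase n, (w - shifted P.η P.ξ h l) :=
    Finset.prod_congr rfl fun l hl => by
      simp only [shifted, h3 l (Finset.ne_of_mem_erase hl)]
  have hwx : w - x ≠ 0 := sub_ne_zero.2 hw
  simp only [chainFactor, pairFactor, dh]
  rw [← Finset.mul_prod_erase _ (fun l => w - shifted P.η P.ξ h l) (Finset.mem_univ n),
    ← Finset.mul_prod_erase _ (fun l => w - shifted P.η P.ξ h' l) (Finset.mem_univ n), hr, ← h1,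
    ← h2, show w - x + (-1) ^ k * P.η = w - (x - (-1) ^ k * P.η) by ring, div_mul_div_comm]
  set b := ∏ l ∈ Finset.univ.erase n, (w - shifted P.η P.ξ h l)
  rw [mul_comm _ (w - x), mul_assoc, mul_div_mul_left _ _ hwx, mul_comm b]

theorem fac_eq_fac_erase {h h' : Config N} {n : Fin N} {i k : ℕ} {Z : Finset ℕ} {z : ℕ → ℂ}
    (hk : k ∈ outer i Z) (h1 : z k = shifted P.η P.ξ h n)
    (h2 : z k - (-1) ^ k * P.η = shifted P.η P.ξ h' n) (h3 : ∀ l, l ≠ n → h' l = h l)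
    (hw : z i ≠ z k) : P.fac h Z i z = P.fac h' (Z.erase k) i z := by
  rw [fac, fac, outer_erase, ← Finset.mul_prod_erase (outer i Z) _ hk,
    ← chainFactor_mul_pairFactor i k h1 h2 h3 hw]
  ring

/-- The configuration obtained from `h` by the move that the variable `z k` describes. -/
def flip (k : ℕ) (n : Fin N) (h : Config N) : Config N :=
  Function.update h n (if Even k then 1 else 0)

theorem shifted_of_flip {k : ℕ} {n : Fin N} {h : Config N} (hn : h n = if Even k then 0 else 1) :
    shifted P.η P.ξ h n = P.ξ n - P.sh k ∧
      P.ξ n - P.sh k - (-1) ^ k * P.η = shifted P.η P.ξ (flip k n h) n := by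
  by_cases hk : Even k
  · rw [if_pos hk] at hn
    simp [shifted, flip, hn, sh, hk]
  · rw [if_neg hk] at hn
    simp [shifted, flip, hn, sh, hk, (Nat.not_even_iff_odd.1 hk).neg_one_pow]

theorem sh_sub_sh (i k : ℕ) : P.sh i - P.sh k = 0 ∨ P.sh i - P.sh k = P.η ∨
    P.sh i - P.sh k = -P.η := by
  by_cases hi : Even i <;> by_cases hk : Even k <;> simp [sh, hi, hk]

variable (wInf wFin : ℕ → ℂ)

/-- At x_k = ξ_n the points x_k and x_k ± η already belong to the constant special points. Erasing
`k` therefore does not change the two sets, nor the contours, which are chosen as functions of these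
sets; the integrands agree by the cancellation with the chain factor. -/
theorem inner_eq_inner_flip (hP : P.Generic) {h : Config N} {Z : Finset ℕ} (i : ℕ) {k : ℕ}
    (hk : k ∈ outer i Z) {n : Fin N} (hn : h n = if Even k then 0 else 1) (z : ℕ → ℂ)
    (hz : P.Dom (outer i Z) z) (hzk : z k = P.ξ n - P.sh k) :
    P.inner wInf wFin h Z i z = P.inner wInf wFin (flip k n h) (Z.erase k) i z := by
  induction i generalizing z with
  | zero => rfl
  | succ i ih =>
    have hki : k ≠ i + 1 := (outer_subset_of hk).ne'
    have hk' : k ∈ outer i Z := by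
      simp only [outer, Finset.mem_filter] at hk ⊢
      exact ⟨hk.1, by omega⟩
    by_cases hi : i + 1 ∈ Z
    · have hi' : i + 1 ∈ Z.erase k := Finset.mem_erase.2 ⟨hki.symm, hi⟩
      have hin : P.inPts (i + 1) (Z.erase k) z = P.inPts (i + 1) Z z := by
        ext p
        constructor
        · rintro ⟨a, ha, rfl⟩
          refine ⟨a, ?_, rfl⟩
          match a, ha with
          | (none, _), ha => exact ha
          | (some j, _), ha =>
            rw [outerOdd_erase] at ha
            exact ⟨Finset.mem_of_mem_erase ha.1, ha.2⟩
        · rintro ⟨a, ha, rfl⟩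
          match a, ha with
          | (none, c), ha => exact ⟨(none, c), ha, rfl⟩
          | (some j, c), ha =>
            by_cases hjk : j = k
            · obtain ⟨_, rfl⟩ := ha
              exact ⟨(none, P.ξ n), ⟨n, rfl⟩, by simp [Form.eval, hjk, hzk]⟩
            · exact ⟨(some j, c), ⟨by
                rw [outerOdd_erase]; exact Finset.mem_erase.2 ⟨hjk, ha.1⟩, ha.2⟩, rfl⟩
      have hout : P.outPts (i + 1) (Z.erase k) z = P.outPts (i + 1) Z z := by
        ext p
        constructor
        · rintro ⟨a, ha, rfl⟩
          refine ⟨a, ?_, rfl⟩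
          match a, ha with
          | (none, _), ha => exact ha
          | (some j, _), ha =>
            rw [outer_erase] at ha
            exact ⟨Finset.mem_of_mem_erase ha.1, ha.2⟩
        · rintro ⟨a, ha, rfl⟩
          match a, ha with
          | (none, c), ha => exact ⟨(none, c), ha, rfl⟩
          | (some j, c), ha =>
            by_cases hjk : j = k
            · have hc : P.ξ n + c ∈ P.outConsts := by
                have := inConsts_shift (P := P) (P.ξ n) ⟨n, rfl⟩
                rcases ha.2 with rfl | rfl
                · exact this.1
                · exact this.2
              exact ⟨(none, P.ξ n + c), hc, by simp [Form.eval, hjk, hzk]⟩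
            · exact ⟨(some j, c), ⟨by
                rw [outer_erase]; exact Finset.mem_erase.2 ⟨hjk, ha.1⟩, ha.2⟩, rfl⟩
      obtain ⟨hs1, hs2⟩ := shifted_of_flip (P := P) hn
      have key : ∀ (Γ : Contour) (wI wO : ℂ), P.GoodContour Γ wI wO (i + 1) Z z →
          Γ.integral (fun w => P.fac h Z (i + 1) (Function.update z (i + 1) w) *
            inner P wInf wFin h Z i (Function.update z (i + 1) w)) =
          Γ.integral (fun w => P.fac (flip k n h) (Z.erase k) (i + 1) (Function.update z (i + 1) w) *
            inner P wInf wFin (flip k n h) (Z.erase k) i (Function.update z (i + 1) w)) := by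
        intro Γ wI wO hΓ
        refine Contour.integral_congr fun w hw => ?_
        have hzk' : Function.update z (i + 1) w k = z k := Function.update_of_ne hki _ _
        rw [ih hk' (Function.update z (i + 1) w)
          (by rw [outer_of_mem hi]; exact hz.update hP hΓ hw) (by rw [hzk', hzk]),
          fac_eq_fac_erase (h' := flip k n h) hk (by rw [hzk', hzk, hs1])
            (by rw [hzk', hzk, hs2]) (fun l hl => by simp [flip, Function.update_of_ne hl])]
        rw [hzk', Function.update_self, hzk]
        -- A point `w` equal to `z k` would have the coordinate ξ_n or ξ_n ± η, all of which the
        -- contour avoids.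
        intro hwe
        obtain ⟨ha1, ha2⟩ := hΓ.avoids (notMem_outerOdd (i + 1) Z) (notMem_outer (i + 1) Z) hw
        have hsh := inConsts_shift (P := P) (P.ξ n) ⟨n, rfl⟩
        rcases sh_sub_sh (P := P) (i + 1) k with hd | hd | hd
        · exact ha1 (none, P.ξ n) ⟨n, rfl⟩ (by
            rw [Function.update_self, hwe]; simp only [Form.eval]; linear_combination hd)
        · exact ha2 (none, P.ξ n + P.η) hsh.1 (by
            rw [Function.update_self, hwe]; simp only [Form.eval]; linear_combination hd)
        · exact ha2 (none, P.ξ n - P.η) hsh.2 (by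
            rw [Function.update_self, hwe]; simp only [Form.eval]; linear_combination hd)
      simp only [inner, if_pos hi, if_pos hi']
      rw [hin, hout, key _ _ _ (goodContour_inf P _ Z z), key _ _ _ (hz.goodContour_fin hP)]
    · have hi' : i + 1 ∉ Z.erase k := fun h => hi (Finset.mem_of_mem_erase h)
      simp only [inner, if_neg hi, if_neg hi']
      rw [← outer_of_notMem hi] at hz
      exact ih hk' z hz hzk

/-! ### Integration over the outermost variable -/

/-- The residue of the factor of `z i` at the point `n` of the chain. -/
def resCoeff (P : Params N R) (h : Config N) (i : ℕ) (n : Fin N) : ℂ :=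
  1 / (P.lam ((i + 1) / 2) - shifted P.η P.ξ h n) *
    ((if Even i then aFun P.η P.ξ (shifted P.η P.ξ h n) else dFun P.ξ (shifted P.η P.ξ h n)) /
      ∏ k ∈ Finset.univ.erase n, (shifted P.η P.ξ h n - shifted P.η P.ξ h k)) *
    P.regRatio i (shifted P.η P.ξ h n)

/-- The function a vanishes at ξ_n - η and d vanishes at ξ_n, so only sites that can actually be
flipped have a residue. -/
theorem numerator_eq_zero {h : Config N} {i : ℕ} {n : Fin N}
    (hn : h n ≠ if Even i then 0 else 1) :
    (if Even i then aFun P.η P.ξ (shifted P.η P.ξ h n) else dFun P.ξ (shifted P.η P.ξ h n)) =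
      0 := by
  have h2 : ∀ a : Fin 2, a = 0 ∨ a = 1 := by decide
  by_cases hi : Even i
  · simp only [if_pos hi] at hn ⊢
    have : h n = 1 := (h2 _).resolve_left hn
    exact Finset.prod_eq_zero (Finset.mem_univ n) (by simp [shifted, this])
  · simp only [if_neg hi] at hn ⊢
    have : h n = 0 := (h2 _).resolve_right hn
    exact Finset.prod_eq_zero (Finset.mem_univ n) (by simp [shifted, this])

theorem chainFactor_eq (hP : P.Generic) (h : Config N) (i : ℕ) {w : ℂ}
    (hw : ∀ n, w ≠ shifted P.η P.ξ h n) :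
    P.chainFactor h i w = 1 + ∑ n, (if Even i then aFun P.η P.ξ (shifted P.η P.ξ h n) else
      dFun P.ξ (shifted P.η P.ξ h n)) /
        (∏ k ∈ Finset.univ.erase n, (shifted P.η P.ξ h n - shifted P.η P.ξ h k)) *
        (w - shifted P.η P.ξ h n)⁻¹ := by
  by_cases hi : Even i
  · simp only [chainFactor, if_pos hi]
    have := prod_div_prod_eq (fun n => P.ξ n - P.η) (hP.shifted_injective h) hw
    simp only [← sub_add] at this
    exact this
  · simp only [chainFactor, if_neg hi]
    exact prod_div_prod_eq P.ξ (hP.shifted_injective h) hw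

theorem Dom.empty (z : ℕ → ℂ) : P.Dom ∅ z := by simp [Dom]

/-- A rational function of no variables is constant; values at absent or already integrated indices
are irrelevant, which justifies the default argument 0 in `value` below. -/
theorem inner_congr_update (hP : P.Generic) (h : Config N) {Z : Finset ℕ}
    (hZ : ∀ k ∈ Z, k ≤ 2 * P.m) {i : ℕ} (ho : outer i Z = ∅) (z : ℕ → ℂ) (k : ℕ) (x : ℂ) :
    P.inner wInf wFin h Z i (Function.update z k x) = P.inner wInf wFin h Z i z := by
  obtain ⟨F, hF, hFe⟩ := exists_inner_eq wInf wFin hP h hZ i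
  rw [ho] at hF hFe
  rw [hFe _ (Dom.empty _), hFe _ (Dom.empty _)]
  exact hF.update (Finset.notMem_empty k) z x

/-- At infinity the chain, Q- and λ-ratios tend to 1, and so do the pair factors with the inner
variables. The minus sign of 1 / (λ - w) compensates the winding number -1. -/
theorem integral_inf_top (hP : P.Generic) (h : Config N) {Z : Finset ℕ}
    (hZ : ∀ k ∈ Z, k ≤ 2 * P.m) {i : ℕ} (hi : i + 1 ∈ Z) (ho : outer (i + 1) Z = ∅) (z : ℕ → ℂ)
    {Γ : Contour} (hΓ : P.GoodContour Γ (-1) (-1) (i + 1) Z z) :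
    Γ.integral (fun w => P.fac h Z (i + 1) (Function.update z (i + 1) w) *
      P.inner wInf wFin h Z i (Function.update z (i + 1) w)) =
      P.inner wInf wFin h (Z.erase (i + 1)) i z := by
  have hz : P.Dom (outer (i + 1) Z) z := by rw [ho]; exact Dom.empty z
  have hmem : i + 1 ∈ outer i Z := Finset.mem_filter.2 ⟨hi, by omega⟩
  have ho' : outer i (Z.erase (i + 1)) = ∅ := by
    rw [outer_erase, outer_of_mem hi, ho]; simp
  obtain ⟨F, hF, hFe⟩ := exists_inner_eq wInf wFin hP h hZ i
  obtain ⟨Φ, hΦ, hfac⟩ := exists_fac_eq h (hZ _ hi) Z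
  have hlim := tendsto_inner wInf wFin hP h hZ i hmem z (by rw [ho']; exact Dom.empty z)
  have hDom : ∀ᶠ x in cobounded ℂ, P.Dom (outer i Z) (Function.update z (i + 1) x) :=
    Dom.eventually hP (by rw [← outer_erase, ho']; exact Dom.empty z)
  have hlamO := lam_mem_outConsts (P := P) (Nat.succ_pos i) (hZ _ hi)
  have hF' := hF
  rw [outer_of_mem hi] at hF'
  obtain ⟨l, hl, hint⟩ := (((FracCls.const (-1)).mul hΦ.1).mul
    (hF'.fracCls (I := P.inConsts) (Y := outerOdd (i + 1) Z))).integral_infinity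
    (notMem_outer _ _) (outerOdd_subset _ _) hlamO hΓ
  have hl' : Tendsto (fun w => -1 * Φ (Function.update z (i + 1) w) *
      F (Function.update z (i + 1) w)) (cobounded ℂ)
      (𝓝 (-1 * 1 * P.inner wInf wFin h (Z.erase (i + 1)) i z)) := by
    refine ((hΦ.2 z).const_mul (-1)).mul (hlim.congr' ?_)
    filter_upwards [hDom] with x hx using hFe _ hx
  rw [← neg_neg (P.inner wInf wFin h (Z.erase (i + 1)) i z),
    show -P.inner wInf wFin h (Z.erase (i + 1)) i z = l by
      rw [tendsto_nhds_unique hl hl']; ring, ← hint]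
  refine Contour.integral_congr fun w hw => ?_
  rw [hfac _ (hΓ.avoids (notMem_outerOdd _ _) (notMem_outer _ _) hw), hFe _ (by
    rw [outer_of_mem hi]; exact hz.update hP hΓ hw), Function.update_self]
  ring

theorem shifted_notMem_support {h : Config N} {i : ℕ} {Z : Finset ℕ} {z : ℕ → ℂ} {Γ : Contour}
    {wI wO : ℂ} (hΓ : P.GoodContour Γ wI wO i Z z) (n : Fin N) :
    shifted P.η P.ξ h n ∉ Γ.support := by
  have h2 : ∀ a : Fin 2, a = 0 ∨ a = 1 := by decide
  have hsh := inConsts_shift (P := P) (P.ξ n) ⟨n, rfl⟩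
  have hin := (hΓ.1 (none, P.ξ n) ⟨n, rfl⟩).1
  have hp := (hΓ.2 (none, P.ξ n + P.η) hsh.1).1
  have hm := (hΓ.2 (none, P.ξ n - P.η) hsh.2).1
  by_cases hi : Even i <;> rcases h2 (h n) with hn | hn <;>
    simp [shifted, hn, Form.eval, sh, hi] at hin hp hm ⊢ <;> assumption

/-- With no outer variable left, the only inside poles are the ξ_n - sh_{i+1}, and they come from
the chain factor alone. Its partial fraction expansion has simple poles, at each of which the rest
of the integrand is evaluated; the inner integral then becomes the one for the flipped
configuration. -/
theorem integral_fin_top (hP : P.Generic) (h : Config N) {Z : Finset ℕ}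
    (hZ : ∀ k ∈ Z, k ≤ 2 * P.m) {i : ℕ} (hi : i + 1 ∈ Z) (ho : outer (i + 1) Z = ∅) (z : ℕ → ℂ)
    {Γ : Contour} (hΓ : P.GoodContour Γ 1 0 (i + 1) Z z) :
    Γ.integral (fun w => P.fac h Z (i + 1) (Function.update z (i + 1) w) *
      P.inner wInf wFin h Z i (Function.update z (i + 1) w)) =
      ∑ n, P.resCoeff h (i + 1) n *
        P.inner wInf wFin (flip (i + 1) n h) (Z.erase (i + 1)) i z := by
  have hz : P.Dom (outer (i + 1) Z) z := by rw [ho]; exact Dom.empty z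
  have hmem : i + 1 ∈ outer i Z := Finset.mem_filter.2 ⟨hi, by omega⟩
  have ho' : outer i (Z.erase (i + 1)) = ∅ := by
    rw [outer_erase, outer_of_mem hi, ho]; simp
  obtain ⟨F, hF, hFe⟩ := exists_inner_eq wInf wFin hP h hZ i
  have hoi : outer i Z = insert (i + 1) ∅ := by rw [outer_of_mem hi, ho]
  rw [hoi] at hF hFe
  obtain ⟨Φ, hΦ, hreg⟩ := hasRatio_regRatio (P := P) (hZ _ hi) ∅ (Y := ∅) (Z := ∅)
    (Finset.notMem_empty _)
  have hlamO := lam_mem_outConsts (P := P) (Nat.succ_pos i) (hZ _ hi)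
  -- The integrand without the chain factor, written with rational representatives so that it has no
  -- inside poles. It is compared with the actual integrand only on the contour and at the flippable
  -- sites.
  set g : (ℕ → ℂ) → ℂ := fun z =>
    (z (i + 1) + P.sh (i + 1) - (P.lam ((i + 1 + 1) / 2) + P.sh (i + 1)))⁻¹ *
      (-1 * (Φ z * F z)) with hg
  have hgc : FracCls P.η P.sh P.outConsts ∅ (i + 1) ∅ ∅ g :=
    (FracCls.inv_out (b := (none, _)) hlamO).mul ((FracCls.const (-1)).mul (hΦ.1.mul hF.fracCls))
  have hΓ0 : Γ.Winds 1 0 P.η P.sh P.outConsts ∅ (i + 1) ∅ ∅ z := by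
    refine ⟨fun a ha => ?_, ?_⟩
    · match a, ha with
      | (none, _), ha => exact absurd ha (Set.notMem_empty _)
      | (some _, _), ha => exact absurd ha.1 (Finset.notMem_empty _)
    · have := hΓ.2
      rwa [ho] at this
  have hne := Finset.notMem_empty (i + 1)
  have hsupp := fun n => shifted_notMem_support (h := h) hΓ n
  have hgeq : ∀ x, P.Dom (insert (i + 1) ∅) (Function.update z (i + 1) x) →
      Avoids P.η P.sh P.outConsts ∅ (i + 1) ∅ ∅ (Function.update z (i + 1) x) →
      g (Function.update z (i + 1) x) = 1 / (P.lam ((i + 1 + 1) / 2) - x) *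
        P.regRatio (i + 1) x * P.inner wInf wFin h Z i (Function.update z (i + 1) x) := by
    intro x hx1 hx2
    have hr := hreg _ hx2
    simp only [Function.update_self] at hr
    simp only [hg]
    rw [← hr, ← hFe _ hx1, one_div_lam_sub, Function.update_self]
    ring
  have hpole : ∀ n, (if Even (i + 1) then aFun P.η P.ξ (shifted P.η P.ξ h n) else
      dFun P.ξ (shifted P.η P.ξ h n)) /
        (∏ k ∈ Finset.univ.erase n, (shifted P.η P.ξ h n - shifted P.η P.ξ h k)) *
      Γ.integral (fun w => (w - shifted P.η P.ξ h n)⁻¹ * g (Function.update z (i + 1) w)) =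
      P.resCoeff h (i + 1) n *
        P.inner wInf wFin (flip (i + 1) n h) (Z.erase (i + 1)) i z := by
    intro n
    by_cases hn : h n = if Even (i + 1) then 0 else 1
    · obtain ⟨hs1, hs2⟩ := shifted_of_flip (P := P) hn
      have hw1 := hΓ.1 (none, P.ξ n) ⟨n, rfl⟩
      simp only [Form.eval] at hw1
      rw [← hs1] at hw1
      have hD : P.Dom (insert (i + 1) ∅) (Function.update z (i + 1) (shifted P.η P.ξ h n)) := by
        have := hP.eta_ne
        refine ⟨fun k hk => ?_, fun k hk l hl => ?_⟩
        · obtain rfl : k = i + 1 := by simpa using hk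
          rw [Function.update_self, hs1, sub_add_cancel]
          exact hP.notMem_outConsts n
        · obtain rfl : k = i + 1 := by simpa using hk
          obtain rfl : l = i + 1 := by simpa using hl
          simpa using this
      have hA : Avoids P.η P.sh P.outConsts ∅ (i + 1) ∅ ∅
          (Function.update z (i + 1) (shifted P.η P.ξ h n)) := by
        constructor
        · intro a ha
          match a, ha with
          | (none, _), ha => exact absurd ha (Set.notMem_empty _)
          | (some _, _), ha => exact absurd ha.1 (Finset.notMem_empty _)
        · intro a ha
          match a, ha with
          | (none, o), ha =>
            rw [Function.update_self, hs1, sub_add_cancel]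
            simp only [Form.eval]
            intro e
            exact hP.notMem_outConsts n (by rw [sub_eq_zero.1 e]; exact ha)
          | (some _, _), ha => exact absurd ha.1 (Finset.notMem_empty _)
      rw [hgc.integral_simple_pole hne hΓ0 hw1, hgeq _ hD hA,
        inner_eq_inner_flip wInf wFin hP i hmem hn _ (by rw [hoi]; exact hD)
          (by rw [Function.update_self, hs1]),
        inner_congr_update wInf wFin hP _ (fun k hk => hZ k (Finset.mem_of_mem_erase hk)) ho',
        resCoeff]
      ring
    · rw [resCoeff, numerator_eq_zero hn]
      simp
  simp only [← hpole]
  have hcg : ContinuousOn (fun w => g (Function.update z (i + 1) w)) Γ.support :=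
    hgc.continuousOn hne subset_rfl hΓ0
  have hci : ∀ n, ContinuousOn (fun w => (w - shifted P.η P.ξ h n)⁻¹) Γ.support := fun n =>
    ContinuousOn.inv₀ (by fun_prop) fun w hw => by
      intro e
      exact hsupp n (by rwa [← sub_eq_zero.1 e])
  have hcn : ∀ n, ContinuousOn (fun w => (if Even (i + 1) then
      aFun P.η P.ξ (shifted P.η P.ξ h n) else dFun P.ξ (shifted P.η P.ξ h n)) /
        (∏ k ∈ Finset.univ.erase n, (shifted P.η P.ξ h n - shifted P.η P.ξ h k)) *
      ((w - shifted P.η P.ξ h n)⁻¹ * g (Function.update z (i + 1) w))) Γ.support := fun n =>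
    continuousOn_const.mul ((hci n).mul hcg)
  simp only [← Contour.integral_const_mul]
  -- The constant term 1 of the expanded chain factor contributes nothing, because `g` has no pole
  -- inside.
  have h0 := hgc.integral_eq_zero hne hΓ0
  have h1 := Contour.integral_add hcg (continuousOn_finsetSum Finset.univ fun n _ => hcn n)
  rw [h0, zero_add, Contour.integral_sum _ fun n _ => hcn n] at h1
  rw [← h1]
  refine Contour.integral_congr fun w hw => ?_
  have hD := hz.update hP hΓ hw
  rw [ho] at hD
  have hA := hΓ0.avoids hne hne hw
  have hch := chainFactor_eq hP h (i + 1) (w := w) fun n e => hsupp n (e ▸ hw)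
  rw [fac, ho, Finset.prod_empty, mul_one, Function.update_self, hch, hgeq w hD hA]
  rw [mul_assoc, mul_assoc, mul_left_comm, add_mul, one_mul, Finset.sum_mul]
  simp only [mul_assoc]

/-- Integration over the outermost variable. -/
theorem inner_top (hP : P.Generic) (h : Config N) {Z : Finset ℕ}
    (hZ : ∀ k ∈ Z, k ≤ 2 * P.m) {i : ℕ} (hi : i + 1 ∈ Z) (ho : outer (i + 1) Z = ∅) (z : ℕ → ℂ) :
    P.inner wInf wFin h Z (i + 1) z =
      wInf (i + 1) * P.inner wInf wFin h (Z.erase (i + 1)) i z +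
        wFin (i + 1) * ∑ n, P.resCoeff h (i + 1) n *
          P.inner wInf wFin (flip (i + 1) n h) (Z.erase (i + 1)) i z := by
  have hz : P.Dom (outer (i + 1) Z) z := by rw [ho]; exact Dom.empty z
  rw [inner, if_pos hi, integral_inf_top wInf wFin hP h hZ hi ho z (goodContour_inf P _ Z z),
    integral_fin_top wInf wFin hP h hZ hi ho z (hz.goodContour_fin hP)]

end Params

end

end TwistedXXX

/-! ### The recursion of the integral without outer variables, and its identification with the
integral of the statement -/

namespace TwistedXXX

open Filter Topology Bornology

noncomputable section

/-- The present variables among `z 1, …, z i`. -/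
def present (ε : ℕ → Fin 2) (i : ℕ) : Finset ℕ := (Finset.Icc 1 i).filter fun k => ebar ε k = 1

theorem ebar_eq_zero_or_one (ε : ℕ → Fin 2) (i : ℕ) : ebar ε i = 0 ∨ ebar ε i = 1 := by
  have : (ε i : ℕ) < 2 := (ε i).isLt
  unfold ebar
  split_ifs <;> omega

theorem prod_Icc_two_mul (f : ℕ → ℂ) (m : ℕ) :
    ∏ i ∈ Finset.Icc 1 (2 * m), f i = ∏ j ∈ Finset.Icc 1 m, f (2 * j) * f (2 * j - 1) := by
  induction m with
  | zero => simp
  | succ m ih =>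
    rw [Finset.prod_Icc_succ_top (by omega), ← ih, show 2 * (m + 1) = 2 * m + 1 + 1 by ring,
      Finset.prod_Icc_succ_top (by omega), Finset.prod_Icc_succ_top (by omega),
      Nat.add_sub_cancel]
    ring

namespace Params

variable {N R : ℕ} {P : Params N R}

theorem present_succ_of_eq_one {ε : ℕ → Fin 2} {i : ℕ} (h : ebar ε (i + 1) = 1) :
    i + 1 ∈ present ε (i + 1) ∧ (present ε (i + 1)).erase (i + 1) = present ε i := by
  constructor
  · simp [present, h]
  · ext k
    simp only [present, Finset.mem_erase, Finset.mem_filter, Finset.mem_Icc]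
    constructor
    · rintro ⟨h1, h2, h3⟩; exact ⟨by omega, h3⟩
    · rintro ⟨h1, h2⟩; exact ⟨by omega, by omega, h2⟩

theorem present_succ_of_eq_zero {ε : ℕ → Fin 2} {i : ℕ} (h : ebar ε (i + 1) = 0) :
    i + 1 ∉ present ε i ∧ present ε (i + 1) = present ε i := by
  constructor
  · simp [present]
  · ext k
    simp only [present, Finset.mem_filter, Finset.mem_Icc]
    constructor
    · rintro ⟨h2, h3⟩
      refine ⟨⟨h2.1, ?_⟩, h3⟩
      by_contra hk
      obtain rfl : k = i + 1 := by omega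
      omega
    · rintro ⟨h1, h2⟩; exact ⟨by omega, h2⟩

theorem outer_present (ε : ℕ → Fin 2) (i : ℕ) : outer i (present ε i) = ∅ := by
  ext k
  simp only [outer, present, Finset.mem_filter, Finset.mem_Icc, Finset.notMem_empty, iff_false]
  omega

/-- The nested integral over the present variables among `z 1, …, z i`, without outer variables. -/
def value (P : Params N R) (wInf wFin : ℕ → ℂ) (ε : ℕ → Fin 2) (i : ℕ) (h : Config N) : ℂ :=
  P.inner wInf wFin h (present ε i) i 0

variable (wInf wFin : ℕ → ℂ)

theorem value_zero (ε : ℕ → Fin 2) (h : Config N) : P.value wInf wFin ε 0 h = 1 := rfl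

theorem value_succ_of_eq_zero {ε : ℕ → Fin 2} {i : ℕ} (he : ebar ε (i + 1) = 0) (h : Config N) :
    P.value wInf wFin ε (i + 1) h = P.value wInf wFin ε i h := by
  obtain ⟨h1, h2⟩ := present_succ_of_eq_zero he
  rw [value, value, inner, h2, if_neg h1]

theorem value_succ_of_eq_one (hP : P.Generic) {ε : ℕ → Fin 2} {i : ℕ} (him : i + 1 ≤ 2 * P.m)
    (he : ebar ε (i + 1) = 1) (h : Config N) :
    P.value wInf wFin ε (i + 1) h = wInf (i + 1) * P.value wInf wFin ε i h +
      wFin (i + 1) * ∑ n, P.resCoeff h (i + 1) n *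
        P.value wInf wFin ε i (flip (i + 1) n h) := by
  obtain ⟨h1, h2⟩ := present_succ_of_eq_one he
  have hZ : ∀ k ∈ present ε (i + 1), k ≤ 2 * P.m := by
    intro k hk
    simp only [present, Finset.mem_filter, Finset.mem_Icc] at hk
    omega
  simp only [value]
  rw [inner_top wInf wFin hP h hZ h1 (outer_present ε _), h2]

/-! ### The nested integral of the full integrand -/

/-- Each pair factor is assigned to the inner one of its two variables. The index (k + 1) / 2 is j
both for k = 2j and for k = 2j - 1. -/
theorem integrand_eq (h : Config N) (ε : ℕ → Fin 2) (z : ℕ → ℂ) :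
    integrand P.η P.ξ P.q P.m ε P.lam h z =
      ∏ k ∈ present ε (2 * P.m), P.fac h (present ε (2 * P.m)) k z := by
  have h1 : ∏ j ∈ Finset.Icc 1 P.m,
      evenFactor P.η P.ξ P.q P.lam h j (z (2 * j)) ^ ebar ε (2 * j) *
        oddFactor P.η P.ξ P.q P.lam h j (z (2 * j - 1)) ^ ebar ε (2 * j - 1) =
      ∏ k ∈ present ε (2 * P.m),
        1 / (P.lam ((k + 1) / 2) - z k) * P.chainFactor h k (z k) * P.regRatio k (z k) := by
    rw [present, Finset.prod_filter, prod_Icc_two_mul]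
    refine Finset.prod_congr rfl fun j hj => ?_
    rw [Finset.mem_Icc] at hj
    have hj1 : (2 * j + 1) / 2 = j := by omega
    have hj2 : (2 * j - 1 + 1) / 2 = j := by omega
    have he : Even (2 * j) := even_two_mul j
    have ho : ¬ Even (2 * j - 1) := by
      rw [Nat.not_even_iff_odd]; exact ⟨j - 1, by omega⟩
    congr 1
    · simp only [chainFactor, regRatio, hj1, if_pos he]
      rcases ebar_eq_zero_or_one ε (2 * j) with h0 | h0
      · simp [h0]
      · rw [h0, if_pos rfl, pow_one, evenFactor]; ring
    · simp only [chainFactor, regRatio, hj2, if_neg ho]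
      rcases ebar_eq_zero_or_one ε (2 * j - 1) with h0 | h0
      · simp [h0]
      · rw [h0, if_pos rfl, pow_one, oddFactor]; ring
  have h2 : ∏ k ∈ Finset.Icc 1 (2 * P.m), ∏ j ∈ Finset.Ico 1 k,
      ((z j - z k) / (z j - z k + (-1) ^ k * P.η)) ^ (ebar ε j * ebar ε k) =
      ∏ j ∈ present ε (2 * P.m), ∏ k ∈ outer j (present ε (2 * P.m)),
        P.pairFactor k (z k) (z j) := by
    rw [Finset.prod_comm' (t' := Finset.Icc 1 (2 * P.m))
      (s' := fun j => (Finset.Icc 1 (2 * P.m)).filter (j < ·)) (fun k j => by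
        simp only [Finset.mem_Icc, Finset.mem_Ico, Finset.mem_filter]; omega)]
    have hp (f : ℕ → ℂ) : ∏ j ∈ present ε (2 * P.m), f j =
        ∏ j ∈ Finset.Icc 1 (2 * P.m), if ebar ε j = 1 then f j else 1 := by
      rw [present, Finset.prod_filter]
    rw [hp]
    refine Finset.prod_congr rfl fun j _ => ?_
    rcases ebar_eq_zero_or_one ε j with h0 | h0
    · simp [h0]
    · rw [if_pos h0, outer, present, Finset.filter_comm,
        Finset.prod_filter (fun k => ebar ε k = 1)]
      refine Finset.prod_congr rfl fun k _ => ?_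
      rcases ebar_eq_zero_or_one ε k with h3 | h3 <;> simp [h0, h3, pairFactor]
  simp only [integrand, h1, h2, fac, Finset.prod_mul_distrib]

theorem fac_update {h : Config N} {Z : Finset ℕ} {i k : ℕ} (hik : i < k) (z : ℕ → ℂ) (w : ℂ) :
    P.fac h Z k (Function.update z i w) = P.fac h Z k z := by
  simp only [fac, Function.update_of_ne hik.ne']
  congr 1
  refine Finset.prod_congr rfl fun j hj => ?_
  rw [Function.update_of_ne (hik.trans (outer_subset_of hj)).ne']

/-- The factors of the outer variables do not contain `z i` and leave the inner integrals. Since an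
integral depends only on the winding numbers, the prescribed contours can be exchanged, one variable
at a time, for those of `inner`. -/
theorem nestedIntegral_eq (hP : P.Generic) (h : Config N) (ε : ℕ → Fin 2)
    (C Γ : ℕ → (ℕ → ℂ) → Contour)
    (hC : ∀ i ∈ present ε (2 * P.m), ∀ z,
      P.GoodContour (C i z) (-1) (-1) i (present ε (2 * P.m)) z)
    (hΓ : ∀ i ∈ present ε (2 * P.m), ∀ z, P.Dom (outer i (present ε (2 * P.m))) z →
      P.GoodContour (Γ i z) 1 0 i (present ε (2 * P.m)) z) {i : ℕ} (hi : i ≤ 2 * P.m) (z : ℕ → ℂ)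
    (hz : P.Dom (outer i (present ε (2 * P.m))) z) :
    nestedIntegral ε wInf wFin C Γ (integrand P.η P.ξ P.q P.m ε P.lam h) i z =
      (∏ k ∈ outer i (present ε (2 * P.m)), P.fac h (present ε (2 * P.m)) k z) *
        P.inner wInf wFin h (present ε (2 * P.m)) i z := by
  set Z := present ε (2 * P.m) with hZdef
  have hZ : ∀ k ∈ Z, k ≤ 2 * P.m := by
    intro k hk
    simp only [hZdef, present, Finset.mem_filter, Finset.mem_Icc] at hk
    omega
  induction i generalizing z with
  | zero =>
    have h0 : outer 0 Z = Z := by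
      refine Finset.filter_true_of_mem fun k hk => ?_
      simp only [hZdef, present, Finset.mem_filter, Finset.mem_Icc] at hk
      omega
    rw [nestedIntegral, inner, mul_one, h0, integrand_eq]
  | succ i ih =>
    rcases ebar_eq_zero_or_one ε (i + 1) with he | he
    · have hiZ : i + 1 ∉ Z := by simp [hZdef, present, he]
      rw [nestedIntegral, if_pos he, inner, if_neg hiZ, ← outer_of_notMem hiZ]
      exact ih (by omega) z (by rwa [outer_of_notMem hiZ])
    · have hiZ : i + 1 ∈ Z := by
        simp only [hZdef, present, Finset.mem_filter, Finset.mem_Icc]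
        omega
      have key : ∀ (Δ : Contour) (wI wO : ℂ), P.GoodContour Δ wI wO (i + 1) Z z →
          Δ.integral (fun w => nestedIntegral ε wInf wFin C Γ
            (integrand P.η P.ξ P.q P.m ε P.lam h) i (Function.update z (i + 1) w)) =
          (∏ k ∈ outer (i + 1) Z, P.fac h Z k z) *
            Δ.integral (fun w => P.fac h Z (i + 1) (Function.update z (i + 1) w) *
              P.inner wInf wFin h Z i (Function.update z (i + 1) w)) := by
        intro Δ wI wO hΔ
        rw [← Contour.integral_const_mul]
        refine Contour.integral_congr fun w hw => ?_
        rw [ih (by omega) _ (by rw [outer_of_mem hiZ]; exact hz.update hP hΔ hw),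
          outer_of_mem hiZ, Finset.prod_insert (notMem_outer _ _),
          Finset.prod_congr rfl fun k hk => fac_update (outer_subset_of hk) z w]
        ring
      have h1 := exists_inner_eq wInf wFin hP h hZ i
      obtain ⟨T1, -, ht1, -⟩ := exists_integral_fac_mul hP integralRule_infinity h hiZ (hZ _ hiZ)
        (g := fun Z => P.inner wInf wFin h Z i) h1
      obtain ⟨T2, -, ht2, -⟩ := exists_integral_fac_mul hP integralRule_residueSum h hiZ
        (hZ _ hiZ) (g := fun Z => P.inner wInf wFin h Z i) h1
      rw [nestedIntegral, if_neg (by omega), inner, if_pos hiZ, key _ _ _ (hC _ hiZ z),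
        key _ _ _ (hΓ _ hiZ z hz), ht1 _ z hz (hC _ hiZ z), ht2 _ z hz (hΓ _ hiZ z hz),
        ht1 _ z hz (goodContour_inf P _ Z z), ht2 _ z hz (hz.goodContour_fin hP)]
      ring

/-! ### The contours of the statement -/

theorem exists_sh_eq (P : Params N R) (k : ℕ) : ∃ s : ℤ, 0 ≤ s ∧ s ≤ 1 ∧ P.sh k = s * P.η := by
  by_cases hk : Even k
  · exact ⟨0, by omega, by omega, by simp [sh, hk]⟩
  · exact ⟨1, by omega, by omega, by simp [sh, hk]⟩

theorem mem_polePoints_of_in {ε : ℕ → Fin 2} {i : ℕ} {z : ℕ → ℂ} {a : Form}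
    (ha : InForm P.inConsts (outerOdd i (present ε (2 * P.m))) a) :
    a.eval P.sh z - P.sh i ∈ polePoints P.η P.ξ P.q P.m ε P.lam i z := by
  obtain ⟨s, hs0, hs1, hs⟩ := exists_sh_eq P i
  match a, ha with
  | (none, c), ⟨n, hn⟩ =>
    refine ⟨-s, by rw [abs_le]; omega, P.ξ n, ?_, Or.inl ⟨n, rfl⟩⟩
    simp only [Form.eval]
    rw [hn, hs]
    push_cast
    ring
  | (some k, c), ⟨hk, hc⟩ =>
    subst hc
    obtain ⟨t, ht0, ht1, ht⟩ := exists_sh_eq P k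
    simp only [outerOdd, present, Finset.mem_filter, Finset.mem_Icc] at hk
    refine ⟨t - s, by rw [abs_le]; omega, z k, ?_,
      Or.inr (Or.inr (Or.inr ⟨k, hk.2.1, hk.1.1.2, hk.1.2, rfl⟩))⟩
    simp only [Form.eval]
    rw [hs, ht]
    push_cast
    ring

theorem mem_polePoints_of_out {ε : ℕ → Fin 2} {i : ℕ} (hi : 1 ≤ i) (him : i ≤ 2 * P.m)
    {z : ℕ → ℂ} {b : Form} (hb : OutForm P.η P.outConsts (outer i (present ε (2 * P.m))) b) :
    b.eval P.sh z - P.sh i ∈ polePoints P.η P.ξ P.q P.m ε P.lam i z := by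
  obtain ⟨s, hs0, hs1, hs⟩ := exists_sh_eq P i
  have key : ∀ (t : ℤ) (x : ℂ), -1 ≤ t → t ≤ 2 → ((∃ n, x = P.ξ n) ∨ (∃ n, x = P.q n) ∨
      (∃ l, 1 ≤ l ∧ l ≤ P.m ∧ x = P.lam l) ∨
        ∃ k, i < k ∧ k ≤ 2 * P.m ∧ ebar ε k = 1 ∧ x = z k) →
      b.eval P.sh z = x + t * P.η →
      b.eval P.sh z - P.sh i ∈ polePoints P.η P.ξ P.q P.m ε P.lam i z := by
    intro t x ht1 ht2 hx hbx
    -- Here |t - s| ≤ 2, while 1 ≤ i ≤ 2m forces m ≥ 1, so the allowed bound 2m + 1 is at least 3.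
    refine ⟨t - s, by rw [abs_le]; omega, x, ?_, hx⟩
    rw [hbx, hs]
    push_cast
    ring
  match b, hb with
  | (none, c), hc =>
    rcases hc with ⟨n, hn | hn⟩ | ⟨n, hn | hn⟩ | ⟨l, hl1, hl2, hl | hl⟩
    · exact key 1 (P.ξ n) (by omega) (by omega) (Or.inl ⟨n, rfl⟩) (by simp [Form.eval, hn])
    · exact key (-1) (P.ξ n) (by omega) (by omega) (Or.inl ⟨n, rfl⟩)
        (by simp [Form.eval, hn, sub_eq_add_neg])
    · exact key 0 (P.q n) (by omega) (by omega) (Or.inr (Or.inl ⟨n, rfl⟩)) (by simp [Form.eval, hn])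
    · exact key 1 (P.q n) (by omega) (by omega) (Or.inr (Or.inl ⟨n, rfl⟩)) (by simp [Form.eval, hn])
    · exact key 0 (P.lam l) (by omega) (by omega) (Or.inr (Or.inr (Or.inl ⟨l, hl1, hl2, rfl⟩)))
        (by simp [Form.eval, hl])
    · exact key 1 (P.lam l) (by omega) (by omega) (Or.inr (Or.inr (Or.inl ⟨l, hl1, hl2, rfl⟩)))
        (by simp [Form.eval, hl])
  | (some k, c), ⟨hk, hc⟩ =>
    obtain ⟨t, ht0, ht1, ht⟩ := exists_sh_eq P k
    simp only [outer, present, Finset.mem_filter, Finset.mem_Icc] at hk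
    have hx := Or.inr (a := ∃ n, z k = P.ξ n) (Or.inr (a := ∃ n, z k = P.q n)
      (Or.inr (a := ∃ l, 1 ≤ l ∧ l ≤ P.m ∧ z k = P.lam l)
        (⟨k, hk.2, hk.1.1.2, hk.1.2, rfl⟩ : ∃ j, i < j ∧ j ≤ 2 * P.m ∧ ebar ε j = 1 ∧ z k = z j)))
    rcases hc with rfl | rfl
    · refine key (t + 1) (z k) (by omega) (by omega) hx ?_
      simp only [Form.eval]; rw [ht]; push_cast; ring
    · refine key (t - 1) (z k) (by omega) (by omega) hx ?_
      simp only [Form.eval]; rw [ht]; push_cast; ring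

theorem insidePoints_eq (ε : ℕ → Fin 2) (i : ℕ) (z : ℕ → ℂ) :
    insidePoints P.η P.ξ P.m ε i z = P.inPts i (present ε (2 * P.m)) z := by
  ext p
  by_cases hi : Even i
  · simp only [insidePoints, if_pos hi]
    constructor
    · rintro (⟨n, rfl⟩ | ⟨k, hk1, hk2, hk3, hk4, rfl⟩)
      · exact ⟨(none, P.ξ n), ⟨n, rfl⟩, by simp [Form.eval, sh, hi]⟩
      · refine ⟨(some k, 0), ⟨?_, rfl⟩, by simp [Form.eval, sh, hi, hk3]⟩
        simp only [outerOdd, present, Finset.mem_filter, Finset.mem_Icc]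
        exact ⟨⟨by omega, hk4⟩, hk1, hk3.add_even hi⟩
    · rintro ⟨⟨a1, a2⟩, ha, rfl⟩
      match a1, ha with
      | none, ⟨n, hn⟩ => exact Or.inl ⟨n, by simp [Form.eval, sh, hi, hn]⟩
      | some k, ⟨hk, hc⟩ =>
        subst hc
        simp only [outerOdd, present, Finset.mem_filter, Finset.mem_Icc] at hk
        have hko : Odd k := (Nat.odd_add.1 hk.2.2).2 hi
        refine Or.inr ⟨k, hk.2.1, hk.1.1.2, hko, hk.1.2, ?_⟩
        simp [Form.eval, sh, hi, hko]
  · simp only [insidePoints, if_neg hi]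
    constructor
    · rintro (⟨n, rfl⟩ | ⟨k, hk1, hk2, hk3, hk4, rfl⟩)
      · exact ⟨(none, P.ξ n), ⟨n, rfl⟩, by simp [Form.eval, sh, hi]⟩
      · refine ⟨(some k, 0), ⟨?_, rfl⟩, by simp [Form.eval, sh, hi, hk3]⟩
        simp only [outerOdd, present, Finset.mem_filter, Finset.mem_Icc]
        exact ⟨⟨by omega, hk4⟩, hk1, hk3.add_odd (Nat.not_even_iff_odd.1 hi)⟩
    · rintro ⟨⟨a1, a2⟩, ha, rfl⟩
      match a1, ha with
      | none, ⟨n, hn⟩ => exact Or.inl ⟨n, by simp [Form.eval, sh, hi, hn]⟩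
      | some k, ⟨hk, hc⟩ =>
        subst hc
        simp only [outerOdd, present, Finset.mem_filter, Finset.mem_Icc] at hk
        have hke : Even k := by
          rw [Nat.odd_add] at hk
          by_contra hke
          exact hi (hk.2.2.1 (Nat.not_even_iff_odd.1 hke))
        refine Or.inr ⟨k, hk.2.1, hk.1.1.2, hke, hk.1.2, ?_⟩
        simp [Form.eval, sh, hi, hke]

theorem goodContour_of_surroundsInfinity {ε : ℕ → Fin 2} {i : ℕ} (hi : 1 ≤ i)
    (him : i ≤ 2 * P.m) {z : ℕ → ℂ} {Γ : Contour}
    (hΓ : Γ.SurroundsInfinity (polePoints P.η P.ξ P.q P.m ε P.lam i z)) :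
    P.GoodContour Γ (-1) (-1) i (present ε (2 * P.m)) z :=
  ⟨fun _ ha => hΓ _ (mem_polePoints_of_in ha), fun _ hb => hΓ _ (mem_polePoints_of_out hi him hb)⟩

/-- Winding number 0 is only prescribed at pole points that need not be surrounded. Admissibility of
the outer variables ensures that no outside point is at the same time one of the surrounded points.
-/
theorem goodContour_of_surrounds (hP : P.Generic) {ε : ℕ → Fin 2} {i : ℕ} (hi : 1 ≤ i)
    (him : i ≤ 2 * P.m) {z : ℕ → ℂ} (hz : P.Dom (outer i (present ε (2 * P.m))) z) {Γ : Contour}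
    (hΓ : Γ.Surrounds (insidePoints P.η P.ξ P.m ε i z)
      (polePoints P.η P.ξ P.q P.m ε P.lam i z)) :
    P.GoodContour Γ 1 0 i (present ε (2 * P.m)) z := by
  rw [insidePoints_eq] at hΓ
  obtain ⟨h1, h2, h3⟩ := hΓ
  refine ⟨fun a ha => ?_, fun b hb => ?_⟩
  · have hm : a.eval P.sh z - P.sh i ∈ P.inPts i (present ε (2 * P.m)) z := ⟨a, ha, rfl⟩
    exact ⟨h1 _ (Or.inl hm), h2 _ hm⟩
  · have hm := mem_polePoints_of_out hi him (z := z) hb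
    exact ⟨h1 _ (Or.inr hm), h3 _ ⟨hm, fun hm' => hz.disjoint hP _ hm' ⟨b, hb, rfl⟩⟩⟩

theorem nestedIntegral_eq_value (hP : P.Generic) (h : Config N) (ε : ℕ → Fin 2)
    (C Γ : ℕ → (ℕ → ℂ) → Contour)
    (hC : ∀ i, 1 ≤ i → i ≤ 2 * P.m → ebar ε i = 1 → ∀ z : ℕ → ℂ,
      (C i z).SurroundsInfinity (polePoints P.η P.ξ P.q P.m ε P.lam i z))
    (hΓ : ∀ i, 1 ≤ i → i ≤ 2 * P.m → ebar ε i = 1 → ∀ z : ℕ → ℂ,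
      (Γ i z).Surrounds (insidePoints P.η P.ξ P.m ε i z)
        (polePoints P.η P.ξ P.q P.m ε P.lam i z)) :
    nestedIntegral ε wInf wFin C Γ (integrand P.η P.ξ P.q P.m ε P.lam h) (2 * P.m) 0 =
      P.value wInf wFin ε (2 * P.m) h := by
  have hmem : ∀ i ∈ present ε (2 * P.m), 1 ≤ i ∧ i ≤ 2 * P.m ∧ ebar ε i = 1 := by
    intro i hi
    simp only [present, Finset.mem_filter, Finset.mem_Icc] at hi
    tauto
  rw [nestedIntegral_eq wInf wFin hP h ε C Γ
    (fun i hi z => goodContour_of_surroundsInfinity (hmem i hi).1 (hmem i hi).2.1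
      (hC i (hmem i hi).1 (hmem i hi).2.1 (hmem i hi).2.2 z))
    (fun i hi z hz => goodContour_of_surrounds hP (hmem i hi).1 (hmem i hi).2.1 hz
      (hΓ i (hmem i hi).1 (hmem i hi).2.1 (hmem i hi).2.2 z)) le_rfl 0
    (by rw [outer_present]; exact Dom.empty 0), outer_present, Finset.prod_empty, one_mul, value]

end Params

end

end TwistedXXX

namespace TwistedXXX

noncomputable section

/-! ### Quadratic relations between matrices with operator entries -/

section Quadratic

variable {𝒜 ℬ : Type*} [Ring 𝒜]

/-- `X₁ Y₂` is antisymmetric in its row indices. -/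
def Anti (X Y : Matrix (Fin 2) (Fin 2) 𝒜) : Prop :=
  ∀ i j k l, X i j * Y k l + X k j * Y i l = 0

/-- All entries of `X` commute with all entries of `Y`. -/
def EntriesCommute (X Y : Matrix (Fin 2) (Fin 2) 𝒜) : Prop :=
  ∀ i j k l, Commute (X i j) (Y k l)

variable {η c r r' : ℂ} {X Y X' Y' : Matrix (Fin 2) (Fin 2) 𝒜}

theorem EntriesCommute.mul_right {Z : Matrix (Fin 2) (Fin 2) 𝒜} (h : EntriesCommute X Y)
    (h' : EntriesCommute X Z) : EntriesCommute X (Y * Z) := fun i j k l => by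
  rw [Matrix.mul_apply]
  exact Commute.sum_right _ _ _ fun a _ => (h i j k a).mul_right (h' i j a l)

theorem mul_mul_mul_apply (h : EntriesCommute X' Y) (i j k l : Fin 2) :
    (X * X') i j * (Y * Y') k l = ∑ a, ∑ b, X i a * Y k b * (X' a j * Y' b l) := by
  rw [Matrix.mul_apply, Matrix.mul_apply, Finset.sum_mul_sum]
  refine Finset.sum_congr rfl fun a _ => Finset.sum_congr rfl fun b _ => ?_
  have := (h a j k b).eq
  calc X i a * X' a j * (Y k b * Y' b l) = X i a * (X' a j * Y k b) * Y' b l := by noncomm_ring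
    _ = X i a * Y k b * (X' a j * Y' b l) := by rw [this]; noncomm_ring

theorem Anti.mul_left (h : Anti X Y) (h1 : EntriesCommute X' Y) : Anti (X * X') (Y * Y') := by
  intro i j k l
  rw [mul_mul_mul_apply h1, mul_mul_mul_apply h1]
  simp only [← Finset.sum_add_distrib, ← add_mul, h _ _ _ _, zero_mul, Finset.sum_const_zero]

variable [Algebra ℂ 𝒜] [Ring ℬ] [Algebra ℂ ℬ]

/-- The relation `R(c) X₁ Y₂ = Y₂ X₁ R(c)`. -/
def RTT (η c : ℂ) (X Y : Matrix (Fin 2) (Fin 2) 𝒜) : Prop :=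
  ∀ i j k l, c • (X i j * Y k l) + η • (X k j * Y i l) =
    c • (Y k l * X i j) + η • (Y k j * X i l)

/-- The quantum determinant of the pair `X`, `Y` is the scalar `r`. -/
def QDet (r : ℂ) (X Y : Matrix (Fin 2) (Fin 2) 𝒜) : Prop :=
  ∀ i k, X i 0 * Y k 1 - X i 1 * Y k 0 =
    ((!![0, 1; -1, 0] : Matrix (Fin 2) (Fin 2) ℂ) i k * r) • (1 : 𝒜)

/-- Entries of different sites commute, so the left pair and then the right pair can be exchanged
separately, with the summation indices swapped in the term of the permutation in between. -/
theorem RTT.mul (h : RTT η c X Y) (h' : RTT η c X' Y') (h1 : EntriesCommute X' Y)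
    (h2 : EntriesCommute Y' X) : RTT η c (X * X') (Y * Y') := by
  intro i j k l
  rw [mul_mul_mul_apply h1, mul_mul_mul_apply h1, mul_mul_mul_apply h2, mul_mul_mul_apply h2]
  calc c • ∑ a, ∑ b, X i a * Y k b * (X' a j * Y' b l) +
        η • ∑ a, ∑ b, X k a * Y i b * (X' a j * Y' b l)
      = ∑ a, ∑ b, (c • (X i a * Y k b) + η • (X k a * Y i b)) * (X' a j * Y' b l) := by
        simp only [Finset.smul_sum, ← Finset.sum_add_distrib, add_mul, smul_mul_assoc]
    _ = ∑ a, ∑ b, c • (Y k b * X i a * (X' a j * Y' b l)) +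
          ∑ a, ∑ b, η • (Y k a * X i b * (X' a j * Y' b l)) := by
        simp only [h i _ k _, ← Finset.sum_add_distrib, add_mul, smul_mul_assoc]
    _ = ∑ a, ∑ b, Y k b * X i a * (c • (X' a j * Y' b l) + η • (X' b j * Y' a l)) := by
        rw [Finset.sum_comm (f := fun a b => η • (Y k a * X i b * (X' a j * Y' b l)))]
        simp only [← Finset.sum_add_distrib, mul_add, mul_smul_comm]
    _ = c • ∑ b, ∑ a, Y k b * X i a * (Y' b l * X' a j) +
          η • ∑ b, ∑ a, Y k b * X i a * (Y' b j * X' a l) := by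
        rw [Finset.sum_comm]
        simp only [h' _ j _ l, Finset.smul_sum, ← Finset.sum_add_distrib, mul_add, mul_smul_comm]

theorem QDet.mul (h : QDet r X Y) (h' : QDet r' X' Y') (h1 : EntriesCommute X' Y) :
    QDet (r * r') (X * X') (Y * Y') := by
  intro i k
  have e00 : X' 0 0 * Y' 0 1 - X' 0 1 * Y' 0 0 = 0 := by simpa using h' 0 0
  have e01 : X' 0 0 * Y' 1 1 - X' 0 1 * Y' 1 0 = r' • 1 := by simpa using h' 0 1
  have e10 : X' 1 0 * Y' 0 1 - X' 1 1 * Y' 0 0 = -(r' • 1) := by simpa using h' 1 0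
  have e11 : X' 1 0 * Y' 1 1 - X' 1 1 * Y' 1 0 = 0 := by simpa using h' 1 1
  rw [mul_mul_mul_apply h1, mul_mul_mul_apply h1]
  simp only [Fin.sum_univ_two]
  calc _ = X i 0 * Y k 0 * (X' 0 0 * Y' 0 1 - X' 0 1 * Y' 0 0) +
        X i 0 * Y k 1 * (X' 0 0 * Y' 1 1 - X' 0 1 * Y' 1 0) +
        X i 1 * Y k 0 * (X' 1 0 * Y' 0 1 - X' 1 1 * Y' 0 0) +
        X i 1 * Y k 1 * (X' 1 0 * Y' 1 1 - X' 1 1 * Y' 1 0) := by noncomm_ring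
    _ = r' • (X i 0 * Y k 1 - X i 1 * Y k 0) := by
        rw [e00, e01, e10, e11]
        simp only [mul_zero, mul_neg, mul_smul_comm, mul_one, smul_sub]
        abel
    _ = _ := by
        rw [h i k, smul_smul]
        congr 1
        ring

/-- At spectral difference η the R-matrix is η times 1 + P, a multiple of the symmetrizer. The RTT
relation carries it through the left pair onto the rows of the right pair, where antisymmetry
annihilates it. -/
theorem Anti.mul_right (hη : η ≠ 0) (h : RTT η η X Y) (h' : Anti X' Y')
    (h1 : EntriesCommute X' Y) : Anti (X * X') (Y * Y') := by
  have h2 (i j k l : Fin 2) : X i j * Y k l + X k j * Y i l = Y k l * X i j + Y k j * X i l := by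
    have := h i j k l
    rw [← smul_add, ← smul_add] at this
    exact smul_right_injective 𝒜 hη this
  intro i j k l
  rw [mul_mul_mul_apply h1, mul_mul_mul_apply h1]
  simp only [← Finset.sum_add_distrib, ← add_mul, h2 i _ k _]
  simp only [add_mul, Finset.sum_add_distrib]
  rw [Finset.sum_comm (f := fun a b => Y k a * X i b * (X' a j * Y' b l))]
  simp only [← Finset.sum_add_distrib, ← mul_add, h' _ _ _ _, mul_zero, Finset.sum_const_zero]

/-! #### Images under homomorphisms, and scalar matrices -/

theorem RTT.map (h : RTT η c X Y) (φ : 𝒜 →ₐ[ℂ] ℬ) : RTT η c (X.map φ) (Y.map φ) := by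
  intro i j k l
  simpa using congrArg φ (h i j k l)

theorem QDet.map (h : QDet r X Y) (φ : 𝒜 →ₐ[ℂ] ℬ) : QDet r (X.map φ) (Y.map φ) := by
  intro i k
  have := congrArg φ (h i k)
  rw [map_sub, map_mul, map_mul, map_smul, map_one] at this
  exact this

theorem Anti.map (h : Anti X Y) (φ : 𝒜 →ₐ[ℂ] ℬ) : Anti (X.map φ) (Y.map φ) := by
  intro i j k l
  simpa using congrArg φ (h i j k l)

variable (𝒜) in
/-- A matrix of scalars, seen as a matrix with operator entries. -/
def scalarMatrix (K : Matrix (Fin 2) (Fin 2) ℂ) : Matrix (Fin 2) (Fin 2) 𝒜 :=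
  K.map (algebraMap ℂ 𝒜)

variable (K : Matrix (Fin 2) (Fin 2) ℂ)

theorem entriesCommute_scalarMatrix_left (X : Matrix (Fin 2) (Fin 2) 𝒜) :
    EntriesCommute (scalarMatrix 𝒜 K) X := fun _ _ _ _ => Algebra.commute_algebraMap_left _ _

theorem entriesCommute_scalarMatrix_right (X : Matrix (Fin 2) (Fin 2) 𝒜) :
    EntriesCommute X (scalarMatrix 𝒜 K) := fun _ _ _ _ => Algebra.commute_algebraMap_right _ _

theorem rtt_scalarMatrix (η c : ℂ) : RTT η c (scalarMatrix 𝒜 K) (scalarMatrix 𝒜 K) := by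
  intro i j k l
  rw [(entriesCommute_scalarMatrix_left K (scalarMatrix 𝒜 K) i j k l).eq]

theorem qdet_scalarMatrix : QDet K.det (scalarMatrix 𝒜 K) (scalarMatrix 𝒜 K) := by
  intro i k
  simp only [scalarMatrix, Matrix.map_apply, ← map_mul, ← map_sub, Matrix.det_fin_two,
    ← Algebra.algebraMap_eq_smul_one]
  congr 1
  fin_cases i <;> fin_cases k <;> simp <;> ring

end Quadratic

/-! ### Operators at one site -/

section Site

variable {N : ℕ}

theorem sum_siteOp_mul (n : Fin N) (X : Matrix (Fin 2) (Fin 2) ℂ) (s : Config N)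
    (f : Config N → ℂ) :
    ∑ r, siteOp n X s r * f r = ∑ a, X (s n) a * f (Function.update s n a) := by
  symm
  refine Finset.sum_of_injOn (Function.update s n) (Function.update_injective s n).injOn
    (fun _ _ => Finset.mem_univ _) (fun r _ hr => ?_) fun a _ => ?_
  · rw [siteOp, if_neg, zero_mul]
    intro h
    refine hr ⟨r n, Finset.mem_coe.2 (Finset.mem_univ _), funext fun k => ?_⟩
    by_cases hk : k = n
    · subst hk; simp
    · simp [hk, h k hk]
  · rw [siteOp, if_pos fun k hk => by simp [hk]]
    simp

/-- The operators at the site `n`, as an algebra homomorphism. -/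
def siteHom (n : Fin N) : Matrix (Fin 2) (Fin 2) ℂ →ₐ[ℂ] Op N :=
  AlgHom.ofLinearMap
    { toFun := siteOp n
      map_add' := fun X Y => by
        ext s t
        simp only [siteOp, Matrix.add_apply]
        split_ifs <;> simp
      map_smul' := fun x X => by
        ext s t
        simp only [siteOp, Matrix.smul_apply, RingHom.id_apply]
        split_ifs <;> simp }
    (by
      ext s t
      simp only [LinearMap.coe_mk, AddHom.coe_mk, siteOp, Matrix.one_apply]
      by_cases h : s = t
      · simp [h]
      · rw [if_neg h]
        split_ifs with h1 h2
        · exact absurd (funext fun k => by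
            by_cases hk : k = n
            · rw [hk, h2]
            · exact h1 k hk) h
        · rfl
        · rfl)
    (fun X Y => by
      ext s t
      simp only [LinearMap.coe_mk, AddHom.coe_mk]
      rw [Matrix.mul_apply, sum_siteOp_mul]
      simp only [siteOp]
      by_cases h : ∀ k, k ≠ n → s k = t k
      · rw [if_pos h, Matrix.mul_apply]
        refine Finset.sum_congr rfl fun a _ => ?_
        rw [if_pos fun k hk => by simpa [hk] using h k hk]
        simp
      · rw [if_neg h]
        refine (Finset.sum_eq_zero fun a _ => ?_).symm
        rw [if_neg, mul_zero]
        intro h'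
        exact h fun k hk => by simpa [hk] using h' k hk)

theorem siteOp_mul_siteOp_apply {n m : Fin N} (hnm : n ≠ m) (X Y : Matrix (Fin 2) (Fin 2) ℂ)
    (s t : Config N) : (siteOp n X * siteOp m Y) s t =
      if ∀ k, k ≠ n → k ≠ m → s k = t k then X (s n) (t n) * Y (s m) (t m) else 0 := by
  rw [Matrix.mul_apply, sum_siteOp_mul]
  refine (Finset.sum_eq_single (t n) (fun a _ ha => ?_) (by simp)).trans ?_
  · rw [siteOp, if_neg, mul_zero]
    intro h
    exact ha (by simpa using h n hnm)
  · simp only [siteOp, Function.update_of_ne hnm.symm, mul_ite, mul_zero]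
    refine if_congr ⟨fun h k h1 h2 => ?_, fun h k hk => ?_⟩ rfl rfl
    · simpa [h1] using h k h2
    · by_cases hkn : k = n
      · subst hkn; simp
      · simpa [hkn] using h k hkn hk

theorem commute_siteOp {n m : Fin N} (hnm : n ≠ m) (X Y : Matrix (Fin 2) (Fin 2) ℂ) :
    Commute (siteOp n X) (siteOp m Y) := by
  ext s t
  rw [siteOp_mul_siteOp_apply hnm, siteOp_mul_siteOp_apply hnm.symm, mul_comm]
  exact if_congr ⟨fun h k h1 h2 => h k h2 h1, fun h k h1 h2 => h k h2 h1⟩ rfl rfl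

/-- The `L`-operator of one site, with entries in the `2 × 2` matrices. -/
def localLax (η u : ℂ) : Matrix (Fin 2) (Fin 2) (Matrix (Fin 2) (Fin 2) ℂ) := fun i j =>
  fun k l => RMatrix η u (i, k) (j, l)

theorem lax_eq_map (η u : ℂ) (n : Fin N) : lax η u n = (localLax η u).map (siteHom n) := rfl

theorem rtt_localLax (η u v : ℂ) : RTT η (u - v) (localLax η u) (localLax η v) := by
  intro i j k l
  ext a b
  fin_cases i <;> fin_cases j <;> fin_cases k <;> fin_cases l <;> fin_cases a <;> fin_cases b <;>
    simp [localLax, RMatrix, Matrix.mul_apply] <;> first | ring1 | (ring_nf; simp)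

theorem qdet_localLax (η u : ℂ) :
    QDet ((u + η) * (u - η)) (localLax η u) (localLax η (u - η)) := by
  intro i k
  ext a b
  fin_cases i <;> fin_cases k <;> fin_cases a <;> fin_cases b <;>
    simp [localLax, RMatrix, Matrix.mul_apply] <;> ring

theorem anti_localLax (η : ℂ) : Anti (localLax η 0) (localLax η (-η)) := by
  intro i j k l
  ext a b
  fin_cases i <;> fin_cases j <;> fin_cases k <;> fin_cases l <;> fin_cases a <;> fin_cases b <;>
    simp [localLax, RMatrix, Matrix.mul_apply]

theorem entriesCommute_lax (η u v : ℂ) {n m : Fin N} (hnm : n ≠ m) :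
    EntriesCommute (lax η u n) (lax η v m) := fun _ _ _ _ => commute_siteOp hnm _ _

end Site

end

end TwistedXXX

namespace TwistedXXX

noncomputable section

/-! ### The monodromy matrix -/

section Monodromy

variable {N : ℕ} {η : ℂ} {ξ : Fin N → ℂ}

theorem monodromy_eq_prod_map (η : ℂ) (ξ : Fin N → ℂ) (u : ℂ) :
    monodromy η ξ u = ((List.finRange N).reverse.map fun n => lax η (u - ξ n) n).prod := by
  rw [monodromy, List.ofFn_eq_map, List.map_reverse]

theorem nodup_finRange_reverse (N : ℕ) : (List.finRange N).reverse.Nodup :=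
  List.nodup_reverse.2 (List.nodup_finRange N)

theorem prod_map_finRange_reverse (f : Fin N → ℂ) :
    ((List.finRange N).reverse.map f).prod = ∏ n, f n := by
  rw [Fin.prod_univ_def]
  exact ((List.reverse_perm _).map f).prod_eq

theorem entriesCommute_lax_prod (u : ℂ) (v : Fin N → ℂ) (n : Fin N) (L : List (Fin N))
    (hL : n ∉ L) : EntriesCommute (lax η u n) (L.map fun k => lax η (v k) k).prod := by
  induction L with
  | nil =>
    intro i j k l
    rw [List.map_nil, List.prod_nil, Matrix.one_apply]
    split_ifs
    · exact Commute.one_right _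
    · exact Commute.zero_right _
  | cons m L ih =>
    rw [List.mem_cons, not_or] at hL
    rw [List.map_cons, List.prod_cons]
    exact (entriesCommute_lax η u _ hL.1).mul_right (ih hL.2)

theorem EntriesCommute.symm {𝒜 : Type*} [Ring 𝒜] {X Y : Matrix (Fin 2) (Fin 2) 𝒜}
    (h : EntriesCommute X Y) : EntriesCommute Y X := fun i j k l => (h k l i j).symm

theorem rtt_prod (c : ℂ) (u v : Fin N → ℂ) (huv : ∀ n, u n - v n = c) (L : List (Fin N))
    (hL : L.Nodup) : RTT η c (L.map fun k => lax η (u k) k).prod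
      (L.map fun k => lax η (v k) k).prod := by
  induction L with
  | nil =>
    have := rtt_scalarMatrix (𝒜 := Op N) 1 η c
    simpa [scalarMatrix] using this
  | cons m L ih =>
    rw [List.nodup_cons] at hL
    simp only [List.map_cons, List.prod_cons]
    refine RTT.mul ?_ (ih hL.2) (entriesCommute_lax_prod _ _ _ _ hL.1).symm
      (entriesCommute_lax_prod _ _ _ _ hL.1).symm
    rw [lax_eq_map, lax_eq_map, ← huv m]
    exact (rtt_localLax η _ _).map _

theorem qdet_prod (u : Fin N → ℂ) (L : List (Fin N)) (hL : L.Nodup) :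
    QDet (L.map fun k => (u k + η) * (u k - η)).prod (L.map fun k => lax η (u k) k).prod
      (L.map fun k => lax η (u k - η) k).prod := by
  induction L with
  | nil =>
    have := qdet_scalarMatrix (𝒜 := Op N) 1
    simpa [scalarMatrix] using this
  | cons m L ih =>
    rw [List.nodup_cons] at hL
    simp only [List.map_cons, List.prod_cons]
    refine QDet.mul ?_ (ih hL.2) (entriesCommute_lax_prod _ _ _ _ hL.1).symm
    rw [lax_eq_map, lax_eq_map]
    exact (qdet_localLax η _).map _

/-- The site with vanishing argument is antisymmetric by itself. Factors to its right preserve this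
trivially, factors to its left by the RTT relation at difference η. -/
theorem anti_prod (hη : η ≠ 0) (u : Fin N → ℂ) (n : Fin N) (hu : u n = 0) (L : List (Fin N))
    (hL : L.Nodup) (hn : n ∈ L) : Anti (L.map fun k => lax η (u k) k).prod
      (L.map fun k => lax η (u k - η) k).prod := by
  induction L with
  | nil => simp at hn
  | cons m L ih =>
    rw [List.nodup_cons] at hL
    simp only [List.map_cons, List.prod_cons]
    by_cases hm : n = m
    · subst hm
      refine Anti.mul_left ?_ (entriesCommute_lax_prod _ _ _ _ hL.1).symm
      rw [lax_eq_map, lax_eq_map, hu, zero_sub]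
      exact (anti_localLax η).map _
    · refine Anti.mul_right hη ?_ (ih hL.2 ((List.mem_cons.1 hn).resolve_left hm))
        (entriesCommute_lax_prod _ _ _ _ hL.1).symm
      have := (rtt_localLax η (u m) (u m - η)).map (siteHom m)
      rwa [sub_sub_cancel] at this

/-! #### The reference state -/

/-- The row vector `v` is a reference state for `X`, with the weights `α` and `δ`. -/
structure IsVacuum (v : Config N → ℂ) (α δ : ℂ) (X : Matrix (Fin 2) (Fin 2) (Op N)) : Prop where
  zero_one : v ᵥ* X 0 1 = 0
  zero_zero : v ᵥ* X 0 0 = α • v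
  one_one : v ᵥ* X 1 1 = δ • v

/-- On the reference state the matrix is triangular: each term with an off-diagonal product contains
an entry (0, 1) that can be applied first, after a commutation for the entry (1, 1). -/
theorem IsVacuum.mul {v : Config N → ℂ} {α δ α' δ' : ℂ} {X X' : Matrix (Fin 2) (Fin 2) (Op N)}
    (h : IsVacuum v α δ X) (h' : IsVacuum v α' δ' X') (hc : EntriesCommute X X') :
    IsVacuum v (α * α') (δ * δ') (X * X') := by
  refine ⟨?_, ?_, ?_⟩
  · rw [Matrix.mul_apply, Fin.sum_univ_two, Matrix.vecMul_add, ← Matrix.vecMul_vecMul,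
      ← Matrix.vecMul_vecMul, h.zero_one, h.zero_zero, Matrix.smul_vecMul, h'.zero_one]
    simp
  · rw [Matrix.mul_apply, Fin.sum_univ_two, Matrix.vecMul_add, ← Matrix.vecMul_vecMul,
      ← Matrix.vecMul_vecMul, h.zero_one, h.zero_zero, Matrix.smul_vecMul, h'.zero_zero]
    simp [smul_smul]
  · rw [Matrix.mul_apply, Fin.sum_univ_two, Matrix.vecMul_add, (hc 1 0 0 1).eq,
      ← Matrix.vecMul_vecMul, ← Matrix.vecMul_vecMul, h'.zero_one, h.one_one, Matrix.smul_vecMul,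
      h'.one_one]
    simp [smul_smul]

theorem braZero_vecMul (X : Op N) (t : Config N) : (braZero N ᵥ* X) t = X 0 t := by
  rw [braZero, Matrix.single_one_vecMul]
  rfl

theorem isVacuum_lax (η u : ℂ) (n : Fin N) : IsVacuum (braZero N) (u + η) u (lax η u n) := by
  have key (x : ℂ) (t : Config N) : (x • braZero N) t = if t = 0 then x else 0 := by
    simp [braZero, Pi.single_apply]
  have h0 {t : Config N} (h : ∀ k, k ≠ n → (0 : Config N) k = t k) (ht : t n = 0) : t = 0 :=
    funext fun k => by
      by_cases hk : k = n
      · rw [hk, ht]; rfl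
      · exact (h k hk).symm
  refine ⟨?_, ?_, ?_⟩
  · ext t
    rw [braZero_vecMul]
    simp [lax, siteOp, RMatrix]
  · ext t
    rw [braZero_vecMul, key]
    simp only [lax, siteOp]
    by_cases ht : t = 0
    · simp [ht, RMatrix]
    · rw [if_neg ht]
      split_ifs with h
      · have : (0 : Fin 2) ≠ t n := fun h1 => ht (h0 h h1.symm)
        simp [RMatrix, this]
      · rfl
  · ext t
    rw [braZero_vecMul, key]
    simp only [lax, siteOp]
    by_cases ht : t = 0
    · simp [ht, RMatrix]
    · rw [if_neg ht]
      split_ifs with h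
      · have : (0 : Fin 2) ≠ t n := fun h1 => ht (h0 h h1.symm)
        simp [RMatrix, this]
      · rfl

theorem isVacuum_prod (u : Fin N → ℂ) (L : List (Fin N)) (hL : L.Nodup) :
    IsVacuum (braZero N) (L.map fun k => u k + η).prod (L.map u).prod
      (L.map fun k => lax η (u k) k).prod := by
  induction L with
  | nil => exact ⟨by simp, by simp, by simp⟩
  | cons m L ih =>
    rw [List.nodup_cons] at hL
    simp only [List.map_cons, List.prod_cons]
    exact (isVacuum_lax η _ m).mul (ih hL.2) (entriesCommute_lax_prod _ _ _ _ hL.1)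

/-! #### Polynomial dependence on the spectral parameter -/

/-- The entries of `F u` are polynomials in `u` of degree at most `n`, and `L` is the coefficient
of `u ^ n`. -/
def HasLead (n : ℕ) (F : ℂ → Op N) (L : Op N) : Prop :=
  ∀ s t, ∃ p : Polynomial ℂ, p.natDegree ≤ n ∧ p.coeff n = L s t ∧ ∀ u, p.eval u = F u s t

theorem HasLead.sum {ι : Type*} (S : Finset ι) {n : ℕ} {F : ι → ℂ → Op N} {L : ι → Op N}
    (h : ∀ a, HasLead n (F a) (L a)) :
    HasLead n (fun u => ∑ a ∈ S, F a u) (∑ a ∈ S, L a) := by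
  intro s t
  choose p hp using fun a => h a s t
  refine ⟨∑ a ∈ S, p a, ?_, ?_, fun u => ?_⟩
  · exact Polynomial.natDegree_sum_le_of_forall_le _ _ fun a _ => (hp a).1
  · rw [Polynomial.finsetSum_coeff, Matrix.sum_apply]
    exact Finset.sum_congr rfl fun a _ => (hp a).2.1
  · beta_reduce
    rw [Polynomial.eval_finsetSum, Matrix.sum_apply]
    exact Finset.sum_congr rfl fun a _ => (hp a).2.2 u

theorem HasLead.mul {n m : ℕ} {F G : ℂ → Op N} {L M : Op N} (h : HasLead n F L)
    (h' : HasLead m G M) : HasLead (n + m) (fun u => F u * G u) (L * M) := by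
  intro s t
  choose p hp using h s
  choose q hq using fun r => h' r t
  refine ⟨∑ r, p r * q r, ?_, ?_, fun u => ?_⟩
  · exact Polynomial.natDegree_sum_le_of_forall_le _ _ fun r _ =>
      Polynomial.natDegree_mul_le_of_le (hp r).1 (hq r).1
  · rw [Polynomial.finsetSum_coeff, Matrix.mul_apply]
    refine Finset.sum_congr rfl fun r _ => ?_
    rw [Polynomial.coeff_mul_add_eq_of_natDegree_le (hp r).1 (hq r).1, (hp r).2.1, (hq r).2.1]
  · beta_reduce
    rw [Polynomial.eval_finsetSum, Matrix.mul_apply]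
    refine Finset.sum_congr rfl fun r _ => ?_
    rw [Polynomial.eval_mul, (hp r).2.2, (hq r).2.2]

theorem HasLead.const (L : Op N) : HasLead 0 (fun _ => L) L := fun s t =>
  ⟨Polynomial.C (L s t), by simp, by simp, by simp⟩

theorem HasLead.continuous {n : ℕ} {F : ℂ → Op N} {L : Op N} (h : HasLead n F L) :
    Continuous F := by
  refine continuous_matrix fun s t => ?_
  obtain ⟨p, -, -, hp⟩ := h s t
  simp only [← hp]
  exact p.continuous

theorem hasLead_lax (ξ : Fin N → ℂ) (n : Fin N) (i j : Fin 2) :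
    HasLead 1 (fun u => lax η (u - ξ n) n i j) ((1 : Matrix (Fin 2) (Fin 2) (Op N)) i j) := by
  intro s t
  have h1 : (1 : Matrix (Fin 2) (Fin 2) (Op N)) i j s t = if i = j ∧ s = t then 1 else 0 := by
    rw [Matrix.one_apply]
    by_cases hij : i = j
    · simp [hij, Matrix.one_apply]
    · simp [hij]
  rw [h1]
  by_cases hst : ∀ k, k ≠ n → s k = t k
  · have h2 : s = t ↔ s n = t n := ⟨fun h => h ▸ rfl, fun h => funext fun k => by
      by_cases hk : k = n
      · rw [hk, h]
      · exact hst k hk⟩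
    refine ⟨if (i, s n) = (j, t n) then
      Polynomial.X + Polynomial.C (if i = s n then η - ξ n else - ξ n)
      else Polynomial.C (if i = t n ∧ s n = j then η else 0), ?_, ?_, fun u => ?_⟩
    · split_ifs <;> compute_degree <;> norm_num
    · simp only [h2, Prod.mk.injEq]
      split_ifs <;> simp [Polynomial.coeff_X]
    · simp only [lax, siteOp, if_pos hst, RMatrix]
      split_ifs <;> simp <;> ring
  · refine ⟨0, by simp, ?_, fun u => by simp [lax, siteOp, hst]⟩
    rw [if_neg fun h => hst fun k _ => by rw [h.2], Polynomial.coeff_zero]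

theorem hasLead_prod (ξ : Fin N → ℂ) (L : List (Fin N)) (i j : Fin 2) :
    HasLead L.length (fun u => (L.map fun k => lax η (u - ξ k) k).prod i j)
      ((1 : Matrix (Fin 2) (Fin 2) (Op N)) i j) := by
  induction L generalizing i j with
  | nil => exact HasLead.const _
  | cons m L ih =>
    simp only [List.map_cons, List.prod_cons, List.length_cons, Matrix.mul_apply]
    rw [add_comm L.length 1]
    have h := HasLead.sum Finset.univ fun a =>
      (hasLead_lax (η := η) ξ m i a).mul (ih a j)
    rwa [← Matrix.mul_apply, one_mul] at h

/-! #### The twisted monodromy matrix -/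

variable (K : Matrix (Fin 2) (Fin 2) ℂ)

theorem twistedMonodromy_eq_mul (η : ℂ) (ξ : Fin N → ℂ) (u : ℂ) :
    twistedMonodromy η ξ K u = scalarMatrix (Op N) K * monodromy η ξ u := by
  funext i j
  rw [twistedMonodromy, Matrix.mul_apply]
  simp only [scalarMatrix, Matrix.map_apply, Algebra.smul_def]

theorem rtt_twistedMonodromy (η : ℂ) (ξ : Fin N → ℂ) (u v : ℂ) :
    RTT η (u - v) (twistedMonodromy η ξ K u) (twistedMonodromy η ξ K v) := by
  rw [twistedMonodromy_eq_mul, twistedMonodromy_eq_mul]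
  refine (rtt_scalarMatrix K η _).mul ?_ (entriesCommute_scalarMatrix_right K _)
    (entriesCommute_scalarMatrix_right K _)
  rw [monodromy_eq_prod_map, monodromy_eq_prod_map]
  exact rtt_prod _ _ _ (fun n => by ring) _ (nodup_finRange_reverse N)

theorem qdet_twistedMonodromy (η : ℂ) (ξ : Fin N → ℂ) (u : ℂ) :
    QDet (K.det * (aFun η ξ u * dFun ξ (u - η))) (twistedMonodromy η ξ K u)
      (twistedMonodromy η ξ K (u - η)) := by
  rw [twistedMonodromy_eq_mul, twistedMonodromy_eq_mul]
  refine (qdet_scalarMatrix K).mul ?_ (entriesCommute_scalarMatrix_right K _)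
  rw [monodromy_eq_prod_map, monodromy_eq_prod_map, aFun, dFun, ← Finset.prod_mul_distrib,
    ← prod_map_finRange_reverse]
  have := qdet_prod (η := η) (fun n => u - ξ n) _ (nodup_finRange_reverse N)
  simpa only [sub_right_comm u η] using this

theorem anti_twistedMonodromy (hη : η ≠ 0) (ξ : Fin N → ℂ) (n : Fin N) :
    Anti (twistedMonodromy η ξ K (ξ n)) (twistedMonodromy η ξ K (ξ n - η)) := by
  rw [twistedMonodromy_eq_mul, twistedMonodromy_eq_mul]
  refine Anti.mul_right hη (rtt_scalarMatrix K η _) ?_ (entriesCommute_scalarMatrix_right K _)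
  rw [monodromy_eq_prod_map, monodromy_eq_prod_map]
  have := anti_prod hη (fun k => ξ n - ξ k) n (sub_self _) _ (nodup_finRange_reverse N)
    (List.mem_reverse.2 (List.mem_finRange n))
  simpa only [sub_right_comm _ η] using this

theorem braZero_vecMul_twistedMonodromy (η : ℂ) (ξ : Fin N → ℂ) (u : ℂ) (i : Fin 2) :
    braZero N ᵥ* twistedMonodromy η ξ K u i 1 = (K i 1 * dFun ξ u) • braZero N := by
  have h := isVacuum_prod (η := η) (fun n => u - ξ n) _ (nodup_finRange_reverse N)
  rw [← monodromy_eq_prod_map] at h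
  rw [twistedMonodromy, Fin.sum_univ_two, Matrix.vecMul_add, Matrix.vecMul_smul,
    Matrix.vecMul_smul, h.zero_one, h.one_one, smul_zero, zero_add, smul_smul,
    prod_map_finRange_reverse, dFun]

theorem hasLead_twistedMonodromy (η : ℂ) (ξ : Fin N → ℂ) (i j : Fin 2) :
    HasLead N (fun u => twistedMonodromy η ξ K u i j) (K i j • 1) := by
  have h := HasLead.sum Finset.univ fun a =>
    (HasLead.const (scalarMatrix (Op N) K i a)).mul
      (hasLead_prod (η := η) ξ (List.finRange N).reverse a j)
  rw [← Matrix.mul_apply, mul_one, List.length_reverse, List.length_finRange, zero_add] at h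
  simpa only [twistedMonodromy_eq_mul, Matrix.mul_apply, monodromy_eq_prod_map, scalarMatrix,
    Matrix.map_apply, Algebra.algebraMap_eq_smul_one] using h

end Monodromy

end

end TwistedXXX

namespace TwistedXXX

noncomputable section

/-! ### The separated basis -/

/-- The assumptions on the chain under which the separation of variables works. -/
structure Regular {N : ℕ} (η : ℂ) (ξ : Fin N → ℂ) (K : Matrix (Fin 2) (Fin 2) ℂ) (k₁ : ℂ) :
    Prop where
  eta_ne : η ≠ 0
  xi_ne : ∀ i j, i ≠ j → ξ i ≠ ξ j ∧ ξ i ≠ ξ j + η ∧ ξ i ≠ ξ j - η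
  b_ne : K 0 1 ≠ 0
  k_ne : k₁ ≠ 0

theorem config_induction {N : ℕ} {p : Config N → Prop} (h0 : p 0)
    (hs : ∀ h n, h n = 0 → p h → p (Function.update h n 1)) (h : Config N) : p h := by
  have key (s : Finset (Fin N)) : p fun n => if n ∈ s then 1 else 0 := by
    induction s using Finset.induction_on with
    | empty =>
      simp only [Finset.notMem_empty, if_false]
      exact h0
    | insert n s hn ih =>
      convert hs _ n (by simp [hn]) ih using 1
      funext k
      by_cases hk : k = n
      · subst hk; simp
      · simp [hk]
  convert key (Finset.univ.filter fun n => h n = 1) with n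
  simp only [Finset.mem_filter, Finset.mem_univ, true_and]
  split_ifs <;> omega

theorem prod_pow_update {ι M : Type*} [DecidableEq ι] [Monoid M] (f : ι → M)
    (hf : ∀ i j, Commute (f i) (f j)) (e : ι → Fin 2) {i : ι} (he : e i = 0) (L : List ι)
    (hL : L.Nodup) (hi : i ∈ L) :
    (L.map fun k => f k ^ (Function.update e i 1 k : ℕ)).prod =
      (L.map fun k => f k ^ (e k : ℕ)).prod * f i := by
  induction L with
  | nil => simp at hi
  | cons m L ih =>
    rw [List.nodup_cons] at hL
    simp only [List.map_cons, List.prod_cons]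
    by_cases hm : i = m
    · subst hm
      have h1 : (L.map fun k => f k ^ (Function.update e i 1 k : ℕ)) =
          L.map fun k => f k ^ (e k : ℕ) :=
        List.map_congr_left fun k hk => by
          rw [Function.update_of_ne (ne_of_mem_of_not_mem hk hL.1)]
      have h2 : Commute (f i) (L.map fun k => f k ^ (e k : ℕ)).prod :=
        Commute.list_prod_right _ _ fun x hx => by
          obtain ⟨k, -, rfl⟩ := List.mem_map.1 hx
          exact (hf i k).pow_right _
      rw [h1]
      simpa [he] using h2.eq
    · rw [ih hL.2 ((List.mem_cons.1 hi).resolve_left hm), Function.update_of_ne (Ne.symm hm),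
        mul_assoc]

section Bra

variable {N : ℕ} {η : ℂ} {ξ : Fin N → ℂ} {K : Matrix (Fin 2) (Fin 2) ℂ} {k₁ : ℂ}

local notation "T" => twistedMonodromy η ξ K

theorem shifted_of_eq_zero {h : Config N} {n : Fin N} (hn : h n = 0) : shifted η ξ h n = ξ n := by
  simp [shifted, hn]

theorem shifted_of_eq_one {h : Config N} {n : Fin N} (hn : h n = 1) :
    shifted η ξ h n = ξ n - η := by
  simp [shifted, hn]

theorem shifted_update_of_ne (h : Config N) {n k : Fin N} (hk : k ≠ n) (e : Fin 2) :
    shifted η ξ (Function.update h n e) k = shifted η ξ h k := by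
  simp [shifted, hk]

theorem Regular.shifted_ne (hR : Regular η ξ K k₁) (h h' : Config N) {n k : Fin N} (hnk : n ≠ k) :
    shifted η ξ h n ≠ shifted η ξ h' k := by
  obtain ⟨h1, h2, h3⟩ := hR.xi_ne n k hnk
  rcases Fin.exists_fin_two.1 ⟨h n, rfl⟩ with hn | hn <;>
    rcases Fin.exists_fin_two.1 ⟨h' k, rfl⟩ with hk | hk <;>
    simp only [shifted, hn, hk, Fin.val_zero, Fin.val_one, Nat.cast_zero, Nat.cast_one,
      zero_mul, one_mul, sub_zero]
  · exact h1
  · exact h3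
  · exact fun h => h2 (by linear_combination h)
  · exact fun h => h1 (by linear_combination h)

theorem Regular.shifted_injective (hR : Regular η ξ K k₁) (h : Config N) :
    Function.Injective (shifted η ξ h) := fun n k hnk => by
  by_contra hne
  exact hR.shifted_ne h h hne hnk

theorem Regular.shifted_ne_of_apply_ne (hR : Regular η ξ K k₁) {h h' : Config N} {n : Fin N}
    (hn : h n ≠ h' n) (k : Fin N) : shifted η ξ h n ≠ shifted η ξ h' k := by
  by_cases hk : n = k
  · subst hk
    intro he
    simp only [shifted, sub_right_inj, mul_eq_mul_right_iff, hR.eta_ne, or_false,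
      Nat.cast_inj] at he
    exact hn (Fin.ext he)
  · exact hR.shifted_ne h h' hk

theorem Regular.norm_ne (hR : Regular η ξ K k₁) (n : Fin N) : k₁ * dFun ξ (ξ n - η) ≠ 0 := by
  refine mul_ne_zero hR.k_ne (Finset.prod_ne_zero_iff.2 fun k _ => ?_)
  have := hR.shifted_ne_of_apply_ne (h := 1) (h' := 0) (n := n) (by simp) k
  rw [shifted_of_eq_one rfl, shifted_of_eq_zero rfl] at this
  exact sub_ne_zero.2 this

theorem Regular.commute_A (hR : Regular η ξ K k₁) (u v : ℂ) : Commute (T u 0 0) (T v 0 0) := by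
  have key (u v : ℂ) (h : u - v + η ≠ 0) : T u 0 0 * T v 0 0 = T v 0 0 * T u 0 0 := by
    have := rtt_twistedMonodromy K η ξ u v 0 0 0 0
    rw [← add_smul, ← add_smul] at this
    exact smul_right_injective _ h this
  by_cases h : u - v + η = 0
  -- The two coefficients u - v + η and v - u + η add up to 2η, so they cannot both vanish.
  · refine (key v u fun h' => hR.eta_ne ?_).symm
    linear_combination (h + h') / 2
  · exact key u v h

theorem Regular.bra_update (hR : Regular η ξ K k₁) {h : Config N} {n : Fin N} (hn : h n = 0) :
    bra η ξ K k₁ (Function.update h n 1) =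
      (k₁ * dFun ξ (ξ n - η))⁻¹ • (bra η ξ K k₁ h ᵥ* T (ξ n) 0 0) := by
  rw [bra, bra, List.ofFn_eq_map, List.ofFn_eq_map, prod_pow_update
    (fun n => (k₁ * dFun ξ (ξ n - η))⁻¹ • T (ξ n) 0 0)
    (fun i j => ((hR.commute_A _ _).smul_left _).smul_right _) h hn _ (List.nodup_finRange N)
    (List.mem_finRange n), ← Matrix.vecMul_vecMul, Matrix.vecMul_smul]

/-- Action of `A` at an inhomogeneity. -/
theorem Regular.bra_vecMul_A (hR : Regular η ξ K k₁) {h : Config N} {n : Fin N} (hn : h n = 0) :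
    bra η ξ K k₁ h ᵥ* T (ξ n) 0 0 =
      (k₁ * dFun ξ (ξ n - η)) • bra η ξ K k₁ (Function.update h n 1) := by
  rw [hR.bra_update hn, smul_inv_smul₀ (hR.norm_ne n)]

theorem bra_zero : bra η ξ K k₁ (0 : Config N) = braZero N := by
  have : (List.ofFn fun n : Fin N => ((k₁ * dFun ξ (ξ n - η))⁻¹ • T (ξ n) 0 0) ^
      ((0 : Config N) n : ℕ)).prod = 1 := by
    refine List.prod_eq_one fun x hx => ?_
    obtain ⟨n, rfl⟩ := List.mem_ofFn.1 hx
    simp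
  rw [bra, this, Matrix.vecMul_one]

theorem dh_zero (u : ℂ) : dh η ξ 0 u = dFun ξ u := by
  simp [dh, dFun, shifted]

theorem dh_update_mul {h : Config N} {n : Fin N} (e : Fin 2) (u : ℂ) :
    dh η ξ (Function.update h n e) u * (u - shifted η ξ h n) =
      dh η ξ h u * (u - (ξ n - ((e : ℕ) : ℂ) * η)) := by
  rw [dh, dh, ← Finset.mul_prod_erase _ _ (Finset.mem_univ n),
    ← Finset.mul_prod_erase _ (fun k => u - shifted η ξ h k) (Finset.mem_univ n),
    Finset.prod_congr rfl fun k hk => by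
      rw [shifted_update_of_ne h (Finset.ne_of_mem_erase hk)]]
  simp only [shifted, Function.update_self]
  ring

theorem dh_eq_zero_iff {h : Config N} {u : ℂ} : dh η ξ h u = 0 ↔ ∃ n, u = shifted η ξ h n := by
  simp [dh, Finset.prod_eq_zero_iff, sub_eq_zero]

theorem continuous_dh (h : Config N) : Continuous (dh η ξ h) := by
  unfold dh
  fun_prop

/-- The bras are eigenvectors of `B`. -/
theorem Regular.bra_vecMul_B (hR : Regular η ξ K k₁) (h : Config N) (u : ℂ) :
    bra η ξ K k₁ h ᵥ* T u 0 1 = (K 0 1 * dh η ξ h u) • bra η ξ K k₁ h := by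
  induction h using config_induction generalizing u with
  | h0 => rw [bra_zero, braZero_vecMul_twistedMonodromy, dh_zero]
  | hs h n hn ih =>
    have hB : bra η ξ K k₁ h ᵥ* T (ξ n) 0 1 = 0 := by
      rw [ih, dh_eq_zero_iff.2 ⟨n, (shifted_of_eq_zero hn).symm⟩, mul_zero, zero_smul]
    have hne (v : ℂ) (hv : v ∈ ({ξ n}ᶜ : Set ℂ)) :
        bra η ξ K k₁ (Function.update h n 1) ᵥ* T v 0 1 =
          (K 0 1 * dh η ξ (Function.update h n 1) v) • bra η ξ K k₁ (Function.update h n 1) := by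
      have hv' : v - ξ n ≠ 0 := sub_ne_zero.2 hv
      -- In the exchange relation of B(v) with A(ξ_n) the unwanted term starts with B(ξ_n) and is
      -- annihilated. What remains multiplies the eigenvalue by (v - ξ_n + η) / (v - ξ_n), that is,
      -- it replaces the root ξ_n by ξ_n - η.
      have h1 := congrArg (bra η ξ K k₁ h ᵥ* ·) (rtt_twistedMonodromy K η ξ v (ξ n) 0 1 0 0)
      simp only [Matrix.vecMul_add, Matrix.vecMul_smul, ← Matrix.vecMul_vecMul, hB, ih,
        Matrix.smul_vecMul, Matrix.zero_vecMul, smul_zero, add_zero, smul_smul] at h1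
      rw [← add_smul] at h1
      have h2 := dh_update_mul (η := η) (ξ := ξ) (h := h) (n := n) 1 v
      rw [shifted_of_eq_zero hn] at h2
      rw [hR.bra_update hn, Matrix.smul_vecMul, smul_comm (K 0 1 * _)]
      congr 1
      refine smul_right_injective _ hv' ?_
      simp only [← h1, smul_smul]
      congr 1
      simp only [Fin.val_one, Nat.cast_one, one_mul] at h2
      linear_combination -(K 0 1) * h2
    -- The excluded value v = ξ_n is reached by continuity.
    have h3 := Continuous.ext_on (dense_compl_singleton (ξ n))
      (Continuous.matrix_vecMul continuous_const
        (hasLead_twistedMonodromy (N := N) K η ξ 0 1).continuous)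
      (((continuous_const.mul (continuous_dh (η := η) (ξ := ξ) (Function.update h n 1))).smul
        continuous_const)) hne
    exact congrFun h3 u

theorem Regular.bra_vecMul_B_eq_zero (hR : Regular η ξ K k₁) {h : Config N} {n : Fin N}
    (hn : h n = 0) : bra η ξ K k₁ h ᵥ* T (ξ n) 0 1 = 0 := by
  rw [hR.bra_vecMul_B, dh_eq_zero_iff.2 ⟨n, (shifted_of_eq_zero hn).symm⟩, mul_zero, zero_smul]

theorem update_update_of_eq {h : Config N} {n : Fin N} {e : Fin 2} (hn : h n = e) (e' : Fin 2) :
    Function.update (Function.update h n e') n e = h := by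
  rw [Function.update_idem, ← hn, Function.update_eq_self]

theorem Regular.bra_vecMul_A_eq_zero (hR : Regular η ξ K k₁) {h : Config N} {n : Fin N}
    (hn : h n = 1) : bra η ξ K k₁ h ᵥ* T (ξ n - η) 0 0 = 0 := by
  have h1 := anti_twistedMonodromy K hR.eta_ne ξ n 0 0 0 0
  have h2 : T (ξ n) 0 0 * T (ξ n - η) 0 0 = 0 := by
    rw [← two_smul ℂ] at h1
    exact (smul_eq_zero.1 h1).resolve_left two_ne_zero
  rw [← update_update_of_eq hn 0, hR.bra_update (by simp), Matrix.smul_vecMul,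
    Matrix.vecMul_vecMul, h2, Matrix.vecMul_zero, smul_zero]

/-- True on the reference state because d(ξ_n) = 0, and preserved by A(ξ_m): in the exchange
relation of D(ξ_n) and A(ξ_m) the unwanted terms start with B(ξ_n) or B(ξ_m), which annihilate the
bra. -/
theorem Regular.bra_vecMul_D_eq_zero (hR : Regular η ξ K k₁) {h : Config N} {n : Fin N}
    (hn : h n = 0) : bra η ξ K k₁ h ᵥ* T (ξ n) 1 1 = 0 := by
  induction h using config_induction with
  | h0 =>
    rw [bra_zero, braZero_vecMul_twistedMonodromy, ← dh_zero (η := η),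
      dh_eq_zero_iff.2 ⟨n, by simp [shifted]⟩, mul_zero, zero_smul]
  | hs h m hm ih =>
    have hnm : n ≠ m := by
      rintro rfl
      simp at hn
    rw [Function.update_of_ne hnm] at hn
    have h1 := congrArg (bra η ξ K k₁ h ᵥ* ·)
      (rtt_twistedMonodromy K η ξ (ξ n) (ξ m) 1 1 0 0)
    simp only [Matrix.vecMul_add, Matrix.vecMul_smul, ← Matrix.vecMul_vecMul, ih hn,
      hR.bra_vecMul_B_eq_zero hn, hR.bra_vecMul_B_eq_zero hm, Matrix.zero_vecMul, smul_zero,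
      add_zero] at h1
    rw [hR.bra_update hm, Matrix.smul_vecMul,
      (smul_eq_zero.1 h1.symm).resolve_left (sub_ne_zero.2 (hR.xi_ne n m hnm).1), smul_zero]

/-- Action of `D` at a shifted inhomogeneity. -/
theorem Regular.bra_vecMul_D (hR : Regular η ξ K k₁) {h : Config N} {n : Fin N} (hn : h n = 1) :
    bra η ξ K k₁ h ᵥ* T (ξ n - η) 1 1 =
      (K.det / k₁ * aFun η ξ (ξ n)) • bra η ξ K k₁ (Function.update h n 0) := by
  -- The quantum determinant reads A(ξ_n) D(ξ_n - η) - B(ξ_n) C(ξ_n - η), and its second term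
  -- annihilates the lowered bra. The normalization of the raised one removes d(ξ_n - η).
  have h1 := congrArg (bra η ξ K k₁ (Function.update h n 0) ᵥ* ·)
    (qdet_twistedMonodromy K η ξ (ξ n) 0 1)
  simp only [Matrix.vecMul_sub, ← Matrix.vecMul_vecMul, Matrix.vecMul_smul, Matrix.vecMul_one,
    hR.bra_vecMul_B_eq_zero (h := Function.update h n 0) (n := n) (by simp), Matrix.zero_vecMul,
    sub_zero] at h1
  have h2 := hR.norm_ne n
  have h3 := right_ne_zero_of_mul h2
  have h4 := hR.k_ne
  conv_lhs => rw [← update_update_of_eq hn 0, hR.bra_update (by simp), Matrix.smul_vecMul, h1,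
    smul_smul]
  congr 1
  simp
  field_simp

end Bra

end

end TwistedXXX

namespace TwistedXXX

noncomputable section

/-! ### The action of the monodromy matrix on states -/

/-- Isolates the dependence on `x n`: the sign depends only on the order of the indices and the last
product does not contain `x n`. -/
theorem vandermondeProd_eq {N : ℕ} (x : Fin N → ℂ) (n : Fin N) :
    vandermondeProd x = (∏ k ∈ Finset.univ.erase n, (if n < k then -1 else 1)) *
      (∏ k ∈ Finset.univ.erase n, (x n - x k)) *
      ∏ i ∈ Finset.univ.erase n, ∏ j ∈ Finset.univ.erase n, if i < j then x j - x i else 1 := by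
  have h1 : vandermondeProd x = ∏ i, ∏ j, if i < j then x j - x i else 1 := by
    refine Finset.prod_congr rfl fun i _ => ?_
    rw [← Finset.prod_filter]
    refine Finset.prod_congr ?_ fun _ _ => rfl
    ext j
    simp
  have h2 : ∏ i ∈ Finset.univ.erase n, ∏ j, (if i < j then x j - x i else 1) =
      (∏ i ∈ Finset.univ.erase n, if i < n then x n - x i else 1) *
      ∏ i ∈ Finset.univ.erase n, ∏ j ∈ Finset.univ.erase n, if i < j then x j - x i else 1 := by
    rw [← Finset.prod_mul_distrib]
    exact Finset.prod_congr rfl fun i _ => (Finset.mul_prod_erase _ _ (Finset.mem_univ n)).symm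
  have h3 : (∏ k ∈ Finset.univ.erase n, if n < k then x k - x n else 1) *
      (∏ k ∈ Finset.univ.erase n, if k < n then x n - x k else 1) =
      (∏ k ∈ Finset.univ.erase n, (if n < k then -1 else 1)) *
        ∏ k ∈ Finset.univ.erase n, (x n - x k) := by
    rw [← Finset.prod_mul_distrib, ← Finset.prod_mul_distrib]
    refine Finset.prod_congr rfl fun k hk => ?_
    rcases lt_or_gt_of_ne (Finset.ne_of_mem_erase hk) with h | h
    · rw [if_neg h.not_gt, if_pos h, if_neg h.not_gt]
    · rw [if_pos h, if_neg h.not_gt, if_pos h]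
      ring
  rw [h1, ← Finset.mul_prod_erase _ _ (Finset.mem_univ n), h2,
    ← Finset.mul_prod_erase _ (fun j => if n < j then x j - x n else 1) (Finset.mem_univ n),
    if_neg (lt_irrefl n), one_mul, ← mul_assoc, h3]

theorem vandermondeProd_mul_eq {N : ℕ} {x y : Fin N → ℂ} (n : Fin N)
    (h : ∀ k, k ≠ n → x k = y k) :
    vandermondeProd x * ∏ k ∈ Finset.univ.erase n, (y n - y k) =
      vandermondeProd y * ∏ k ∈ Finset.univ.erase n, (x n - x k) := by
  have h' : ∀ k ∈ Finset.univ.erase n, x k = y k := fun k hk => h k (Finset.ne_of_mem_erase hk)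
  have h1 : ∏ i ∈ Finset.univ.erase n, ∏ j ∈ Finset.univ.erase n,
      (if i < j then x j - x i else 1) =
      ∏ i ∈ Finset.univ.erase n, ∏ j ∈ Finset.univ.erase n, if i < j then y j - y i else 1 :=
    Finset.prod_congr rfl fun i hi => Finset.prod_congr rfl fun j hj => by rw [h' i hi, h' j hj]
  rw [vandermondeProd_eq x n, vandermondeProd_eq y n, h1]
  ring

theorem sum_ite_update {N : ℕ} {M : Type*} [AddCommMonoid M] (n : Fin N) (e : Fin 2)
    (g : Config N → M) :
    ∑ h : Config N, (if h n = e then g h else 0) =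
      ∑ h : Config N, if h n = e then 0 else g (Function.update h n e) := by
  rw [← Finset.sum_filter]
  have : ∀ h : Config N, (if h n = e then 0 else g (Function.update h n e)) =
      if h n ≠ e then g (Function.update h n e) else 0 := fun h => by
    by_cases hn : h n = e <;> simp [hn]
  simp only [this]
  rw [← Finset.sum_filter]
  have h2 (a b : Fin 2) (h : a ≠ b) : a = 1 - b := by omega
  have h3 (a : Fin 2) : 1 - a ≠ a := by omega
  refine Finset.sum_bij' (fun h _ => Function.update h n (1 - e))
    (fun h _ => Function.update h n e) (fun h hh => ?_) (fun h hh => ?_) (fun h hh => ?_)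
    (fun h hh => ?_) fun h hh => ?_ <;>
    simp only [Finset.mem_filter, Finset.mem_univ, true_and] at hh ⊢
  · simpa using h3 e
  · simp
  · exact update_update_of_eq hh _
  · exact update_update_of_eq (h2 _ _ hh) _
  · rw [update_update_of_eq hh]

section State

variable {N : ℕ} {η : ℂ} {ξ : Fin N → ℂ} {K : Matrix (Fin 2) (Fin 2) ℂ} {k₁ : ℂ}

local notation "T" => twistedMonodromy η ξ K

/-- Distinct configurations have distinct sets of roots, so all differences of the polynomials d_h
are nonzero, and so is their product; any point where it does not vanish separates the eigenvalues
of B. -/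
theorem Regular.exists_injective_dh (hR : Regular η ξ K k₁) :
    ∃ u, Function.Injective fun h => dh η ξ h u := by
  let p (h : Config N) : Polynomial ℂ :=
    ∏ n, (Polynomial.X - Polynomial.C (shifted η ξ h n))
  have hp (h : Config N) (u : ℂ) : (p h).eval u = dh η ξ h u := by
    simp [p, dh, Polynomial.eval_prod]
  have hne : ∏ r : Config N × Config N with r.1 ≠ r.2, (p r.1 - p r.2) ≠ 0 := by
    refine Finset.prod_ne_zero_iff.2 fun r hr h0 => ?_
    obtain ⟨n, hn⟩ := Function.ne_iff.1 (Finset.mem_filter.1 hr).2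
    have h1 := congrArg (Polynomial.eval (shifted η ξ r.1 n)) h0
    rw [Polynomial.eval_sub, hp, hp, dh_eq_zero_iff.2 ⟨n, rfl⟩, Polynomial.eval_zero, zero_sub,
      neg_eq_zero, dh_eq_zero_iff] at h1
    obtain ⟨k, hk⟩ := h1
    exact hR.shifted_ne_of_apply_ne hn k hk
  obtain ⟨u, hu⟩ : ∃ u, (∏ r : Config N × Config N with r.1 ≠ r.2, (p r.1 - p r.2)).eval u ≠ 0 := by
    by_contra! h
    exact hne (Polynomial.funext fun u => by rw [h u, Polynomial.eval_zero])
  refine ⟨u, fun h h' hh => ?_⟩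
  by_contra hne'
  rw [Polynomial.eval_prod, Finset.prod_ne_zero_iff] at hu
  refine hu (h, h') (by simpa using hne') ?_
  rw [Polynomial.eval_sub, hp, hp]
  exact sub_eq_zero.2 hh

/-- D(ξ_n - η) leads back from the raised bra to the previous one with a nonzero factor, so no
raising step can give zero. -/
theorem Regular.bra_ne_zero (hR : Regular η ξ K k₁) (hK : K.det ≠ 0) (h : Config N) :
    bra η ξ K k₁ h ≠ 0 := by
  induction h using config_induction with
  | h0 =>
    rw [bra_zero, braZero]
    simp
  | hs h n hn ih =>
    intro h0
    have h1 := hR.bra_vecMul_D (h := Function.update h n 1) (n := n) (by simp)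
    rw [h0, Matrix.zero_vecMul, update_update_of_eq hn] at h1
    refine ih ((smul_eq_zero.1 h1.symm).resolve_left
      (mul_ne_zero (div_ne_zero hK hR.k_ne) (Finset.prod_ne_zero_iff.2 fun k _ => ?_)))
    have := hR.shifted_ne_of_apply_ne (h := 0) (h' := 1) (n := n) (by simp) k
    rw [shifted_of_eq_one (h := 1) rfl, shifted_of_eq_zero (h := 0) rfl] at this
    exact fun h => this (by linear_combination h)

theorem Regular.linearIndependent_bra (hR : Regular η ξ K k₁) (hK : K.det ≠ 0) :
    LinearIndependent ℂ (bra η ξ K k₁) := by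
  obtain ⟨u, hu⟩ := hR.exists_injective_dh
  refine Module.End.eigenvectors_linearIndependent' (T u 0 1).vecMulLinear
    (fun h => K 0 1 * dh η ξ h u) (fun h h' hh => hu (mul_left_cancel₀ hR.b_ne hh)) _ fun h =>
    ⟨Module.End.mem_eigenspace_iff.2 ?_, hR.bra_ne_zero hK h⟩
  exact hR.bra_vecMul_B h u

/-- The bras are a basis of eigenvectors, by independence and a count of dimensions, and all
eigenvalues are nonzero. -/
theorem Regular.isUnit_B (hR : Regular η ξ K k₁) (hK : K.det ≠ 0) {u : ℂ}
    (hu : ∀ h, dh η ξ h u ≠ 0) : IsUnit (T u 0 1) := by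
  rw [← Matrix.vecMul_surjective_iff_isUnit]
  have h1 : ⊤ ≤ LinearMap.range (T u 0 1).vecMulLinear := by
    rw [← (hR.linearIndependent_bra hK).span_eq_top_of_card_eq_finrank' (by simp),
      Submodule.span_le]
    rintro _ ⟨h, rfl⟩
    refine ⟨(K 0 1 * dh η ξ h u)⁻¹ • bra η ξ K k₁ h, ?_⟩
    rw [map_smul]
    simp only [Matrix.vecMulLinear_apply]
    rw [hR.bra_vecMul_B, inv_smul_smul₀ (mul_ne_zero hR.b_ne (hu h))]
  exact fun v => h1 (Submodule.mem_top (x := v))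

theorem Regular.bra_vecMul_B_inv (hR : Regular η ξ K k₁) (hK : K.det ≠ 0) {u : ℂ}
    (hu : ∀ h, dh η ξ h u ≠ 0) (h : Config N) :
    bra η ξ K k₁ h ᵥ* (T u 0 1)⁻¹ = (K 0 1 * dh η ξ h u)⁻¹ • bra η ξ K k₁ h := by
  have h1 := congrArg (· ᵥ* (T u 0 1)⁻¹) (hR.bra_vecMul_B h u)
  simp only [Matrix.vecMul_vecMul, Matrix.smul_vecMul] at h1
  rw [Matrix.mul_nonsing_inv _ ((Matrix.isUnit_iff_isUnit_det _).1 (hR.isUnit_B hK hu)),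
    Matrix.vecMul_one] at h1
  conv_rhs => rw [h1, inv_smul_smul₀ (mul_ne_zero hR.b_ne (hu h))]

theorem Regular.bra_vecMul_eq_interpolation (hR : Regular η ξ K k₁) {F : ℂ → Op N} {x : ℂ}
    (hF : HasLead N F (x • 1)) (h : Config N) (u : ℂ) :
    bra η ξ K k₁ h ᵥ* F u = (x * dh η ξ h u) • bra η ξ K k₁ h +
      ∑ n, (∏ k ∈ Finset.univ.erase n, ((u - shifted η ξ h k) /
        (shifted η ξ h n - shifted η ξ h k))) • (bra η ξ K k₁ h ᵥ* F (shifted η ξ h n)) := by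
  ext t
  choose p hp using fun s => hF s t
  have h1 (v : ℂ) : (∑ s, Polynomial.C (bra η ξ K k₁ h s) * p s).eval v =
      (bra η ξ K k₁ h ᵥ* F v) t := by
    simp [Polynomial.eval_finsetSum, (hp _).2.2, Matrix.vecMul, dotProduct]
  have h2 := eval_eq_interpolation (∑ s, Polynomial.C (bra η ξ K k₁ h s) * p s)
    (Polynomial.natDegree_sum_le_of_forall_le _ _ fun s _ =>
      (Polynomial.natDegree_C_mul_le _ _).trans (hp s).1) (hR.shifted_injective h) u
  simp only [h1] at h2
  rw [h2]
  simp only [Pi.add_apply, Pi.smul_apply, Finset.sum_apply, smul_eq_mul, dh,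
    Polynomial.finsetSum_coeff, Polynomial.coeff_C_mul, (hp _).2.1, Matrix.smul_apply,
    Matrix.one_apply, mul_ite, mul_one, mul_zero, Finset.sum_ite_eq', Finset.mem_univ, if_true]
  congr 1
  · ring
  · exact Finset.sum_congr rfl fun n _ => mul_comm _ _

variable (η ξ K k₁) in
/-- The state with the coefficients `f h V(ξ^{(h)})` in the separated basis. -/
def stateOf (f : Config N → ℂ) : Config N → ℂ :=
  ∑ h, (f h * vandermondeProd (shifted η ξ h)) • bra η ξ K k₁ h

variable (η ξ) in
/-- The weight of a shift at the site `n`. -/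
def shiftWeight (num : ℂ → ℂ) (u : ℂ) (h : Config N) (n : Fin N) : ℂ :=
  1 / (u - shifted η ξ h n) * (num (shifted η ξ h n) /
    ∏ k ∈ Finset.univ.erase n, (shifted η ξ h n - shifted η ξ h k))

/-- Covers A with `e = 0` and D with `e = 1`. In the interpolation formula a site contributes only
if h_n = e; reindexing by the resulting bra moves the shift onto the coefficient function. The
vanishing of `num` at h_n = e allows the sum to run over all sites. -/
theorem Regular.stateOf_vecMul (hR : Regular η ξ K k₁) {F : ℂ → Op N} {x κ : ℂ} {num : ℂ → ℂ}
    {e : Fin 2} (hF : HasLead N F (x • 1))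
    (h0 : ∀ h n, h n ≠ e → bra η ξ K k₁ h ᵥ* F (shifted η ξ h n) = 0)
    (h1 : ∀ h n, h n ≠ e → bra η ξ K k₁ (Function.update h n e) ᵥ*
      F (shifted η ξ (Function.update h n e) n) =
        (κ * num (shifted η ξ h n)) • bra η ξ K k₁ h)
    (hnum : ∀ h n, h n = e → num (shifted η ξ h n) = 0) {u : ℂ}
    (hu : ∀ h n, u ≠ shifted η ξ h n) (f : Config N → ℂ) :
    stateOf η ξ K k₁ f ᵥ* F u = stateOf η ξ K k₁ fun h => dh η ξ h u *
      (x * f h + κ * ∑ n, shiftWeight η ξ num u h n * f (Function.update h n e)) := by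
  have key (n : Fin N) : ∑ h, (f h * vandermondeProd (shifted η ξ h)) •
      (∏ k ∈ Finset.univ.erase n, ((u - shifted η ξ h k) /
        (shifted η ξ h n - shifted η ξ h k))) • (bra η ξ K k₁ h ᵥ* F (shifted η ξ h n)) =
      ∑ h, (dh η ξ h u * κ * (shiftWeight η ξ num u h n * f (Function.update h n e)) *
        vandermondeProd (shifted η ξ h)) • bra η ξ K k₁ h := by
    refine (Finset.sum_congr rfl fun h _ => ?_).trans ((sum_ite_update n e fun h =>
      (f h * vandermondeProd (shifted η ξ h)) •
        (∏ k ∈ Finset.univ.erase n, ((u - shifted η ξ h k) /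
          (shifted η ξ h n - shifted η ξ h k))) • (bra η ξ K k₁ h ᵥ* F (shifted η ξ h n))).trans
      (Finset.sum_congr rfl fun h _ => ?_))
    · by_cases hn : h n = e
      · rw [if_pos hn]
      · rw [if_neg hn, h0 h n hn, smul_zero, smul_zero]
    · by_cases hn : h n = e
      · simp [hn, shiftWeight, hnum h n hn]
      · rw [if_neg hn, h1 h n hn, smul_smul, smul_smul]
        congr 1
        have hx (h : Config N) :
            ∏ k ∈ Finset.univ.erase n, (shifted η ξ h n - shifted η ξ h k) ≠ 0 :=
          Finset.prod_ne_zero_iff.2 fun k hk => sub_ne_zero.2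
            (hR.shifted_ne h h (Finset.ne_of_mem_erase hk).symm)
        -- The quotient of the two Vandermonde factors is the quotient of the interpolation
        -- denominators before and after the flip.
        have hV := vandermondeProd_mul_eq (x := shifted η ξ (Function.update h n e))
          (y := shifted η ξ h) n fun k hk => shifted_update_of_ne h hk e
        have hd : dh η ξ h u = (u - shifted η ξ h n) *
            ∏ k ∈ Finset.univ.erase n, (u - shifted η ξ h k) :=
          (Finset.mul_prod_erase _ _ (Finset.mem_univ n)).symm
        have hu' := sub_ne_zero.2 (hu h n)
        have hx1 := hx h
        have hx2 := hx (Function.update h n e)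
        rw [Finset.prod_div_distrib, shiftWeight, hd,
          Finset.prod_congr rfl fun k hk => by
            rw [shifted_update_of_ne h (Finset.ne_of_mem_erase hk)]]
        field_simp
        linear_combination (κ * num (shifted η ξ h n) * f (Function.update h n e) *
          ∏ k ∈ Finset.univ.erase n, (u - shifted η ξ h k)) * hV
  simp only [stateOf, Matrix.sum_vecMul, Matrix.smul_vecMul, hR.bra_vecMul_eq_interpolation hF _ u,
    smul_add, Finset.smul_sum, Finset.sum_add_distrib]
  rw [Finset.sum_comm, Finset.sum_congr rfl fun n _ => key n, Finset.sum_comm,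
    ← Finset.sum_add_distrib]
  refine Finset.sum_congr rfl fun h _ => ?_
  rw [← Finset.sum_smul, smul_smul, ← add_smul, ← Finset.sum_mul, ← Finset.mul_sum]
  congr 1
  ring

theorem Regular.stateOf_vecMul_A (hR : Regular η ξ K k₁) {u : ℂ} (hu : ∀ h n, u ≠ shifted η ξ h n)
    (f : Config N → ℂ) :
    stateOf η ξ K k₁ f ᵥ* T u 0 0 = stateOf η ξ K k₁ fun h => dh η ξ h u *
      (K 0 0 * f h + k₁ * ∑ n, shiftWeight η ξ (dFun ξ) u h n * f (Function.update h n 0)) := by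
  refine hR.stateOf_vecMul (F := fun u => T u 0 0) (hasLead_twistedMonodromy K η ξ 0 0)
    (fun h n hn => ?_) (fun h n hn => ?_) (fun h n hn => ?_) hu f
  · have hn' : h n = 1 := by omega
    rw [shifted_of_eq_one hn']
    exact hR.bra_vecMul_A_eq_zero hn'
  · have hn' : h n = 1 := by omega
    rw [shifted_of_eq_one hn', shifted_of_eq_zero (by simp)]
    exact (hR.bra_vecMul_A (by simp)).trans (by rw [update_update_of_eq hn'])
  · rw [shifted_of_eq_zero hn, ← dh_zero (η := η)]
    exact dh_eq_zero_iff.2 ⟨n, (shifted_of_eq_zero rfl).symm⟩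

theorem aFun_eq_dFun (u : ℂ) : aFun η ξ u = dFun ξ (u + η) :=
  Finset.prod_congr rfl fun n _ => by ring

theorem Regular.stateOf_vecMul_D (hR : Regular η ξ K k₁) {u : ℂ} (hu : ∀ h n, u ≠ shifted η ξ h n)
    (f : Config N → ℂ) :
    stateOf η ξ K k₁ f ᵥ* T u 1 1 = stateOf η ξ K k₁ fun h => dh η ξ h u *
      (K 1 1 * f h + K.det / k₁ *
        ∑ n, shiftWeight η ξ (aFun η ξ) u h n * f (Function.update h n 1)) := by
  refine hR.stateOf_vecMul (F := fun u => T u 1 1) (hasLead_twistedMonodromy K η ξ 1 1)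
    (fun h n hn => ?_) (fun h n hn => ?_) (fun h n hn => ?_) hu f
  · have hn' : h n = 0 := by omega
    rw [shifted_of_eq_zero hn']
    exact hR.bra_vecMul_D_eq_zero hn'
  · have hn' : h n = 0 := by omega
    rw [shifted_of_eq_zero hn', shifted_of_eq_one (by simp)]
    exact (hR.bra_vecMul_D (by simp)).trans (by rw [update_update_of_eq hn'])
  · rw [shifted_of_eq_one hn, aFun_eq_dFun, sub_add_cancel, ← dh_zero (η := η)]
    exact dh_eq_zero_iff.2 ⟨n, (shifted_of_eq_zero rfl).symm⟩

theorem Regular.stateOf_vecMul_B (hR : Regular η ξ K k₁) (u : ℂ) (f : Config N → ℂ) :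
    stateOf η ξ K k₁ f ᵥ* T u 0 1 = stateOf η ξ K k₁ fun h => K 0 1 * dh η ξ h u * f h := by
  simp only [stateOf, Matrix.sum_vecMul, Matrix.smul_vecMul, hR.bra_vecMul_B, smul_smul]
  exact Finset.sum_congr rfl fun h _ => by congr 1; ring

/-- The flipped coefficient carries 1 / d_{h'}(u + η) with h'_n = 0. Replacing it by 1 / d_h(u + η)
changes the denominator u + η - (ξ_n - η) of the weight into u - (ξ_n - η), so the arguments u + η
leave the weights of A at u and no factor d_h. -/
theorem Regular.stateOf_vecMul_B_inv_mul_A (hR : Regular η ξ K k₁) (hK : K.det ≠ 0) {u : ℂ}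
    (hu : ∀ h n, u ≠ shifted η ξ h n) (hu' : ∀ h n, u + η ≠ shifted η ξ h n) (f : Config N → ℂ) :
    stateOf η ξ K k₁ f ᵥ* ((T (u + η) 0 1)⁻¹ * T (u + η) 0 0) =
      stateOf η ξ K k₁ fun h => K 0 0 / K 0 1 * f h +
        k₁ / K 0 1 * ∑ n, shiftWeight η ξ (dFun ξ) u h n * f (Function.update h n 0) := by
  have hd (h : Config N) : dh η ξ h (u + η) ≠ 0 := fun h0 => by
    obtain ⟨n, hn⟩ := dh_eq_zero_iff.1 h0
    exact hu' h n hn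
  have h1 : stateOf η ξ K k₁ f ᵥ* (T (u + η) 0 1)⁻¹ =
      stateOf η ξ K k₁ fun h => (K 0 1 * dh η ξ h (u + η))⁻¹ * f h := by
    simp only [stateOf, Matrix.sum_vecMul, Matrix.smul_vecMul, hR.bra_vecMul_B_inv hK hd,
      smul_smul]
    exact Finset.sum_congr rfl fun h _ => by congr 1; ring
  rw [← Matrix.vecMul_vecMul, h1, hR.stateOf_vecMul_A hu']
  congr 1
  funext h
  have hb := hR.b_ne
  have h2 (n : Fin N) : shiftWeight η ξ (dFun ξ) (u + η) h n *
      ((K 0 1 * dh η ξ (Function.update h n 0) (u + η))⁻¹ * f (Function.update h n 0)) =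
      (K 0 1 * dh η ξ h (u + η))⁻¹ *
        (shiftWeight η ξ (dFun ξ) u h n * f (Function.update h n 0)) := by
    by_cases hn : h n = 0
    · rw [shiftWeight, shiftWeight, shifted_of_eq_zero hn, ← dh_zero (η := η),
        dh_eq_zero_iff.2 ⟨n, (shifted_of_eq_zero rfl).symm⟩]
      simp
    · have hn' : h n = 1 := by omega
      have h3 := dh_update_mul (η := η) (ξ := ξ) (h := h) (n := n) 0 (u + η)
      have h4 := hd h
      have h5 := hd (Function.update h n 0)
      have h6 := sub_ne_zero.2 (hu h n)
      have h7 := sub_ne_zero.2 (hu' h n)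
      rw [shiftWeight, shiftWeight]
      rw [shifted_of_eq_one hn'] at h3 h6 h7 ⊢
      simp only [Fin.val_zero, Nat.cast_zero, zero_mul, sub_zero] at h3
      generalize ∏ k ∈ Finset.univ.erase n, (ξ n - η - shifted η ξ h k) = E
      rcases eq_or_ne E 0 with rfl | hE
      · simp
      field_simp
      linear_combination (-(dFun ξ (ξ n - η)) * f (Function.update h n 0)) * h3
  simp only [h2, ← Finset.mul_sum]
  have h4 := hd h
  field_simp

end State

end

end TwistedXXX

namespace TwistedXXX

noncomputable section

/-! ### Repeated action on a separate state -/

namespace Params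

variable {N R : ℕ} {P : Params N R}

variable (P) in
/-- The part of the coefficient of a bra that does not involve the integrals, after the action of
`j` operators. -/
def prefactor (b : ℂ) (j : ℕ) (h : Config N) : ℂ :=
  (∏ k ∈ Finset.Icc 1 j, (b * dh P.η P.ξ h (P.lam k))) *
    ∏ n, QFun P.q (shifted P.η P.ξ h n)

theorem Generic.regular (hP : P.Generic) {K : Matrix (Fin 2) (Fin 2) ℂ} {k₁ : ℂ}
    (hb : K 0 1 ≠ 0) (hk : k₁ ≠ 0) : Regular P.η P.ξ K k₁ :=
  ⟨hP.eta_ne, hP.xi_ne, hb, hk⟩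

theorem Generic.lam_ne_shifted (hP : P.Generic) {j : ℕ} (hj : 1 ≤ j) (hjm : j ≤ P.m)
    (h : Config N) (n : Fin N) : P.lam j ≠ shifted P.η P.ξ h n := by
  obtain ⟨h1, h2, -⟩ := hP.lam_ne j hj hjm n
  rcases Fin.exists_fin_two.1 ⟨h n, rfl⟩ with hn | hn
  · rwa [shifted_of_eq_zero hn]
  · rwa [shifted_of_eq_one hn]

theorem Generic.lam_add_ne_shifted (hP : P.Generic) {j : ℕ} (hj : 1 ≤ j) (hjm : j ≤ P.m)
    (h : Config N) (n : Fin N) : P.lam j + P.η ≠ shifted P.η P.ξ h n := by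
  obtain ⟨-, h1, h2⟩ := hP.lam_ne j hj hjm n
  rcases Fin.exists_fin_two.1 ⟨h n, rfl⟩ with hn | hn
  · rw [shifted_of_eq_zero hn]
    exact fun h => h1 (by linear_combination h)
  · rw [shifted_of_eq_one hn]
    exact fun h => h2 (by linear_combination h)

theorem Generic.QFun_ne_zero (hP : P.Generic) (h : Config N) (n : Fin N) :
    QFun P.q (shifted P.η P.ξ h n) ≠ 0 := by
  refine Finset.prod_ne_zero_iff.2 fun k _ => sub_ne_zero.2 ?_
  rcases Fin.exists_fin_two.1 ⟨h n, rfl⟩ with hn | hn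
  · rw [shifted_of_eq_zero hn]
    exact (hP.q_ne k n).1.symm
  · rw [shifted_of_eq_one hn]
    exact (hP.q_ne k n).2.symm

theorem regRatio_eq {i : ℕ} {h : Config N} {n : Fin N} (hn : h n = if Even i then 0 else 1) :
    P.regRatio i (shifted P.η P.ξ h n) =
      QFun P.q (shifted P.η P.ξ (flip i n h) n) / QFun P.q (shifted P.η P.ξ h n) *
        ∏ k ∈ Finset.Ico 1 ((i + 1) / 2), (shifted P.η P.ξ (flip i n h) n - P.lam k) /
          (shifted P.η P.ξ h n - P.lam k) := by
  by_cases hi : Even i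
  · rw [if_pos hi] at hn
    rw [flip, regRatio, if_pos hi, if_pos hi, shifted_of_eq_zero hn, shifted_of_eq_one (by simp)]
    simp only [sub_right_comm]
  · rw [if_neg hi] at hn
    rw [flip, regRatio, if_neg hi, if_neg hi, shifted_of_eq_one hn, shifted_of_eq_zero (by simp)]
    have h1 (x : ℂ) : P.ξ n - P.η - x + P.η = P.ξ n - x := by ring
    simp only [h1, sub_add_cancel]

/-- A flip moves one point of the chain: this changes one value of Q and one linear factor in each
d_h(λ_k), exactly the ratios attached to the integration variable in the integrand. -/
theorem Generic.prefactor_flip (hP : P.Generic) (b : ℂ) {i j : ℕ} (hij : (i + 1) / 2 = j + 1)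
    (hj : j ≤ P.m) {h : Config N} {n : Fin N} (hn : h n = if Even i then 0 else 1) :
    P.prefactor b j (flip i n h) =
      P.prefactor b j h * P.regRatio i (shifted P.η P.ξ h n) := by
  have h1 : ∏ k ∈ Finset.Icc 1 j, (b * dh P.η P.ξ (flip i n h) (P.lam k)) =
      (∏ k ∈ Finset.Icc 1 j, (b * dh P.η P.ξ h (P.lam k))) *
        ∏ k ∈ Finset.Icc 1 j, (shifted P.η P.ξ (flip i n h) n - P.lam k) /
          (shifted P.η P.ξ h n - P.lam k) := by
    rw [← Finset.prod_mul_distrib]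
    refine Finset.prod_congr rfl fun k hk => ?_
    rw [Finset.mem_Icc] at hk
    have h2 := sub_ne_zero.2 (hP.lam_ne_shifted hk.1 (hk.2.trans hj) h n).symm
    have h3 := dh_update_mul (η := P.η) (ξ := P.ξ) (h := h) (n := n) (if Even i then 1 else 0)
      (P.lam k)
    have h4 : shifted P.η P.ξ (flip i n h) n =
        P.ξ n - (((if Even i then 1 else 0 : Fin 2) : ℕ) : ℂ) * P.η := by
      simp only [shifted, flip, Function.update_self]
    rw [← h4] at h3
    rw [mul_div_assoc', eq_div_iff h2]
    change dh P.η P.ξ (flip i n h) (P.lam k) * _ = _ at h3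
    linear_combination (-b) * h3
  have h2 : ∏ k, QFun P.q (shifted P.η P.ξ (flip i n h) k) =
      (∏ k, QFun P.q (shifted P.η P.ξ h k)) *
        (QFun P.q (shifted P.η P.ξ (flip i n h) n) / QFun P.q (shifted P.η P.ξ h n)) := by
    rw [mul_div_assoc', eq_div_iff (hP.QFun_ne_zero h n),
      ← Finset.mul_prod_erase _ _ (Finset.mem_univ n),
      ← Finset.mul_prod_erase _ (fun k => QFun P.q (shifted P.η P.ξ h k)) (Finset.mem_univ n),
      Finset.prod_congr rfl fun k hk => by
        rw [flip, shifted_update_of_ne h (Finset.ne_of_mem_erase hk)]]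
    ring
  rw [prefactor, prefactor, regRatio_eq hn, h1, h2, hij]
  have h3 : Finset.Ico 1 (j + 1) = Finset.Icc 1 j := by
    ext k; simp only [Finset.mem_Ico, Finset.mem_Icc]; omega
  rw [h3]
  ring

theorem Generic.prefactor_mul_resCoeff (hP : P.Generic) (b : ℂ) {i j : ℕ}
    (hij : (i + 1) / 2 = j + 1) (hj : j ≤ P.m) (h : Config N) (n : Fin N) :
    P.prefactor b j h * P.resCoeff h i n =
      shiftWeight P.η P.ξ (if Even i then aFun P.η P.ξ else dFun P.ξ) (P.lam (j + 1)) h n *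
        P.prefactor b j (flip i n h) := by
  have h0 : (if Even i then aFun P.η P.ξ else dFun P.ξ) (shifted P.η P.ξ h n) =
      if Even i then aFun P.η P.ξ (shifted P.η P.ξ h n) else dFun P.ξ (shifted P.η P.ξ h n) := by
    split_ifs <;> rfl
  rw [resCoeff, shiftWeight, hij, h0]
  by_cases hn : h n = if Even i then 0 else 1
  · rw [hP.prefactor_flip b hij hj hn]
    ring
  · rw [numerator_eq_zero hn]
    ring

theorem Generic.prefactor_mul_value_succ (hP : P.Generic) (wInf wFin : ℕ → ℂ) (b : ℂ)
    {ε : ℕ → Fin 2} {i j : ℕ} (hij : (i + 1 + 1) / 2 = j + 1) (him : i + 1 ≤ 2 * P.m)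
    (he : ebar ε (i + 1) = 1) (h : Config N) :
    P.prefactor b j h * P.value wInf wFin ε (i + 1) h =
      wInf (i + 1) * (P.prefactor b j h * P.value wInf wFin ε i h) +
        wFin (i + 1) * ∑ n, shiftWeight P.η P.ξ (if Even (i + 1) then aFun P.η P.ξ else dFun P.ξ)
          (P.lam (j + 1)) h n *
            (P.prefactor b j (flip (i + 1) n h) * P.value wInf wFin ε i (flip (i + 1) n h)) := by
  have h1 (n : Fin N) := hP.prefactor_mul_resCoeff b hij (by omega) h n
  rw [value_succ_of_eq_one wInf wFin hP him he]
  simp only [← mul_assoc, ← h1]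
  simp only [mul_assoc, ← Finset.mul_sum]
  ring

theorem prefactor_succ (b : ℂ) (j : ℕ) (h : Config N) :
    P.prefactor b (j + 1) h = b * dh P.η P.ξ h (P.lam (j + 1)) * P.prefactor b j h := by
  rw [prefactor, prefactor, Finset.prod_Icc_succ_top (by omega)]
  ring

/-- The action of one operator and the integration over the new outermost variables are the same
recursion on coefficients, with A producing the odd variable, D the even one, and B only the factor
b d_h(λ). -/
theorem Generic.stateOf_vecMul_Tbar (hP : P.Generic) {K : Matrix (Fin 2) (Fin 2) ℂ} {k₁ : ℂ}
    (hK : K.det ≠ 0) (hb : K 0 1 ≠ 0) (hk : k₁ ≠ 0) (ε : ℕ → Fin 2) {j : ℕ}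
    (hj : j + 1 ≤ P.m) :
    stateOf P.η P.ξ K k₁ (fun h => P.prefactor (K 0 1) j h *
      P.value (weightInf K) (weightFin K k₁ (K.det / k₁)) ε (2 * j) h) ᵥ*
        Tbar P.η P.ξ K (ε (2 * (j + 1))) (ε (2 * (j + 1) - 1)) (P.lam (j + 1)) =
      stateOf P.η P.ξ K k₁ fun h => P.prefactor (K 0 1) (j + 1) h *
        P.value (weightInf K) (weightFin K k₁ (K.det / k₁)) ε (2 * (j + 1)) h := by
  have hR := hP.regular hb hk
  have hl := hP.lam_ne_shifted (j := j + 1) (by omega) hj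
  have hl' := hP.lam_add_ne_shifted (j := j + 1) (by omega) hj
  have he : Even (2 * j + 1 + 1) := ⟨j + 1, by ring⟩
  have ho : ¬ Even (2 * j + 1) := Nat.not_even_iff_odd.2 ⟨j, rfl⟩
  have hidx : 2 * (j + 1) = 2 * j + 1 + 1 := by ring
  have hidx' : 2 * (j + 1) - 1 = 2 * j + 1 := by omega
  have hodd (he1 : ε (2 * j + 1) = 0) (h : Config N) :=
    hP.prefactor_mul_value_succ (weightInf K) (weightFin K k₁ (K.det / k₁)) (K 0 1) (ε := ε)
      (i := 2 * j) (j := j) (by omega) (by omega) (by simp [ebar, ho, he1]) h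
  have heven (he2 : ε (2 * j + 1 + 1) = 1) (h : Config N) :=
    hP.prefactor_mul_value_succ (weightInf K) (weightFin K k₁ (K.det / k₁)) (K 0 1) (ε := ε)
      (i := 2 * j + 1) (j := j) (by omega) (by omega) (by simp [ebar, he, he2]) h
  have hodd' (he1 : ε (2 * j + 1) = 1) (h : Config N) :=
    value_succ_of_eq_zero (P := P) (weightInf K) (weightFin K k₁ (K.det / k₁)) (ε := ε)
      (i := 2 * j) (by simp [ebar, ho, he1]) h
  have heven' (he2 : ε (2 * j + 1 + 1) = 0) (h : Config N) :=
    value_succ_of_eq_zero (P := P) (weightInf K) (weightFin K k₁ (K.det / k₁)) (ε := ε)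
      (i := 2 * j + 1) (by simp [ebar, he, he2]) h
  simp only [weightInf, weightFin, flip, if_neg ho] at hodd
  simp only [weightInf, weightFin, flip, if_pos he] at heven
  rw [hidx', hidx]
  rcases Fin.exists_fin_two.1 ⟨ε (2 * j + 1 + 1), rfl⟩ with h2 | h2 <;>
    rcases Fin.exists_fin_two.1 ⟨ε (2 * j + 1), rfl⟩ with h1 | h1
  · rw [h1, h2, Tbar, if_neg (by simp), hR.stateOf_vecMul_A hl]
    congr 1
    funext h
    rw [prefactor_succ, heven' h2, mul_assoc, hodd h1]
    field_simp
  · rw [h1, h2, Tbar, if_neg (by simp), hR.stateOf_vecMul_B]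
    congr 1
    funext h
    rw [prefactor_succ, heven' h2, hodd' h1, mul_assoc _ (prefactor _ _ _ _)]
  -- On a row vector B⁻¹ A acts first and adds the odd variable without a factor d_h; D then adds
  -- the even variable outside it and supplies the single factor d_h(λ).
  · rw [h1, h2, Tbar, if_pos ⟨rfl, rfl⟩, ← Matrix.vecMul_vecMul,
      hR.stateOf_vecMul_B_inv_mul_A hK hl hl', hR.stateOf_vecMul_D hl]
    congr 1
    funext h
    simp only [← hodd h1]
    rw [prefactor_succ, mul_assoc _ (prefactor _ _ _ _), heven h2]
    field_simp
  · rw [h1, h2, Tbar, if_neg (by simp), hR.stateOf_vecMul_D hl]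
    congr 1
    funext h
    rw [prefactor_succ, mul_assoc _ (prefactor _ _ _ _), heven h2]
    simp only [hodd' h1]
    field_simp

theorem Generic.separateState_vecMul_TbarProd (hP : P.Generic) {K : Matrix (Fin 2) (Fin 2) ℂ}
    {k₁ : ℂ} (hK : K.det ≠ 0) (hb : K 0 1 ≠ 0) (hk : k₁ ≠ 0) (ε : ℕ → Fin 2) {j : ℕ}
    (hj : j ≤ P.m) :
    separateState P.η P.ξ K k₁ P.q ᵥ* TbarProd P.η P.ξ K j ε P.lam =
      stateOf P.η P.ξ K k₁ fun h => P.prefactor (K 0 1) j h *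
        P.value (weightInf K) (weightFin K k₁ (K.det / k₁)) ε (2 * j) h := by
  induction j with
  | zero => simp [TbarProd, separateState, stateOf, prefactor, value_zero]
  | succ j ih =>
    have h1 : TbarProd P.η P.ξ K (j + 1) ε P.lam = TbarProd P.η P.ξ K j ε P.lam *
        Tbar P.η P.ξ K (ε (2 * (j + 1))) (ε (2 * (j + 1) - 1)) (P.lam (j + 1)) := by
      simp [TbarProd, List.range_succ]
    rw [h1, ← Matrix.vecMul_vecMul, ih (by omega), hP.stateOf_vecMul_Tbar hK hb hk ε hj]

end Params

end

end TwistedXXX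

/-! ### The multiple action formula -/

theorem mainTheorem9 (N m R : ℕ) (hR : R ≤ N)
    (η : ℂ) (hη : η ≠ 0)
    (ξ : Fin N → ℂ)
    (hξ : ∀ i j, i ≠ j → ξ i ≠ ξ j ∧ ξ i ≠ ξ j + η ∧ ξ i ≠ ξ j - η)
    (K : Matrix (Fin 2) (Fin 2) ℂ) (hK : K.det ≠ 0) (hb : K 0 1 ≠ 0)
    (k₁ k₂ : ℂ) (hk₁ : k₁ ^ 2 - k₁ * K.trace + K.det = 0) (hk₂ : k₂ = K.det / k₁)
    (q : Fin R → ℂ) (hq : ∀ k n, q k ≠ ξ n ∧ q k ≠ ξ n - η)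
    (lam : ℕ → ℂ)
    (hlam : ∀ j, 1 ≤ j → j ≤ m →
      ∀ n, lam j ≠ ξ n ∧ lam j ≠ ξ n - η ∧ lam j ≠ ξ n - 2 * η)
    (ε : ℕ → Fin 2)
    (C Γ : ℕ → (ℕ → ℂ) → TwistedXXX.Contour)
    (hC : ∀ i, 1 ≤ i → i ≤ 2 * m → TwistedXXX.ebar ε i = 1 → ∀ z : ℕ → ℂ,
      (C i z).SurroundsInfinity (TwistedXXX.polePoints η ξ q m ε lam i z))
    (hΓ : ∀ i, 1 ≤ i → i ≤ 2 * m → TwistedXXX.ebar ε i = 1 → ∀ z : ℕ → ℂ,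
      (Γ i z).Surrounds (TwistedXXX.insidePoints η ξ m ε i z)
        (TwistedXXX.polePoints η ξ q m ε lam i z)) :
    Matrix.vecMul (TwistedXXX.separateState η ξ K k₁ q) (TwistedXXX.TbarProd η ξ K m ε lam) =
      ∑ h : TwistedXXX.Config N,
        ((∏ j ∈ Finset.Icc 1 m, (K 0 1 * TwistedXXX.dh η ξ h (lam j))) *
          (∏ n, TwistedXXX.QFun q (TwistedXXX.shifted η ξ h n)) *
          TwistedXXX.nestedIntegral ε (TwistedXXX.weightInf K) (TwistedXXX.weightFin K k₁ k₂) C Γ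
            (TwistedXXX.integrand η ξ q m ε lam h) (2 * m) 0 *
          TwistedXXX.vandermondeProd (TwistedXXX.shifted η ξ h)) •
        TwistedXXX.bra η ξ K k₁ h := by
  have hk : k₁ ≠ 0 := by
    rintro rfl
    exact hK (by simpa using hk₁)
  have hP : (⟨η, ξ, q, lam, m⟩ : TwistedXXX.Params N R).Generic := ⟨hη, hξ, hq, hlam⟩
  subst hk₂
  rw [hP.separateState_vecMul_TbarProd hK hb hk ε le_rfl]
  refine Finset.sum_congr rfl fun h _ => ?_
  rw [TwistedXXX.Params.nestedIntegral_eq_value _ _ hP h ε C Γ hC hΓ]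
  rfl
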